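/- Let $\mathcal H'$ be the $\mathbb C$-linear monoidal category generated by two objects $\mathsf P$ (upward strand) and $\mathsf Q$ (downward strand), whose morphisms are generated by the crossing $\mathsf{PP}\to\mathsf{PP}$ of two upward strands and the four oriented cups and caps $\mathbf 1\to\mathsf{QP}$, $\mathbf 1\to\mathsf{PQ}$, $\mathsf{QP}\to\mathbf 1$, $\mathsf{PQ}\to\mathbf 1$. Diagrams are read from bottom to top and considered up to planar isotopy; crossings of the other orientations are obtained by rotating the upward crossing. The local relations are: the upward crossing squares to the identity and satisfies the braid relation; the composite $\mathsf{PQ}\to\mathsf{QP}\to\mathsf{PQ}$ of the two sideways crossings is the identity; the composite $\mathsf{QP}\to\mathsf{PQ}\to\mathsf{QP}$ is the identity minus the composite $\mathsf{QP}\to\mathbf 1\to\mathsf{QP}$ of cap and cup; a counterclockwise circle equals $1$; and a left curl on an upward strand equals $0$. Let $\mathcal H$, Khovanov's Heisenberg category, be the Karoubi envelope of the additive closure of $\mathcal H'$. Let $$\operatorname{Tr}(\mathcal H)=\Bigl(\bigoplus_{X\in\mathrm{Ob}(\mathcal H)}\operatorname{End}_{\mathcal H}(X)\Bigr)\Big/\operatorname{Span}_{\mathbb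 C}\{fg-gf\},$$ where $f\colon X\to Y$ and $g\colon Y\to X$ run through all such pairs of morphisms of $\mathcal H$. It is an algebra with product $[f][g]=[f\otimes g]$. For $w\in S_n$ let $f_w\in\operatorname{End}(\mathsf P^n)$ and $f_{-w}\in\operatorname{End}(\mathsf Q^n)$ be the diagrams of the permutation $w$ on $n$ upward, respectively $n$ downward, strands. For $n\ge 0$ put $$p^{(n)}\otimes 1=\frac1{n!}\sum_{w\in S_n}[f_w],\qquad q^{(n)}\otimes 1=\frac1{n!}\sum_{w\in S_n}[f_{-w}]\qquad\text{in }\operatorname{Tr}(\mathcal H).$$ **Theorem.** For all integers $n,m\ge 0$, in $\operatorname{Tr}(\mathcal H)$: $$(p^{(n)}\otimes 1)(p^{(m)}\otimes 1)=(p^{(m)}\otimes 1)(p^{(n)}\otimes 1),\qquad (q^{(n)}\otimes 1)(q^{(m)}\otimes 1)=(q^{(m)}\otimes 1)(q^{(n)}\otimes 1),$$ $$(q^{(n)}\otimes 1)(p^{(m)}\otimes 1)=\sum_{k=0}^{\min(m,n)}(p^{(m-k)}\otimes 1)(q^{(n-k)}\otimes 1).$$ -/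

import Mathlib

open CategoryTheory MonoidalCategory

noncomputable section

namespace Heisenberg

/-! ### The monoidal category `H'` by generators and relations -/

/-- Objects of `H'`: tensor words in the upward strand `P` and the downward strand `Q`. -/
inductive Obj : Type
  | P : Obj
  | Q : Obj
  | one : Obj
  | tensor : Obj → Obj → Obj

/-- Formal `ℂ`-linear combinations of formal string diagrams, read from bottom to top: composites
and tensor products of the upward crossing, the four oriented cups and caps, and the structural
morphisms of a monoidal category.  The name of a cup or cap lists its two ends from left to
right, so `cupQP` and `capQP` are counterclockwise, `cupPQ` and `capPQ` are clockwise. -/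
inductive Diag : Obj → Obj → Type
  | cross : Diag (.tensor .P .P) (.tensor .P .P)
  | cupQP : Diag .one (.tensor .Q .P)
  | capQP : Diag (.tensor .Q .P) .one
  | cupPQ : Diag .one (.tensor .P .Q)
  | capPQ : Diag (.tensor .P .Q) .one
  | ident (X : Obj) : Diag X X
  | comp {X Y Z : Obj} (f : Diag X Y) (g : Diag Y Z) : Diag X Z
  | tensor {X₁ Y₁ X₂ Y₂ : Obj} (f : Diag X₁ Y₁) (g : Diag X₂ Y₂) :
      Diag (.tensor X₁ X₂) (.tensor Y₁ Y₂)
  | assocHom (X Y Z : Obj) : Diag (.tensor (.tensor X Y) Z) (.tensor X (.tensor Y Z))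
  | assocInv (X Y Z : Obj) : Diag (.tensor X (.tensor Y Z)) (.tensor (.tensor X Y) Z)
  | leftHom (X : Obj) : Diag (.tensor .one X) X
  | leftInv (X : Obj) : Diag X (.tensor .one X)
  | rightHom (X : Obj) : Diag (.tensor X .one) X
  | rightInv (X : Obj) : Diag X (.tensor X .one)
  | zero (X Y : Obj) : Diag X Y
  | add {X Y : Obj} (f g : Diag X Y) : Diag X Y
  | smul {X Y : Obj} (c : ℂ) (f : Diag X Y) : Diag X Y

namespace Diag

/-- Counterclockwise quarter turn: the upper left end `P` is bent over to the left by a cap and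
the lower right end `P` is bent up to the right by a cup. -/
def rotL {A B : Obj} (g : Diag (.tensor A .P) (.tensor .P B)) :
    Diag (.tensor .Q A) (.tensor B .Q) :=
  (rightInv (.tensor .Q A)).comp <|
  ((ident (.tensor .Q A)).tensor cupPQ).comp <|
  (assocHom .Q A (.tensor .P .Q)).comp <|
  ((ident .Q).tensor
    ((assocInv A .P .Q).comp ((g.tensor (ident .Q)).comp (assocHom .P B .Q)))).comp <|
  (assocInv .Q .P (.tensor B .Q)).comp <|
  (capQP.tensor (ident (.tensor B .Q))).comp <|
  leftHom (.tensor B .Q)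

/-- Clockwise quarter turn: the lower left end `P` is bent up to the left by a cup and the upper
right end `P` is bent over to the right by a cap. -/
def rotR {A B : Obj} (g : Diag (.tensor .P A) (.tensor B .P)) :
    Diag (.tensor A .Q) (.tensor .Q B) :=
  (leftInv (.tensor A .Q)).comp <|
  (cupQP.tensor (ident (.tensor A .Q))).comp <|
  (assocHom .Q .P (.tensor A .Q)).comp <|
  ((ident .Q).tensor
    ((assocInv .P A .Q).comp ((g.tensor (ident .Q)).comp (assocHom B .P .Q)))).comp <|
  (assocInv .Q B (.tensor .P .Q)).comp <|
  ((ident (.tensor .Q B)).tensor capPQ).comp <|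
  rightHom (.tensor .Q B)

/-- The leftward sideways crossing `QP → PQ`. -/
def crossL : Diag (.tensor .Q .P) (.tensor .P .Q) := rotL cross

/-- The rightward sideways crossing `PQ → QP`. -/
def crossR : Diag (.tensor .P .Q) (.tensor .Q .P) := rotR cross

/-- The downward crossing. -/
def crossDown : Diag (.tensor .Q .Q) (.tensor .Q .Q) := rotL crossL

/-- The crossing of the first two of three upward strands. -/
def cross₁ : Diag (.tensor .P (.tensor .P .P)) (.tensor .P (.tensor .P .P)) :=
  (assocInv .P .P .P).comp ((cross.tensor (ident .P)).comp (assocHom .P .P .P))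

/-- The crossing of the last two of three upward strands. -/
def cross₂ : Diag (.tensor .P (.tensor .P .P)) (.tensor .P (.tensor .P .P)) :=
  (ident .P).tensor cross

/-- The left curl on an upward strand. -/
def leftCurl : Diag .P .P :=
  (leftInv .P).comp <|
  (cupQP.tensor (ident .P)).comp <|
  (assocHom .Q .P .P).comp <|
  ((ident .Q).tensor cross).comp <|
  (assocInv .Q .P .P).comp <|
  (capQP.tensor (ident .P)).comp <|
  leftHom .P

end Diag

open Diag in
/-- The relations of `H'`: the axioms of a `ℂ`-linear monoidal category, planar isotopy
(the zigzag relations and the invariance of the crossing under a full turn), and the local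
relations. -/
inductive Rel : ∀ {X Y : Obj}, Diag X Y → Diag X Y → Prop
  -- congruence
  | refl {X Y : Obj} (f : Diag X Y) : Rel f f
  | symm {X Y : Obj} {f g : Diag X Y} : Rel f g → Rel g f
  | trans {X Y : Obj} {f g h : Diag X Y} : Rel f g → Rel g h → Rel f h
  | comp {X Y Z : Obj} {f f' : Diag X Y} {g g' : Diag Y Z} :
      Rel f f' → Rel g g' → Rel (f.comp g) (f'.comp g')
  | tensor {X₁ Y₁ X₂ Y₂ : Obj} {f f' : Diag X₁ Y₁} {g g' : Diag X₂ Y₂} :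
      Rel f f' → Rel g g' → Rel (f.tensor g) (f'.tensor g')
  | add {X Y : Obj} {f f' g g' : Diag X Y} : Rel f f' → Rel g g' → Rel (f.add g) (f'.add g')
  | smul {X Y : Obj} (c : ℂ) {f f' : Diag X Y} : Rel f f' → Rel (f.smul c) (f'.smul c)
  -- vector space axioms
  | add_assoc {X Y : Obj} (f g h : Diag X Y) : Rel ((f.add g).add h) (f.add (g.add h))
  | add_comm {X Y : Obj} (f g : Diag X Y) : Rel (f.add g) (g.add f)
  | zero_add {X Y : Obj} (f : Diag X Y) : Rel ((zero X Y).add f) f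
  | one_smul {X Y : Obj} (f : Diag X Y) : Rel (f.smul 1) f
  | mul_smul {X Y : Obj} (c d : ℂ) (f : Diag X Y) : Rel (f.smul (c * d)) ((f.smul d).smul c)
  | smul_add {X Y : Obj} (c : ℂ) (f g : Diag X Y) :
      Rel ((f.add g).smul c) ((f.smul c).add (g.smul c))
  | add_smul {X Y : Obj} (c d : ℂ) (f : Diag X Y) :
      Rel (f.smul (c + d)) ((f.smul c).add (f.smul d))
  | zero_smul {X Y : Obj} (f : Diag X Y) : Rel (f.smul 0) (zero X Y)
  -- bilinearity of composition and of the tensor product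
  | add_comp {X Y Z : Obj} (f f' : Diag X Y) (g : Diag Y Z) :
      Rel ((f.add f').comp g) ((f.comp g).add (f'.comp g))
  | comp_add {X Y Z : Obj} (f : Diag X Y) (g g' : Diag Y Z) :
      Rel (f.comp (g.add g')) ((f.comp g).add (f.comp g'))
  | smul_comp {X Y Z : Obj} (c : ℂ) (f : Diag X Y) (g : Diag Y Z) :
      Rel ((f.smul c).comp g) ((f.comp g).smul c)
  | comp_smul {X Y Z : Obj} (c : ℂ) (f : Diag X Y) (g : Diag Y Z) :
      Rel (f.comp (g.smul c)) ((f.comp g).smul c)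
  | add_tensor {X₁ Y₁ X₂ Y₂ : Obj} (f f' : Diag X₁ Y₁) (g : Diag X₂ Y₂) :
      Rel ((f.add f').tensor g) ((f.tensor g).add (f'.tensor g))
  | tensor_add {X₁ Y₁ X₂ Y₂ : Obj} (f : Diag X₁ Y₁) (g g' : Diag X₂ Y₂) :
      Rel (f.tensor (g.add g')) ((f.tensor g).add (f.tensor g'))
  | smul_tensor {X₁ Y₁ X₂ Y₂ : Obj} (c : ℂ) (f : Diag X₁ Y₁) (g : Diag X₂ Y₂) :
      Rel ((f.smul c).tensor g) ((f.tensor g).smul c)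
  | tensor_smul {X₁ Y₁ X₂ Y₂ : Obj} (c : ℂ) (f : Diag X₁ Y₁) (g : Diag X₂ Y₂) :
      Rel (f.tensor (g.smul c)) ((f.tensor g).smul c)
  -- axioms of a monoidal category
  | id_comp {X Y : Obj} (f : Diag X Y) : Rel ((ident X).comp f) f
  | comp_id {X Y : Obj} (f : Diag X Y) : Rel (f.comp (ident Y)) f
  | assoc {W X Y Z : Obj} (f : Diag W X) (g : Diag X Y) (h : Diag Y Z) :
      Rel ((f.comp g).comp h) (f.comp (g.comp h))
  | id_tensor_id (X Y : Obj) : Rel ((ident X).tensor (ident Y)) (ident (.tensor X Y))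
  | tensor_comp_tensor {X₁ Y₁ Z₁ X₂ Y₂ Z₂ : Obj} (f₁ : Diag X₁ Y₁) (f₂ : Diag X₂ Y₂)
      (g₁ : Diag Y₁ Z₁) (g₂ : Diag Y₂ Z₂) :
      Rel ((f₁.tensor f₂).comp (g₁.tensor g₂)) ((f₁.comp g₁).tensor (f₂.comp g₂))
  | assocHom_inv (X Y Z : Obj) : Rel ((assocHom X Y Z).comp (assocInv X Y Z)) (ident _)
  | assocInv_hom (X Y Z : Obj) : Rel ((assocInv X Y Z).comp (assocHom X Y Z)) (ident _)
  | assoc_naturality {X₁ X₂ X₃ Y₁ Y₂ Y₃ : Obj}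
      (f₁ : Diag X₁ Y₁) (f₂ : Diag X₂ Y₂) (f₃ : Diag X₃ Y₃) :
      Rel (((f₁.tensor f₂).tensor f₃).comp (assocHom Y₁ Y₂ Y₃))
        ((assocHom X₁ X₂ X₃).comp (f₁.tensor (f₂.tensor f₃)))
  | leftHom_inv (X : Obj) : Rel ((leftHom X).comp (leftInv X)) (ident _)
  | leftInv_hom (X : Obj) : Rel ((leftInv X).comp (leftHom X)) (ident _)
  | left_naturality {X Y : Obj} (f : Diag X Y) :
      Rel (((ident .one).tensor f).comp (leftHom Y)) ((leftHom X).comp f)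
  | rightHom_inv (X : Obj) : Rel ((rightHom X).comp (rightInv X)) (ident _)
  | rightInv_hom (X : Obj) : Rel ((rightInv X).comp (rightHom X)) (ident _)
  | right_naturality {X Y : Obj} (f : Diag X Y) :
      Rel ((f.tensor (ident .one)).comp (rightHom Y)) ((rightHom X).comp f)
  | pentagon (W X Y Z : Obj) :
      Rel (((assocHom W X Y).tensor (ident Z)).comp
          ((assocHom W (.tensor X Y) Z).comp ((ident W).tensor (assocHom X Y Z))))
        ((assocHom (.tensor W X) Y Z).comp (assocHom W X (.tensor Y Z)))
  | triangle (X Y : Obj) :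
      Rel ((assocHom X .one Y).comp ((ident X).tensor (leftHom Y))) ((rightHom X).tensor (ident Y))
  -- planar isotopy
  | zigzag_P_left : Rel
      ((rightInv .P).comp (((ident .P).tensor cupQP).comp ((assocInv .P .Q .P).comp
        ((capPQ.tensor (ident .P)).comp (leftHom .P))))) (ident .P)
  | zigzag_P_right : Rel
      ((leftInv .P).comp ((cupPQ.tensor (ident .P)).comp ((assocHom .P .Q .P).comp
        (((ident .P).tensor capQP).comp (rightHom .P))))) (ident .P)
  | zigzag_Q_left : Rel
      ((rightInv .Q).comp (((ident .Q).tensor cupPQ).comp ((assocInv .Q .P .Q).comp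
        ((capQP.tensor (ident .Q)).comp (leftHom .Q))))) (ident .Q)
  | zigzag_Q_right : Rel
      ((leftInv .Q).comp ((cupQP.tensor (ident .Q)).comp ((assocHom .Q .P .Q).comp
        (((ident .Q).tensor capPQ).comp (rightHom .Q))))) (ident .Q)
  | cross_cyclic : Rel (rotL (rotL cross)) (rotR (rotR cross))
  -- local relations
  | cross_cross : Rel (cross.comp cross) (ident (.tensor .P .P))
  | braid : Rel (cross₁.comp (cross₂.comp cross₁)) (cross₂.comp (cross₁.comp cross₂))
  | crossL_crossR : Rel (crossL.comp crossR)
      ((ident (.tensor .Q .P)).add ((capQP.comp cupQP).smul (-1)))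
  | crossR_crossL : Rel (crossR.comp crossL) (ident (.tensor .P .Q))
  | circle : Rel (cupQP.comp capQP) (ident .one)
  | curl : Rel leftCurl (zero .P .P)

/-- The equivalence relation on formal diagrams generated by the relations. -/
instance diagSetoid (X Y : Obj) : Setoid (Diag X Y) := ⟨Rel, ⟨Rel.refl, Rel.symm, Rel.trans⟩⟩

/-- The category `H'`. -/
instance : Category Obj where
  Hom X Y := Quotient (diagSetoid X Y)
  id X := Quotient.mk (diagSetoid X X) (Diag.ident X)
  comp := Quotient.map₂ Diag.comp fun _ _ hf _ _ hg => Rel.comp hf hg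
  id_comp := by
    rintro X Y ⟨f⟩
    exact Quotient.sound (Rel.id_comp f)
  comp_id := by
    rintro X Y ⟨f⟩
    exact Quotient.sound (Rel.comp_id f)
  assoc := by
    rintro W X Y Z ⟨f⟩ ⟨g⟩ ⟨h⟩
    exact Quotient.sound (Rel.assoc f g h)

/-- The morphism of `H'` represented by a formal diagram. -/
def mk {X Y : Obj} (f : Diag X Y) : X ⟶ Y := Quotient.mk (diagSetoid X Y) f

instance (X Y : Obj) : Zero (X ⟶ Y) where
  zero := mk (Diag.zero X Y)

instance (X Y : Obj) : Add (X ⟶ Y) where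
  add := Quotient.map₂ Diag.add fun _ _ hf _ _ hg => Rel.add hf hg

instance (X Y : Obj) : Neg (X ⟶ Y) where
  neg := Quotient.map (Diag.smul (-1)) fun _ _ hf => Rel.smul (-1) hf

instance (X Y : Obj) : SMul ℂ (X ⟶ Y) where
  smul c := Quotient.map (Diag.smul c) fun _ _ hf => Rel.smul c hf

instance (X Y : Obj) : AddCommGroup (X ⟶ Y) where
  add_assoc := by
    rintro ⟨f⟩ ⟨g⟩ ⟨h⟩
    exact Quotient.sound (Rel.add_assoc f g h)
  add_comm := by
    rintro ⟨f⟩ ⟨g⟩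
    exact Quotient.sound (Rel.add_comm f g)
  zero_add := by
    rintro ⟨f⟩
    exact Quotient.sound (Rel.zero_add f)
  add_zero := by
    rintro ⟨f⟩
    exact Quotient.sound ((Rel.add_comm _ _).trans (Rel.zero_add f))
  neg_add_cancel := by
    rintro ⟨f⟩
    refine Quotient.sound (((Rel.refl _).add (Rel.one_smul f).symm).trans ?_)
    refine (Rel.add_smul (-1) 1 f).symm.trans ?_
    rw [neg_add_cancel]
    exact Rel.zero_smul f
  nsmul := nsmulRec
  zsmul := zsmulRec

instance (X Y : Obj) : Module ℂ (X ⟶ Y) where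
  one_smul := by
    rintro ⟨f⟩
    exact Quotient.sound (Rel.one_smul f)
  mul_smul := by
    rintro c d ⟨f⟩
    exact Quotient.sound (Rel.mul_smul c d f)
  smul_add := by
    rintro c ⟨f⟩ ⟨g⟩
    exact Quotient.sound (Rel.smul_add c f g)
  add_smul := by
    rintro c d ⟨f⟩
    exact Quotient.sound (Rel.add_smul c d f)
  zero_smul := by
    rintro ⟨f⟩
    exact Quotient.sound (Rel.zero_smul f)
  smul_zero := by
    intro c
    refine Quotient.sound ?_
    refine (Rel.smul c (Rel.zero_smul (Diag.zero X Y)).symm).trans ?_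
    refine (Rel.mul_smul c 0 _).symm.trans ?_
    rw [mul_zero]
    exact Rel.zero_smul _

instance : Preadditive Obj where
  add_comp := by
    rintro X Y Z ⟨f⟩ ⟨f'⟩ ⟨g⟩
    exact Quotient.sound (Rel.add_comp f f' g)
  comp_add := by
    rintro X Y Z ⟨f⟩ ⟨g⟩ ⟨g'⟩
    exact Quotient.sound (Rel.comp_add f g g')

instance : Linear ℂ Obj where
  smul_comp := by
    rintro X Y Z c ⟨f⟩ ⟨g⟩
    exact Quotient.sound (Rel.smul_comp c f g)
  comp_smul := by
    rintro X Y Z ⟨f⟩ c ⟨g⟩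
    exact Quotient.sound (Rel.comp_smul c f g)

instance : MonoidalCategoryStruct Obj where
  tensorObj := Obj.tensor
  tensorUnit := Obj.one
  tensorHom := Quotient.map₂ Diag.tensor fun _ _ hf _ _ hg => Rel.tensor hf hg
  whiskerLeft X _ _ := Quotient.map (Diag.tensor (Diag.ident X)) fun _ _ hf =>
    Rel.tensor (Rel.refl _) hf
  whiskerRight f Y := Quotient.map (fun f => Diag.tensor f (Diag.ident Y))
    (fun _ _ hf => Rel.tensor hf (Rel.refl _)) f
  associator X Y Z := ⟨mk (Diag.assocHom X Y Z), mk (Diag.assocInv X Y Z),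
    Quotient.sound (Rel.assocHom_inv X Y Z), Quotient.sound (Rel.assocInv_hom X Y Z)⟩
  leftUnitor X := ⟨mk (Diag.leftHom X), mk (Diag.leftInv X),
    Quotient.sound (Rel.leftHom_inv X), Quotient.sound (Rel.leftInv_hom X)⟩
  rightUnitor X := ⟨mk (Diag.rightHom X), mk (Diag.rightInv X),
    Quotient.sound (Rel.rightHom_inv X), Quotient.sound (Rel.rightInv_hom X)⟩

/-- The monoidal structure of `H'`: horizontal juxtaposition of diagrams. -/
instance : MonoidalCategory Obj :=
  MonoidalCategory.ofTensorHom
    (id_tensorHom_id := fun X Y => Quotient.sound (Rel.id_tensor_id X Y))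
    (id_tensorHom := by
      rintro X Y₁ Y₂ ⟨f⟩
      rfl)
    (tensorHom_id := by
      rintro X₁ X₂ ⟨f⟩ Y
      rfl)
    (tensorHom_comp_tensorHom := by
      rintro X₁ Y₁ Z₁ X₂ Y₂ Z₂ ⟨f₁⟩ ⟨f₂⟩ ⟨g₁⟩ ⟨g₂⟩
      exact Quotient.sound (Rel.tensor_comp_tensor f₁ f₂ g₁ g₂))
    (associator_naturality := by
      rintro X₁ X₂ X₃ Y₁ Y₂ Y₃ ⟨f₁⟩ ⟨f₂⟩ ⟨f₃⟩
      exact Quotient.sound (Rel.assoc_naturality f₁ f₂ f₃))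
    (leftUnitor_naturality := by
      rintro X Y ⟨f⟩
      exact Quotient.sound (Rel.left_naturality f))
    (rightUnitor_naturality := by
      rintro X Y ⟨f⟩
      exact Quotient.sound (Rel.right_naturality f))
    (pentagon := fun W X Y Z => Quotient.sound (Rel.pentagon W X Y Z))
    (triangle := fun X Y => Quotient.sound (Rel.triangle X Y))

instance : MonoidalPreadditive Obj where
  whiskerLeft_zero := by
    intro X Y Z
    refine Quotient.sound (((Rel.refl _).tensor (Rel.zero_smul (Diag.zero Y Z)).symm).trans ?_)
    exact (Rel.tensor_smul 0 _ _).trans (Rel.zero_smul _)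
  zero_whiskerRight := by
    intro X Y Z
    refine Quotient.sound (((Rel.zero_smul (Diag.zero Y Z)).symm.tensor (Rel.refl _)).trans ?_)
    exact (Rel.smul_tensor 0 _ _).trans (Rel.zero_smul _)
  whiskerLeft_add := by
    rintro X Y Z ⟨f⟩ ⟨g⟩
    exact Quotient.sound (Rel.tensor_add _ f g)
  add_whiskerRight := by
    rintro X Y Z ⟨f⟩ ⟨g⟩
    exact Quotient.sound (Rel.add_tensor f g _)

instance : MonoidalLinear ℂ Obj where
  whiskerLeft_smul := by
    rintro X Y Z c ⟨f⟩
    exact Quotient.sound (Rel.tensor_smul c _ f)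
  smul_whiskerRight := by
    rintro c Y Z ⟨f⟩ X
    exact Quotient.sound (Rel.smul_tensor c f _)

/-! ### Additive closure of a linear monoidal category -/

section Additive

variable {C : Type*} [Category C] [Preadditive C]

instance matLinear (k : Type*) [Semiring k] [Linear k C] : Linear k (Mat_ C) where
  homModule M N := inferInstanceAs (Module k (∀ (i : M.ι) (j : N.ι), M.X i ⟶ N.X j))
  smul_comp M N K r f g := by
    ext i j
    exact (Finset.sum_congr rfl fun l _ => Linear.smul_comp _ _ _ r (f i l) (g l j)).trans
      Finset.smul_sum.symm
  comp_smul M N K f r g := by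
    ext i j
    exact (Finset.sum_congr rfl fun l _ => Linear.comp_smul _ _ _ (f i l) r (g l j)).trans
      Finset.smul_sum.symm

/-- The morphism of tuples given by a map `e` of index sets and morphisms `X i ⟶ Y (e i)`. -/
def reindex {M N : Mat_ C} (e : M.ι → N.ι) (φ : ∀ i, M.X i ⟶ N.X (e i)) : M ⟶ N :=
  fun i j => by
    classical exact if h : e i = j then φ i ≫ eqToHom (congrArg N.X h) else 0

theorem reindex_self {M N : Mat_ C} (e : M.ι → N.ι) (φ : ∀ i, M.X i ⟶ N.X (e i)) (i : M.ι) :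
    reindex e φ i (e i) = φ i := by
  simp [reindex]

theorem reindex_of_ne {M N : Mat_ C} (e : M.ι → N.ι) (φ : ∀ i, M.X i ⟶ N.X (e i))
    {i : M.ι} {j : N.ι} (h : e i ≠ j) : reindex e φ i j = 0 := by
  simp [reindex, h]

theorem reindex_comp_apply {M N K : Mat_ C} (e : M.ι → N.ι) (φ : ∀ i, M.X i ⟶ N.X (e i))
    (f : N ⟶ K) (i : M.ι) (l : K.ι) : (reindex e φ ≫ f) i l = φ i ≫ f (e i) l := by
  rw [Mat_.comp_apply, Finset.sum_eq_single (e i), reindex_self]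
  · intro j _ hj
    rw [reindex_of_ne e φ hj.symm, Limits.zero_comp]
  · simp

theorem comp_reindex_apply {M N K : Mat_ C} (e : N.ι → K.ι) (he : Function.Injective e)
    (φ : ∀ j, N.X j ⟶ K.X (e j)) (f : M ⟶ N) (i : M.ι) (j : N.ι) :
    (f ≫ reindex e φ) i (e j) = f i j ≫ φ j := by
  rw [Mat_.comp_apply, Finset.sum_eq_single j, reindex_self]
  · intro l _ hl
    rw [reindex_of_ne e φ (he.ne hl), Limits.comp_zero]
  · simp

theorem reindex_comp_reindex {M N K : Mat_ C} (e : M.ι → N.ι) (φ : ∀ i, M.X i ⟶ N.X (e i))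
    (e' : N.ι → K.ι) (φ' : ∀ j, N.X j ⟶ K.X (e' j)) :
    reindex e φ ≫ reindex e' φ' =
      reindex (N := K) (fun i => e' (e i)) (fun i => φ i ≫ φ' (e i)) := by
  ext i l
  rw [reindex_comp_apply]
  by_cases h : e' (e i) = l
  · subst h
    rw [reindex_self, reindex_self (fun i => e' (e i))]
  · rw [reindex_of_ne e' φ' h, Limits.comp_zero,
      reindex_of_ne (N := K) (fun i => e' (e i)) (fun i => φ i ≫ φ' (e i)) h]

theorem reindex_id (M : Mat_ C) : reindex (M := M) (N := M) (fun i => i) (fun _ => 𝟙 _) = 𝟙 M := by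
  ext i j
  by_cases h : i = j
  · subst h
    rw [reindex_self (M := M) (N := M) (fun i => i), Mat_.id_apply_self]
  · rw [reindex_of_ne (M := M) (N := M) (fun i => i) _ h, Mat_.id_apply_of_ne _ _ _ h]

variable [MonoidalCategory C]

/-- The tensor product of matrices of morphisms (Kronecker product). -/
def matTensorHom {M M' N N' : Mat_ C} (f : M ⟶ N) (g : M' ⟶ N') :
    (Mat_.mk (M.ι × M'.ι) fun p => M.X p.1 ⊗ M'.X p.2) ⟶
      Mat_.mk (N.ι × N'.ι) fun p => N.X p.1 ⊗ N'.X p.2 :=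
  fun p q => f p.1 q.1 ⊗ₘ g p.2 q.2

instance matMonoidalStruct : MonoidalCategoryStruct (Mat_ C) where
  tensorObj M N := ⟨M.ι × N.ι, fun p => M.X p.1 ⊗ N.X p.2⟩
  tensorUnit := ⟨Unit, fun _ => 𝟙_ C⟩
  tensorHom f g := matTensorHom f g
  whiskerLeft M _ _ f := matTensorHom (𝟙 M) f
  whiskerRight f M := matTensorHom f (𝟙 M)
  associator L M N :=
    { hom := reindex (fun p => (p.1.1, (p.1.2, p.2)))
        (fun p => (α_ (L.X p.1.1) (M.X p.1.2) (N.X p.2)).hom)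
      inv := reindex (fun p => ((p.1, p.2.1), p.2.2))
        (fun p => (α_ (L.X p.1) (M.X p.2.1) (N.X p.2.2)).inv)
      hom_inv_id := by
        rw [reindex_comp_reindex, ← reindex_id]
        simp only [Iso.hom_inv_id]
      inv_hom_id := by
        rw [reindex_comp_reindex, ← reindex_id]
        simp only [Iso.inv_hom_id] }
  leftUnitor M :=
    { hom := reindex (fun p => p.2) (fun p => (λ_ (M.X p.2)).hom)
      inv := reindex (fun i => ((), i)) (fun i => (λ_ (M.X i)).inv)
      hom_inv_id := by
        rw [reindex_comp_reindex, ← reindex_id]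
        simp only [Iso.hom_inv_id]
      inv_hom_id := by
        rw [reindex_comp_reindex, ← reindex_id]
        simp only [Iso.inv_hom_id] }
  rightUnitor M :=
    { hom := reindex (fun p => p.1) (fun p => (ρ_ (M.X p.1)).hom)
      inv := reindex (fun i => (i, ())) (fun i => (ρ_ (M.X i)).inv)
      hom_inv_id := by
        rw [reindex_comp_reindex, ← reindex_id]
        simp only [Iso.hom_inv_id]
      inv_hom_id := by
        rw [reindex_comp_reindex, ← reindex_id]
        simp only [Iso.inv_hom_id] }

theorem matTensorHom_apply {M M' N N' : Mat_ C} (f : M ⟶ N) (g : M' ⟶ N')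
    (p : M.ι × M'.ι) (q : N.ι × N'.ι) : (f ⊗ₘ g) p q = f p.1 q.1 ⊗ₘ g p.2 q.2 := rfl

theorem mat_associator_hom (L M N : Mat_ C) :
    (α_ L M N).hom = reindex (M := (L ⊗ M) ⊗ N) (N := L ⊗ M ⊗ N) (fun p => (p.1.1, (p.1.2, p.2)))
      (fun p => (α_ (L.X p.1.1) (M.X p.1.2) (N.X p.2)).hom) := rfl

theorem mat_leftUnitor_hom (M : Mat_ C) :
    (λ_ M).hom = reindex (M := 𝟙_ _ ⊗ M) (N := M) (fun p => p.2)
      (fun p => (λ_ (M.X p.2)).hom) := rfl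

theorem mat_rightUnitor_hom (M : Mat_ C) :
    (ρ_ M).hom = reindex (M := M ⊗ 𝟙_ _) (N := M) (fun p => p.1)
      (fun p => (ρ_ (M.X p.1)).hom) := rfl

variable [MonoidalPreadditive C]

theorem reindex_tensor_reindex {M M' N N' : Mat_ C} (e : M.ι → N.ι) (φ : ∀ i, M.X i ⟶ N.X (e i))
    (e' : M'.ι → N'.ι) (φ' : ∀ i, M'.X i ⟶ N'.X (e' i)) :
    reindex e φ ⊗ₘ reindex e' φ' =
      reindex (M := M ⊗ M') (N := N ⊗ N') (fun p => (e p.1, e' p.2))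
        (fun p => φ p.1 ⊗ₘ φ' p.2) := by
  ext ⟨i, i'⟩ ⟨j, j'⟩
  rw [matTensorHom_apply]
  by_cases h : e i = j
  · by_cases h' : e' i' = j'
    · subst h h'
      rw [reindex_self, reindex_self]
      exact (reindex_self (M := M ⊗ M') (N := N ⊗ N') (fun p => (e p.1, e' p.2))
        (fun p => φ p.1 ⊗ₘ φ' p.2) (i, i')).symm
    · rw [reindex_of_ne e' φ' h', MonoidalPreadditive.tensor_zero]
      exact (reindex_of_ne (M := M ⊗ M') (N := N ⊗ N') _ _
        (fun hh => h' (congrArg Prod.snd hh))).symm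
  · rw [reindex_of_ne e φ h, MonoidalPreadditive.zero_tensor]
    exact (reindex_of_ne (M := M ⊗ M') (N := N ⊗ N') _ _
      (fun hh => h (congrArg Prod.fst hh))).symm

/-- The tensor product of tuples is the tuple of all pairwise tensor products. -/
instance matMonoidal : MonoidalCategory (Mat_ C) :=
  MonoidalCategory.ofTensorHom
    (id_tensorHom_id := fun M N => by
      rw [← reindex_id, ← reindex_id, reindex_tensor_reindex, ← reindex_id]
      congr 1
      funext p
      exact id_tensorHom_id _ _)
    (id_tensorHom := fun _ _ _ _ => rfl)
    (tensorHom_id := fun _ _ => rfl)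
    (tensorHom_comp_tensorHom := fun {M N K M' N' K'} f f' g g' => by
      ext ⟨i, i'⟩ ⟨l, l'⟩
      rw [matTensorHom_apply, Mat_.comp_apply, Mat_.comp_apply, Mat_.comp_apply, sum_tensor]
      simp only [tensor_sum]
      refine (Fintype.sum_prod_type _).trans ?_
      refine Finset.sum_congr rfl fun j _ => Finset.sum_congr rfl fun j' _ => ?_
      exact tensorHom_comp_tensorHom _ _ _ _)
    (associator_naturality := fun {M₁ M₂ M₃ N₁ N₂ N₃} f g h => by
      ext ⟨⟨i, i'⟩, i''⟩ ⟨j, j', j''⟩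
      refine (comp_reindex_apply (M := (M₁ ⊗ M₂) ⊗ M₃) (N := (N₁ ⊗ N₂) ⊗ N₃)
        (K := N₁ ⊗ N₂ ⊗ N₃) (fun p => (p.1.1, (p.1.2, p.2))) ?_ _ _ _ ((j, j'), j'')).trans ?_
      · rintro ⟨⟨a, b⟩, c⟩ ⟨⟨a', b'⟩, c'⟩ hh
        cases hh
        rfl
      · refine Eq.trans ?_ (reindex_comp_apply (M := (M₁ ⊗ M₂) ⊗ M₃) (N := M₁ ⊗ M₂ ⊗ M₃)
          _ _ _ _ _).symm
        exact associator_naturality _ _ _)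
    (leftUnitor_naturality := fun {M N} f => by
      ext ⟨u, i⟩ j
      refine (comp_reindex_apply (M := 𝟙_ _ ⊗ M) (N := 𝟙_ _ ⊗ N) (K := N)
        (fun p => p.2) ?_ _ _ _ ((), j)).trans ?_
      · rintro ⟨⟨⟩, a⟩ ⟨⟨⟩, b⟩ hh
        exact congrArg (Prod.mk ()) hh
      · refine Eq.trans ?_ (reindex_comp_apply (M := 𝟙_ _ ⊗ M) (N := M) _ _ _ _ _).symm
        have := leftUnitor_naturality (f i j)
        rw [← id_tensorHom] at this
        refine Eq.trans ?_ this
        rw [matTensorHom_apply]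
        congr 2
        exact Mat_.id_apply_self _ _)
    (rightUnitor_naturality := fun {M N} f => by
      ext ⟨i, u⟩ j
      refine (comp_reindex_apply (M := M ⊗ 𝟙_ _) (N := N ⊗ 𝟙_ _) (K := N)
        (fun p => p.1) ?_ _ _ _ (j, ())).trans ?_
      · rintro ⟨a, ⟨⟩⟩ ⟨b, ⟨⟩⟩ hh
        exact congrArg (fun x => (x, ())) hh
      · refine Eq.trans ?_ (reindex_comp_apply (M := M ⊗ 𝟙_ _) (N := M) _ _ _ _ _).symm
        have := rightUnitor_naturality (f i j)
        rw [← tensorHom_id] at this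
        refine Eq.trans ?_ this
        rw [matTensorHom_apply]
        congr 2
        exact Mat_.id_apply_self _ _)
    (pentagon := fun K L M N => by
      simp only [mat_associator_hom, ← reindex_id, reindex_tensor_reindex, reindex_comp_reindex]
      congr 1
      funext p
      simp only [id_tensorHom, tensorHom_id]
      exact pentagon (K.X p.1.1.1) (L.X p.1.1.2) (M.X p.1.2) (N.X p.2))
    (triangle := fun M N => by
      simp only [mat_associator_hom, mat_leftUnitor_hom, mat_rightUnitor_hom, ← reindex_id,
        reindex_tensor_reindex, reindex_comp_reindex]
      congr 1
      funext p
      simp only [id_tensorHom, tensorHom_id]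
      exact triangle (M.X p.1.1) (N.X p.2))

instance matMonoidalPreadditive : MonoidalPreadditive (Mat_ C) where
  whiskerLeft_zero := by
    intros
    ext p q
    exact MonoidalPreadditive.tensor_zero _
  zero_whiskerRight := by
    intros
    ext p q
    exact MonoidalPreadditive.zero_tensor _
  whiskerLeft_add := by
    intros
    ext p q
    exact MonoidalPreadditive.tensor_add _ _ _
  add_whiskerRight := by
    intros
    ext p q
    exact MonoidalPreadditive.add_tensor _ _ _

instance matMonoidalLinear (k : Type*) [Semiring k] [Linear k C] [MonoidalLinear k C] :
    MonoidalLinear k (Mat_ C) where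
  whiskerLeft_smul M N K r f := by
    ext p q
    change (𝟙 M : M ⟶ M) p.1 q.1 ⊗ₘ (r • f p.2 q.2) = r • ((𝟙 M : M ⟶ M) p.1 q.1 ⊗ₘ f p.2 q.2)
    simp only [MonoidalCategory.tensorHom_def, MonoidalLinear.whiskerLeft_smul, Linear.comp_smul]
  smul_whiskerRight r M N f K := by
    ext p q
    change (r • f p.1 q.1) ⊗ₘ (𝟙 K : K ⟶ K) p.2 q.2 = r • (f p.1 q.1 ⊗ₘ (𝟙 K : K ⟶ K) p.2 q.2)
    simp only [MonoidalCategory.tensorHom_def, MonoidalLinear.smul_whiskerRight, Linear.smul_comp]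

end Additive

/-! ### Idempotent completion of a linear monoidal category -/

section Idempotent

open Idempotents

variable {C : Type*} [Category C]

instance karoubiLinear [Preadditive C] (k : Type*) [Semiring k] [Linear k C] :
    Linear k (Karoubi C) where
  homModule X Y :=
    { smul := fun r f => ⟨r • f.f, by rw [Linear.smul_comp, Linear.comp_smul, f.comm]⟩
      one_smul := fun f => Karoubi.hom_ext _ _ (one_smul k f.f)
      mul_smul := fun r s f => Karoubi.hom_ext _ _ (mul_smul r s f.f)
      smul_zero := fun r => Karoubi.hom_ext _ _ (smul_zero r)
      smul_add := fun r f g => Karoubi.hom_ext _ _ (smul_add r f.f g.f)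
      add_smul := fun r s f => Karoubi.hom_ext _ _ (add_smul r s f.f)
      zero_smul := fun f => Karoubi.hom_ext _ _ (zero_smul k f.f) }
  smul_comp _ _ _ r f g := Karoubi.hom_ext _ _ (Linear.smul_comp _ _ _ r f.f g.f)
  comp_smul _ _ _ f r g := Karoubi.hom_ext _ _ (Linear.comp_smul _ _ _ f.f r g.f)

/-- An isomorphism of underlying objects that commutes with the idempotents. -/
def karoubiIso {X Y : Karoubi C} (a : X.X ≅ Y.X) (h : X.p ≫ a.hom = a.hom ≫ Y.p) : X ≅ Y where
  hom := ⟨X.p ≫ a.hom, by rw [Category.assoc, ← h, ← Category.assoc, ← Category.assoc, X.idem,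
    X.idem]⟩
  inv := ⟨a.inv ≫ X.p, by
    have h' : Y.p ≫ a.inv = a.inv ≫ X.p := by
      rw [Iso.eq_inv_comp, ← Category.assoc, ← h, Category.assoc, a.hom_inv_id, Category.comp_id]
    rw [Category.assoc, X.idem, ← Category.assoc, h', Category.assoc, X.idem]⟩
  hom_inv_id := by
    ext
    simp
  inv_hom_id := by
    ext
    change (a.inv ≫ X.p) ≫ X.p ≫ a.hom = Y.p
    rw [Category.assoc, ← Category.assoc X.p, X.idem, h, a.inv_hom_id_assoc]

variable [MonoidalCategory C]

/-- The tensor product of objects of the idempotent completion. -/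
def karoubiTensorObj (X Y : Karoubi C) : Karoubi C :=
  ⟨X.X ⊗ Y.X, X.p ⊗ₘ Y.p, by simp only [tensorHom_comp_tensorHom, Karoubi.idem]⟩

/-- The tensor product of morphisms of the idempotent completion. -/
def karoubiTensorHom {X₁ Y₁ X₂ Y₂ : Karoubi C} (f : X₁ ⟶ Y₁) (g : X₂ ⟶ Y₂) :
    karoubiTensorObj X₁ X₂ ⟶ karoubiTensorObj Y₁ Y₂ :=
  ⟨f.f ⊗ₘ g.f, by
    simp only [karoubiTensorObj, tensorHom_comp_tensorHom, Karoubi.p_comp, Karoubi.comp_p]⟩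

instance karoubiMonoidalStruct : MonoidalCategoryStruct (Karoubi C) where
  tensorObj X Y := karoubiTensorObj X Y
  tensorUnit := ⟨𝟙_ C, 𝟙 _, Category.comp_id _⟩
  tensorHom f g := karoubiTensorHom f g
  whiskerLeft X _ _ f := karoubiTensorHom (𝟙 X) f
  whiskerRight f X := karoubiTensorHom f (𝟙 X)
  associator X Y Z := karoubiIso (α_ X.X Y.X Z.X) (associator_naturality X.p Y.p Z.p)
  leftUnitor X := karoubiIso (λ_ X.X) (by
    change (𝟙 (𝟙_ C) ⊗ₘ X.p) ≫ (λ_ X.X).hom = (λ_ X.X).hom ≫ X.p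
    rw [id_tensorHom, leftUnitor_naturality])
  rightUnitor X := karoubiIso (ρ_ X.X) (by
    change (X.p ⊗ₘ 𝟙 (𝟙_ C)) ≫ (ρ_ X.X).hom = (ρ_ X.X).hom ≫ X.p
    rw [tensorHom_id, rightUnitor_naturality])

/-- The tensor product of the images of two idempotents is the image of their tensor product. -/
instance karoubiMonoidal : MonoidalCategory (Karoubi C) :=
  MonoidalCategory.ofTensorHom
    (id_tensorHom_id := fun _ _ => rfl)
    (id_tensorHom := fun _ _ _ _ => rfl)
    (tensorHom_id := fun _ _ => rfl)
    (tensorHom_comp_tensorHom := fun f₁ f₂ g₁ g₂ => by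
      ext
      exact tensorHom_comp_tensorHom f₁.f f₂.f g₁.f g₂.f)
    (associator_naturality := fun {X₁ X₂ X₃ Y₁ Y₂ Y₃} f₁ f₂ f₃ => by
      ext
      change ((f₁.f ⊗ₘ f₂.f) ⊗ₘ f₃.f) ≫ ((Y₁.p ⊗ₘ Y₂.p) ⊗ₘ Y₃.p) ≫ (α_ Y₁.X Y₂.X Y₃.X).hom =
        (((X₁.p ⊗ₘ X₂.p) ⊗ₘ X₃.p) ≫ (α_ X₁.X X₂.X X₃.X).hom) ≫ (f₁.f ⊗ₘ (f₂.f ⊗ₘ f₃.f))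
      rw [Category.assoc, ← associator_naturality, tensorHom_comp_tensorHom_assoc,
        tensorHom_comp_tensorHom_assoc, tensorHom_comp_tensorHom, tensorHom_comp_tensorHom]
      simp only [Karoubi.p_comp, Karoubi.comp_p])
    (leftUnitor_naturality := fun {X Y} f => by
      ext
      change (𝟙 (𝟙_ C) ⊗ₘ f.f) ≫ (𝟙 (𝟙_ C) ⊗ₘ Y.p) ≫ (λ_ Y.X).hom =
        ((𝟙 (𝟙_ C) ⊗ₘ X.p) ≫ (λ_ X.X).hom) ≫ f.f
      rw [Category.assoc, ← leftUnitor_naturality, ← id_tensorHom,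
        tensorHom_comp_tensorHom_assoc, tensorHom_comp_tensorHom_assoc, Karoubi.p_comp,
        Karoubi.comp_p])
    (rightUnitor_naturality := fun {X Y} f => by
      ext
      change (f.f ⊗ₘ 𝟙 (𝟙_ C)) ≫ (Y.p ⊗ₘ 𝟙 (𝟙_ C)) ≫ (ρ_ Y.X).hom =
        ((X.p ⊗ₘ 𝟙 (𝟙_ C)) ≫ (ρ_ X.X).hom) ≫ f.f
      rw [Category.assoc, ← rightUnitor_naturality, ← tensorHom_id,
        tensorHom_comp_tensorHom_assoc, tensorHom_comp_tensorHom_assoc, Karoubi.p_comp,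
        Karoubi.comp_p])
    (pentagon := fun W X Y Z => by
      ext
      change ((((W.p ⊗ₘ X.p) ⊗ₘ Y.p) ≫ (α_ W.X X.X Y.X).hom) ⊗ₘ Z.p) ≫
          (((W.p ⊗ₘ (X.p ⊗ₘ Y.p)) ⊗ₘ Z.p) ≫ (α_ W.X (X.X ⊗ Y.X) Z.X).hom) ≫
            (W.p ⊗ₘ (((X.p ⊗ₘ Y.p) ⊗ₘ Z.p) ≫ (α_ X.X Y.X Z.X).hom)) =
        ((((W.p ⊗ₘ X.p) ⊗ₘ Y.p) ⊗ₘ Z.p) ≫ (α_ (W.X ⊗ X.X) Y.X Z.X).hom) ≫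
          ((W.p ⊗ₘ X.p) ⊗ₘ (Y.p ⊗ₘ Z.p)) ≫ (α_ W.X X.X (Y.X ⊗ Z.X)).hom
      have e₁ : (((W.p ⊗ₘ X.p) ⊗ₘ Y.p) ≫ (α_ W.X X.X Y.X).hom) ⊗ₘ Z.p =
          (((W.p ⊗ₘ X.p) ⊗ₘ Y.p) ⊗ₘ Z.p) ≫ ((α_ W.X X.X Y.X).hom ▷ Z.X) := by
        rw [← tensorHom_id, tensorHom_comp_tensorHom, Category.comp_id]
      have e₁' : ((α_ W.X X.X Y.X).hom ▷ Z.X) ≫ ((W.p ⊗ₘ (X.p ⊗ₘ Y.p)) ⊗ₘ Z.p) =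
          (((W.p ⊗ₘ X.p) ⊗ₘ Y.p) ⊗ₘ Z.p) ≫ ((α_ W.X X.X Y.X).hom ▷ Z.X) := by
        rw [← tensorHom_id, tensorHom_comp_tensorHom, tensorHom_comp_tensorHom,
          associator_naturality, Category.comp_id, Category.id_comp]
      have e₂ : W.p ⊗ₘ (((X.p ⊗ₘ Y.p) ⊗ₘ Z.p) ≫ (α_ X.X Y.X Z.X).hom) =
          (W.p ⊗ₘ ((X.p ⊗ₘ Y.p) ⊗ₘ Z.p)) ≫ (W.X ◁ (α_ X.X Y.X Z.X).hom) := by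
        rw [← id_tensorHom, tensorHom_comp_tensorHom, Category.comp_id]
      have e₂' := associator_naturality W.p (X.p ⊗ₘ Y.p) Z.p
      have e₃ := associator_naturality (W.p ⊗ₘ X.p) Y.p Z.p
      have e₄ : (((W.p ⊗ₘ X.p) ⊗ₘ Y.p) ⊗ₘ Z.p) ≫ (((W.p ⊗ₘ X.p) ⊗ₘ Y.p) ⊗ₘ Z.p) =
          ((W.p ⊗ₘ X.p) ⊗ₘ Y.p) ⊗ₘ Z.p := by
        simp only [tensorHom_comp_tensorHom, Karoubi.idem]
      rw [e₁, e₂]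
      simp only [Category.assoc]
      rw [reassoc_of% e₁', ← reassoc_of% e₂', reassoc_of% e₁', reassoc_of% e₄, reassoc_of% e₄,
        ← reassoc_of% e₃, reassoc_of% e₄, MonoidalCategory.pentagon])
    (triangle := fun X Y => by
      ext
      change (((X.p ⊗ₘ 𝟙 (𝟙_ C)) ⊗ₘ Y.p) ≫ (α_ X.X (𝟙_ C) Y.X).hom) ≫
          (X.p ⊗ₘ ((𝟙 (𝟙_ C) ⊗ₘ Y.p) ≫ (λ_ Y.X).hom)) =
        ((X.p ⊗ₘ 𝟙 (𝟙_ C)) ≫ (ρ_ X.X).hom) ⊗ₘ Y.p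
      have e₁ := associator_naturality X.p (𝟙 (𝟙_ C)) Y.p
      have e₂ : X.p ⊗ₘ ((𝟙 (𝟙_ C) ⊗ₘ Y.p) ≫ (λ_ Y.X).hom) =
          (X.p ⊗ₘ (𝟙 (𝟙_ C) ⊗ₘ Y.p)) ≫ (X.X ◁ (λ_ Y.X).hom) := by
        rw [← id_tensorHom X.X, tensorHom_comp_tensorHom, Category.comp_id]
      have e₃ : ((X.p ⊗ₘ 𝟙 (𝟙_ C)) ⊗ₘ Y.p) ≫ ((X.p ⊗ₘ 𝟙 (𝟙_ C)) ⊗ₘ Y.p) =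
          (X.p ⊗ₘ 𝟙 (𝟙_ C)) ⊗ₘ Y.p := by
        simp only [tensorHom_comp_tensorHom, Karoubi.idem, Category.comp_id]
      rw [e₂, Category.assoc, ← reassoc_of% e₁, reassoc_of% e₃, MonoidalCategory.triangle,
        ← tensorHom_id, tensorHom_comp_tensorHom, Category.comp_id])

instance karoubiMonoidalPreadditive [Preadditive C] [MonoidalPreadditive C] :
    MonoidalPreadditive (Karoubi C) where
  whiskerLeft_zero := Karoubi.hom_ext _ _ (MonoidalPreadditive.tensor_zero _)
  zero_whiskerRight := Karoubi.hom_ext _ _ (MonoidalPreadditive.zero_tensor _)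
  whiskerLeft_add _ _ := Karoubi.hom_ext _ _ (MonoidalPreadditive.tensor_add _ _ _)
  add_whiskerRight _ _ := Karoubi.hom_ext _ _ (MonoidalPreadditive.add_tensor _ _ _)

instance karoubiMonoidalLinear [Preadditive C] [MonoidalPreadditive C] (k : Type*) [Semiring k]
    [Linear k C] [MonoidalLinear k C] : MonoidalLinear k (Karoubi C) where
  whiskerLeft_smul X _ _ r f := by
    ext
    change X.p ⊗ₘ (r • f.f) = r • (X.p ⊗ₘ f.f)
    simp only [MonoidalCategory.tensorHom_def, MonoidalLinear.whiskerLeft_smul, Linear.comp_smul]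
  smul_whiskerRight r _ _ f X := by
    ext
    change (r • f.f) ⊗ₘ X.p = r • (f.f ⊗ₘ X.p)
    simp only [MonoidalCategory.tensorHom_def, MonoidalLinear.smul_whiskerRight, Linear.smul_comp]

end Idempotent
/-! ### The trace of a linear monoidal category -/

section Trace

open DirectSum

variable (k : Type*) [CommRing k] (D : Type*) [Category D] [Preadditive D] [Linear k D]

open scoped Classical in
/-- The span of the differences `fg - gf` in the direct sum of all endomorphism spaces. -/
def traceRelations : Submodule k (⨁ X : D, (X ⟶ X)) :=
  Submodule.span k {t | ∃ (X Y : D) (f : X ⟶ Y) (g : Y ⟶ X),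
    t = DirectSum.lof k D (fun X => (X ⟶ X)) X (f ≫ g) -
      DirectSum.lof k D (fun X => (X ⟶ X)) Y (g ≫ f)}

/-- The trace (zeroth Hochschild homology) of a `k`-linear category. -/
def Tr : Type _ := (⨁ X : D, (X ⟶ X)) ⧸ traceRelations k D

instance : AddCommGroup (Tr k D) :=
  inferInstanceAs (AddCommGroup ((⨁ X : D, (X ⟶ X)) ⧸ traceRelations k D))

instance : Module k (Tr k D) :=
  inferInstanceAs (Module k ((⨁ X : D, (X ⟶ X)) ⧸ traceRelations k D))

variable {D}

open scoped Classical in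
/-- The class `[f]` in the trace of an endomorphism `f`, as a linear function of `f`. -/
def trClass (X : D) : (X ⟶ X) →ₗ[k] Tr k D :=
  (traceRelations k D).mkQ ∘ₗ DirectSum.lof k D (fun X => (X ⟶ X)) X

theorem trClass_comp_comm {X Y : D} (f : X ⟶ Y) (g : Y ⟶ X) :
    trClass k X (f ≫ g) = trClass k Y (g ≫ f) :=
  (Submodule.Quotient.eq (traceRelations k D)).2 (Submodule.subset_span ⟨X, Y, f, g, rfl⟩)

variable {k}

theorem Tr.hom_ext {M : Type*} [AddCommGroup M] [Module k M] {F G : Tr k D →ₗ[k] M}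
    (h : ∀ (X : D) (f : X ⟶ X), F (trClass k X f) = G (trClass k X f)) : F = G := by
  classical
  refine Submodule.linearMap_qext _ (DirectSum.linearMap_ext k fun X => LinearMap.ext fun f => ?_)
  exact h X f

open scoped Classical in
/-- The linear map out of the trace given by linear maps that agree on `fg` and `gf`. -/
def Tr.lift {M : Type*} [AddCommGroup M] [Module k M] (F : ∀ X : D, (X ⟶ X) →ₗ[k] M)
    (h : ∀ (X Y : D) (f : X ⟶ Y) (g : Y ⟶ X), F X (f ≫ g) = F Y (g ≫ f)) : Tr k D →ₗ[k] M :=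
  (traceRelations k D).liftQ (DirectSum.toModule k D M F) (by
    rw [traceRelations, Submodule.span_le]
    rintro _ ⟨X, Y, f, g, rfl⟩
    simp only [SetLike.mem_coe, LinearMap.mem_ker, map_sub, DirectSum.toModule_lof, h X Y f g,
      sub_self])

theorem Tr.lift_trClass {M : Type*} [AddCommGroup M] [Module k M] (F : ∀ X : D, (X ⟶ X) →ₗ[k] M)
    (h : ∀ (X Y : D) (f : X ⟶ Y) (g : Y ⟶ X), F X (f ≫ g) = F Y (g ≫ f)) (X : D) (f : X ⟶ X) :
    Tr.lift F h (trClass k X f) = F X f := by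
  classical
  exact (Submodule.liftQ_apply _ _ _).trans
    (DirectSum.toModule_lof (M := fun X : D => (X ⟶ X)) (φ := F) k X f)

theorem trClass_conj {X Y : D} (a : X ≅ Y) (f : X ⟶ X) (g : Y ⟶ Y)
    (h : f ≫ a.hom = a.hom ≫ g) : trClass k X f = trClass k Y g := by
  rw [← Category.comp_id f, ← a.hom_inv_id, ← Category.assoc, h, trClass_comp_comm,
    a.inv_hom_id_assoc]

@[elab_as_elim]
theorem Tr.induction {p : Tr k D → Prop} (a : Tr k D) (zero : p 0)
    (cls : ∀ (X : D) (f : X ⟶ X), p (trClass k X f)) (add : ∀ a b, p a → p b → p (a + b)) :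
    p a := by
  classical
  obtain ⟨x, rfl⟩ := Submodule.mkQ_surjective (traceRelations k D) a
  induction x using DirectSum.induction_on with
  | zero => exact zero
  | of X f => exact cls X f
  | add x y hx hy => exact add _ _ hx hy

variable [MonoidalCategory D] [MonoidalPreadditive D] [MonoidalLinear k D]

/-- The tensor product of endomorphisms as a bilinear map. -/
def tensorBilin (X Y : D) : (X ⟶ X) →ₗ[k] (Y ⟶ Y) →ₗ[k] (X ⊗ Y ⟶ X ⊗ Y) :=
  LinearMap.mk₂ k (fun f g => f ⊗ₘ g)
    (fun _ _ _ => MonoidalPreadditive.add_tensor _ _ _)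
    (fun r f g => by
      simp only [MonoidalCategory.tensorHom_def, MonoidalLinear.smul_whiskerRight,
        Linear.smul_comp])
    (fun _ _ _ => MonoidalPreadditive.tensor_add _ _ _)
    (fun r f g => by
      simp only [MonoidalCategory.tensorHom_def, MonoidalLinear.whiskerLeft_smul,
        Linear.comp_smul])

/-- The multiplication of the trace of a linear monoidal category, `[f] [g] = [f ⊗ g]`. -/
def Tr.mul : Tr k D →ₗ[k] Tr k D →ₗ[k] Tr k D :=
  Tr.lift
    (fun X => LinearMap.flip (Tr.lift
      (fun Y => LinearMap.flip ((tensorBilin X Y).compr₂ (trClass k (X ⊗ Y))))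
      (fun Y Y' g g' => by
        ext f
        change trClass k _ (f ⊗ₘ (g ≫ g')) = trClass k _ (f ⊗ₘ (g' ≫ g))
        rw [← Category.comp_id f, ← tensorHom_comp_tensorHom, trClass_comp_comm,
          tensorHom_comp_tensorHom, Category.id_comp, Category.comp_id])))
    (fun X X' f f' => by
      refine Tr.hom_ext fun Y g => ?_
      rw [LinearMap.flip_apply, LinearMap.flip_apply, Tr.lift_trClass, Tr.lift_trClass]
      change trClass k _ ((f ≫ f') ⊗ₘ g) = trClass k _ ((f' ≫ f) ⊗ₘ g)
      rw [← Category.comp_id g, ← tensorHom_comp_tensorHom, trClass_comp_comm,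
        tensorHom_comp_tensorHom, Category.id_comp, Category.comp_id])

theorem Tr.mul_trClass {X Y : D} (f : X ⟶ X) (g : Y ⟶ Y) :
    Tr.mul (trClass k X f) (trClass k Y g) = trClass k (X ⊗ Y) (f ⊗ₘ g) := by
  rw [Tr.mul, Tr.lift_trClass, LinearMap.flip_apply, Tr.lift_trClass]
  rfl

/-- The trace of a linear monoidal category is a ring. -/
instance : Ring (Tr k D) where
  __ := (inferInstance : AddCommGroup (Tr k D))
  mul a b := Tr.mul a b
  one := trClass k (𝟙_ D) (𝟙 (𝟙_ D))
  left_distrib a b c := map_add (Tr.mul a) b c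
  right_distrib a b c := LinearMap.map_add₂ Tr.mul a b c
  zero_mul a := LinearMap.map_zero₂ Tr.mul a
  mul_zero a := map_zero (Tr.mul a)
  mul_assoc a b c := by
    change Tr.mul (Tr.mul a b) c = Tr.mul a (Tr.mul b c)
    induction a using Tr.induction with
    | zero => simp only [map_zero, LinearMap.zero_apply]
    | add a a' ha ha' => simp only [map_add, LinearMap.add_apply, ha, ha']
    | cls X f =>
      induction b using Tr.induction with
      | zero => simp only [map_zero, LinearMap.zero_apply]
      | add b b' hb hb' => simp only [map_add, LinearMap.add_apply, hb, hb']
      | cls Y g =>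
        induction c using Tr.induction with
        | zero => simp only [map_zero]
        | add c c' hc hc' => simp only [map_add, hc, hc']
        | cls Z h =>
          simp only [Tr.mul_trClass]
          exact trClass_conj (α_ X Y Z) _ _ (associator_naturality f g h)
  one_mul a := by
    change Tr.mul (trClass k (𝟙_ D) (𝟙 (𝟙_ D))) a = a
    induction a using Tr.induction with
    | zero => exact map_zero _
    | add a a' ha ha' => rw [map_add, ha, ha']
    | cls X f =>
      rw [Tr.mul_trClass, id_tensorHom]
      exact trClass_conj (λ_ X) _ _ (leftUnitor_naturality f)
  mul_one a := by
    change Tr.mul a (trClass k (𝟙_ D) (𝟙 (𝟙_ D))) = a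
    induction a using Tr.induction with
    | zero => exact LinearMap.map_zero₂ _ _
    | add a a' ha ha' => rw [map_add, LinearMap.add_apply, ha, ha']
    | cls X f =>
      rw [Tr.mul_trClass, tensorHom_id]
      exact trClass_conj (ρ_ X) _ _ (rightUnitor_naturality f)

/-- The trace of a `k`-linear monoidal category is a `k`-algebra. -/
instance : Algebra k (Tr k D) :=
  Algebra.ofModule (fun r a b => LinearMap.map_smul₂ Tr.mul r a b)
    (fun r a b => map_smul (Tr.mul a) r b)

theorem trClass_mul_trClass {X Y : D} (f : X ⟶ X) (g : Y ⟶ Y) :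
    trClass k X f * trClass k Y g = trClass k (X ⊗ Y) (f ⊗ₘ g) :=
  Tr.mul_trClass f g

end Trace

/-! ### The Heisenberg category and the elements of its trace -/

section Elements

open Idempotents

/-- The Heisenberg category `H`: the idempotent completion of the additive closure of `H'`. -/
abbrev H : Type 1 := Karoubi (Mat_ Obj)

/-- The inclusion of `H'` in `H`. -/
def incl : Obj ⥤ H := Mat_.embedding Obj ⋙ toKaroubi (Mat_ Obj)

/-- The upward crossing, an endomorphism of `P ⊗ P`. -/
def crossP : Obj.P ⊗ Obj.P ⟶ Obj.P ⊗ Obj.P := mk Diag.cross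

/-- The downward crossing, an endomorphism of `Q ⊗ Q`. -/
def crossQ : Obj.Q ⊗ Obj.Q ⟶ Obj.Q ⊗ Obj.Q := mk Diag.crossDown

/-- The tensor power `Xⁿ`. -/
def pow (X : Obj) : ℕ → Obj
  | 0 => 𝟙_ Obj
  | n + 1 => X ⊗ pow X n

/-- Given a crossing `c` of two strands `X`, the endomorphism of `Xⁿ⁺¹` in which the first strand
at the bottom crosses over to position `j` at the top and the others keep their order. -/
def insertStrand {X : Obj} (c : X ⊗ X ⟶ X ⊗ X) :
    ∀ {n : ℕ}, Fin (n + 1) → (pow X (n + 1) ⟶ pow X (n + 1))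
  | 0, _ => 𝟙 _
  | n + 1, j => Fin.cases (𝟙 _)
      (fun i => (α_ X X (pow X n)).inv ≫ (c ▷ pow X n) ≫ (α_ X X (pow X n)).hom ≫
        (X ◁ insertStrand c i)) j

/-- The permutation of the remaining strands after the first one has been removed from `w`:
it satisfies `w i.succ = (w 0).succAbove (removeFirst w i)`. -/
def removeFirst {n : ℕ} (w : Equiv.Perm (Fin (n + 1))) : Equiv.Perm (Fin n) :=
  Equiv.removeNone (((finSuccEquiv n).symm.trans w).trans (finSuccEquiv' (w 0)))

theorem succAbove_removeFirst {n : ℕ} (w : Equiv.Perm (Fin (n + 1))) (i : Fin n) :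
    (w 0).succAbove (removeFirst w i) = w i.succ := by
  have h : some (removeFirst w i) = finSuccEquiv' (w 0) (w i.succ) := by
    refine (Equiv.removeNone_some _ ?_).trans ?_
    · have hne : w i.succ ≠ w 0 := fun hh => Fin.succ_ne_zero i (w.injective hh)
      obtain ⟨j, hj⟩ := Fin.exists_succAbove_eq hne
      exact ⟨j, by simp [← hj]⟩
    · simp
  rw [← finSuccEquiv'_symm_some, h, Equiv.symm_apply_apply]

/-- The diagram of the permutation `w` on `n` strands `X`: the strand in position `i` at the
bottom ends in position `w i` at the top, and two strands cross at most once. -/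
def permDiagram {X : Obj} (c : X ⊗ X ⟶ X ⊗ X) :
    ∀ {n : ℕ}, Equiv.Perm (Fin n) → (pow X n ⟶ pow X n)
  | 0, _ => 𝟙 _
  | _ + 1, w => (X ◁ permDiagram c (removeFirst w)) ≫ insertStrand c (w 0)

/-- The class in `Tr(H)` of an endomorphism in `H'`. -/
def cls {X : Obj} (f : X ⟶ X) : Tr ℂ H := trClass ℂ (incl.obj X) (incl.map f)

/-- The element `p⁽ⁿ⁾ ⊗ 1` of `Tr(H)`. -/
def p (n : ℕ) : Tr ℂ H :=
  (1 / (n.factorial : ℂ)) • ∑ w : Equiv.Perm (Fin n), cls (permDiagram crossP w)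

/-- The element `q⁽ⁿ⁾ ⊗ 1` of `Tr(H)`. -/
def q (n : ℕ) : Tr ℂ H :=
  (1 / (n.factorial : ℂ)) • ∑ w : Equiv.Perm (Fin n), cls (permDiagram crossQ w)

end Elements

end Heisenberg

end

/-!
The relation between `q` and `p` lifts to a decomposition of the symmetrizer of `Qⁿ ⊗ Pᵐ`
in the category, and taking traces turns that decomposition into the stated sum.

Write `E_n` for the sum of all permutation diagrams on `n` strands (`symSum`) and
`e_n = E_n / n!` (`symmetrizer`), so that `p n = [e_n]` on upward and `q n = [E_n] / n!` on downward
strands.  As the crossing satisfies the relations of the symmetric group, `e_n` absorbs crossings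
on either side and is idempotent.  The downward crossing satisfies the same relations: turning a
crossing preserves the Yang–Baxter equation (`YangBaxter.rotate`) and, after two turns, also the
relation `c² = 1` (`rotate_rotate_sq`).

*Commutativity.*  Crossing `m` strands over `n` strands is an isomorphism `Xᵐ ⊗ Xⁿ ≅ Xⁿ ⊗ Xᵐ`
carrying `E_m ⊗ E_n` to `E_n ⊗ E_m` (`exists_braiding`), and conjugate endomorphisms have the same
class in the trace.

*The mixed relation.*  For one downward strand, the relations say that `Q ⊗ e_m` is the sum of two
composites: slide `Q` to the right through all `m` upward strands and back, or cap it off against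
one of them and create it again by a cup, the second with coefficient `m`
(`whiskerLeft_symmetrizer_succ`).  Iterating over `n` downward strands leads to morphisms
`U = normalOut : Pᵃ ⊗ Qʳ ⟶ Qⁿ ⊗ Pᵇ`, the sum over the choices of the `r` downward strands that pass
through, the others being produced by cups, and `V = normalIn` in the opposite direction, with
caps.  Two facts are then proved by induction on `n`:

* `symSum_tensor_symmetrizer`: `E_n ⊗ e_b = ∑ (b - a)! V (Pᵃ ⊗ E_r) U`, the sum over all `r`, `a`;
* `normalOut_comp_normalIn`: `V` after `U` is `(n choose r) e_a ⊗ Qʳ` (and `0` unless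
  `n + a = r + b`).  Here the vanishing of the left curl and the value `1` of the counterclockwise
  circle enter, through the counterclockwise partial trace of `e_{a+1}`, which is
  `e_a / (a + 1)` (`partialTrace_symmetrizer`).

Cyclicity of the trace turns the first identity, by the second, into
`[E_n ⊗ e_m] = ∑ k! (n choose k) [e_{m-k}] [E_{n-k}]`, where `k = n - r = m - a` is the number of
caps; dividing by `n!` gives the relation.

All of this takes place in an arbitrary `ℂ`-linear monoidal category with the relevant morphisms
(`HeisenbergRelations`); only the last parts are about the diagrammatic category.  Compositions are
read from bottom to top, so that `f ≫ g` has `g` above `f`.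
-/

noncomputable section

namespace Heisenberg

set_option linter.unusedSectionVars false

/-! ### Turning crossings -/

section Rotation

variable {C : Type*} [Category C] [MonoidalCategory C] {P Q : C}

/-- The clockwise quarter turn of `g`: the strand `P` at the lower left is bent up by the cup `η`,
the one at the upper right is bent down by the cap `ε`. -/
def rotate (η : 𝟙_ C ⟶ Q ⊗ P) (ε : P ⊗ Q ⟶ 𝟙_ C) {A B : C} (g : P ⊗ A ⟶ B ⊗ P) :
    A ⊗ Q ⟶ Q ⊗ B :=
  (λ_ (A ⊗ Q)).inv ≫ (η ▷ (A ⊗ Q)) ≫ (α_ Q P (A ⊗ Q)).hom ≫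
    (Q ◁ ((α_ P A Q).inv ≫ (g ▷ Q) ≫ (α_ B P Q).hom)) ≫ (α_ Q B (P ⊗ Q)).inv ≫
      ((Q ⊗ B) ◁ ε) ≫ (ρ_ (Q ⊗ B)).hom

variable {η : 𝟙_ C ⟶ Q ⊗ P} {ε : P ⊗ Q ⟶ 𝟙_ C}

/-- A strand can be pulled across the cup. -/
theorem cup_rotate
    (hP : (ρ_ P).inv ≫ (P ◁ η) ≫ (α_ P Q P).inv ≫ (ε ▷ P) ≫ (λ_ P).hom = 𝟙 P)
    {A B : C} (g : P ⊗ A ⟶ B ⊗ P) :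
    (ρ_ A).inv ≫ (A ◁ η) ≫ (α_ A Q P).inv ≫ (rotate η ε g ▷ P) ≫ (α_ Q B P).hom =
      (λ_ A).inv ≫ (η ▷ A) ≫ (α_ Q P A).hom ≫ (Q ◁ g) := by
  calc _ = 𝟙 A ⊗≫ (η ▷ (A ⊗ 𝟙_ C) ≫ (Q ⊗ P) ◁ (A ◁ η)) ⊗≫ (Q ◁ g ▷ Q ▷ P) ⊗≫
        (Q ◁ B ◁ ε ▷ P) ⊗≫ 𝟙 _ := by
        rw [← whisker_exchange]
        unfold rotate
        monoidal
    _ = 𝟙 A ⊗≫ η ▷ A ⊗≫ Q ◁ ((P ⊗ A) ◁ η ≫ g ▷ (Q ⊗ P)) ⊗≫ (Q ◁ B ◁ ε ▷ P) ⊗≫ 𝟙 _ := by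
        monoidal
    _ = 𝟙 A ⊗≫ η ▷ A ⊗≫ Q ◁ g ⊗≫
        Q ◁ B ◁ ((ρ_ P).inv ≫ (P ◁ η) ≫ (α_ P Q P).inv ≫ (ε ▷ P) ≫ (λ_ P).hom) ⊗≫ 𝟙 _ := by
        rw [whisker_exchange]
        monoidal
    _ = _ := by
        rw [hP]
        monoidal

theorem whiskerRight_comp_rotate {A A' B : C} (h : A ⟶ A') (g : P ⊗ A' ⟶ B ⊗ P) :
    (h ▷ Q) ≫ rotate η ε g = rotate η ε ((P ◁ h) ≫ g) := by
  calc _ = 𝟙 _ ⊗≫ (𝟙_ C ◁ (h ▷ Q) ≫ η ▷ (A' ⊗ Q)) ⊗≫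
        (Q ◁ (g ▷ Q)) ⊗≫ ((Q ⊗ B) ◁ ε) ⊗≫ 𝟙 _ := by
        unfold rotate
        monoidal
    _ = _ := by
        rw [whisker_exchange]
        unfold rotate
        monoidal

theorem rotate_comp_whiskerLeft {A B B' : C} (g : P ⊗ A ⟶ B ⊗ P) (h : B ⟶ B') :
    rotate η ε g ≫ (Q ◁ h) = rotate η ε (g ≫ (h ▷ P)) := by
  calc _ = 𝟙 _ ⊗≫ η ▷ (A ⊗ Q) ⊗≫ (Q ◁ (g ▷ Q)) ⊗≫
        ((Q ⊗ B) ◁ ε ≫ (Q ◁ h) ▷ 𝟙_ C) ⊗≫ 𝟙 _ := by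
        unfold rotate
        monoidal
    _ = _ := by
        rw [whisker_exchange]
        unfold rotate
        monoidal

/-- Turning two crossings side by side, which share the strand `P`, turns each of them. -/
theorem rotate_tensor
    (hP : (ρ_ P).inv ≫ (P ◁ η) ≫ (α_ P Q P).inv ≫ (ε ▷ P) ≫ (λ_ P).hom = 𝟙 P)
    {A A' B B' : C} (g : P ⊗ B ⟶ B' ⊗ P) (f : P ⊗ A ⟶ A' ⊗ P) :
    (α_ B A Q).hom ≫ (B ◁ rotate η ε f) ≫ (α_ B Q A').inv ≫ (rotate η ε g ▷ A') ≫
        (α_ Q B' A').hom =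
      rotate η ε ((α_ P B A).inv ≫ (g ▷ A) ≫ (α_ B' P A).hom ≫ (B' ◁ f) ≫
        (α_ B' A' P).inv) := by
  calc _ = 𝟙 _ ⊗≫ B ◁ η ▷ A ▷ Q ⊗≫ B ◁ Q ◁ f ▷ Q ⊗≫ (B ⊗ Q ⊗ A') ◁ ε ⊗≫
        η ▷ (B ⊗ Q ⊗ A') ⊗≫ Q ◁ g ▷ (Q ⊗ A') ⊗≫ (Q ⊗ B') ◁ ε ▷ A' ⊗≫ 𝟙 _ := by
        unfold rotate
        monoidal
    _ = 𝟙 _ ⊗≫ B ◁ η ▷ A ▷ Q ⊗≫ B ◁ Q ◁ f ▷ Q ⊗≫ (𝟙_ C ◁ ((B ⊗ Q ⊗ A') ◁ ε) ≫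
        η ▷ ((B ⊗ Q ⊗ A') ⊗ 𝟙_ C)) ⊗≫ Q ◁ g ▷ (Q ⊗ A') ⊗≫ (Q ⊗ B') ◁ ε ▷ A' ⊗≫ 𝟙 _ := by
        monoidal
    _ = 𝟙 _ ⊗≫ B ◁ η ▷ A ▷ Q ⊗≫ (𝟙_ C ◁ (B ◁ Q ◁ f ▷ Q) ≫ η ▷ _) ⊗≫
        (Q ◁ ((P ⊗ B) ◁ (Q ◁ A' ◁ ε) ≫ g ▷ _)) ⊗≫ (Q ⊗ B') ◁ ε ▷ A' ⊗≫ 𝟙 _ := by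
        rw [whisker_exchange]
        monoidal
    _ = 𝟙 _ ⊗≫ (𝟙_ C ◁ (B ◁ η ▷ A ▷ Q) ≫ η ▷ _) ⊗≫ (Q ◁ ((P ⊗ B) ◁ (Q ◁ f ▷ Q) ≫ g ▷ _)) ⊗≫
        (Q ◁ B' ◁ ((P ⊗ Q) ◁ (A' ◁ ε) ≫ ε ▷ _)) ⊗≫ 𝟙 _ := by
        rw [whisker_exchange, whisker_exchange]
        monoidal
    _ = 𝟙 _ ⊗≫ η ▷ (B ⊗ A ⊗ Q) ⊗≫ (Q ◁ ((P ⊗ B) ◁ (η ▷ A ▷ Q) ≫ g ▷ _)) ⊗≫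
        (Q ◁ B' ◁ ((P ⊗ Q) ◁ (f ▷ Q) ≫ ε ▷ _)) ⊗≫ (Q ◁ B' ◁ A' ◁ ε) ⊗≫ 𝟙 _ := by
        rw [whisker_exchange, whisker_exchange, whisker_exchange]
        monoidal
    _ = 𝟙 _ ⊗≫ η ▷ (B ⊗ A ⊗ Q) ⊗≫ (Q ◁ (g ▷ (A ⊗ Q))) ⊗≫
        (Q ◁ B' ◁ ((ρ_ P).inv ≫ (P ◁ η) ≫ (α_ P Q P).inv ≫ (ε ▷ P) ≫ (λ_ P).hom) ▷ (A ⊗ Q)) ⊗≫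
        (Q ◁ B' ◁ (f ▷ Q)) ⊗≫ (Q ◁ B' ◁ A' ◁ ε) ⊗≫ 𝟙 _ := by
        rw [whisker_exchange, whisker_exchange]
        monoidal
    _ = _ := by
        rw [hP]
        unfold rotate
        monoidal

/-- The Yang–Baxter equation for three crossings of strands `X`, `Y`, `Z`: the two ways of
reversing the order of the three strands agree. -/
def YangBaxter {X Y Z : C} (xy : X ⊗ Y ⟶ Y ⊗ X) (xz : X ⊗ Z ⟶ Z ⊗ X) (yz : Y ⊗ Z ⟶ Z ⊗ Y) :
    Prop :=
  (α_ X Y Z).inv ≫ (xy ▷ Z) ≫ (α_ Y X Z).hom ≫ (Y ◁ xz) ≫ (α_ Y Z X).inv ≫ (yz ▷ X) =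
    (X ◁ yz) ≫ (α_ X Z Y).inv ≫ (xz ▷ Y) ≫ (α_ Z X Y).hom ≫ (Z ◁ xy) ≫ (α_ Z Y X).inv

/-- The strand `P` is turned into `Q`; in the resulting equation it comes last instead of
first. -/
theorem YangBaxter.rotate
    (hP : (ρ_ P).inv ≫ (P ◁ η) ≫ (α_ P Q P).inv ≫ (ε ▷ P) ≫ (λ_ P).hom = 𝟙 P)
    {A B : C} {f : P ⊗ A ⟶ A ⊗ P} {g : P ⊗ B ⟶ B ⊗ P} {h : A ⊗ B ⟶ B ⊗ A}
    (hfg : YangBaxter f g h) :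
    YangBaxter h (rotate η ε f) (rotate η ε g) := by
  have e₁ := rotate_tensor hP f g
  have e₂ := rotate_tensor hP g f
  have e := congrArg (Heisenberg.rotate η ε) hfg
  rw [← whiskerRight_comp_rotate, ← e₂] at e
  simp only [← Category.assoc] at e
  rw [← rotate_comp_whiskerLeft] at e
  simp only [Category.assoc] at e
  rw [← e₁] at e
  unfold YangBaxter
  rw [← cancel_mono (α_ Q B A).hom]
  simp only [Category.assoc, Iso.inv_hom_id, Category.comp_id] at e ⊢
  rw [← e, Iso.inv_hom_id_assoc]

/-- A crossing can be moved across two nested cups, which turns it by half a turn. -/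
theorem nestedCup_rotate_rotate
    (hP : (ρ_ P).inv ≫ (P ◁ η) ≫ (α_ P Q P).inv ≫ (ε ▷ P) ≫ (λ_ P).hom = 𝟙 P)
    (c : P ⊗ P ⟶ P ⊗ P) :
    (η ⊗≫ Q ◁ η ▷ P ⊗≫ 𝟙 ((Q ⊗ Q) ⊗ (P ⊗ P))) ≫ (rotate η ε (rotate η ε c) ▷ (P ⊗ P)) =
      (η ⊗≫ Q ◁ η ▷ P ⊗≫ 𝟙 ((Q ⊗ Q) ⊗ (P ⊗ P))) ≫ ((Q ⊗ Q) ◁ c) := by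
  have h₁ := cup_rotate hP c
  have h₂ := cup_rotate hP (rotate η ε c)
  calc _ = η ⊗≫ ((ρ_ Q).inv ≫ (Q ◁ η) ≫ (α_ Q Q P).inv ≫ (rotate η ε (rotate η ε c) ▷ P) ≫
        (α_ Q Q P).hom) ▷ P ⊗≫ 𝟙 _ := by
        monoidal
    _ = 𝟙 _ ⊗≫ (𝟙_ C ◁ η ≫ η ▷ (Q ⊗ P)) ⊗≫ Q ◁ rotate η ε c ▷ P ⊗≫ 𝟙 _ := by
        rw [h₂]
        monoidal
    _ = η ⊗≫ Q ◁ ((ρ_ P).inv ≫ (P ◁ η) ≫ (α_ P Q P).inv ≫ (rotate η ε c ▷ P) ≫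
        (α_ Q P P).hom) ⊗≫ 𝟙 _ := by
        rw [whisker_exchange]
        monoidal
    _ = _ := by
        rw [h₁]
        monoidal

/-- A crossing turned by half a turn is determined by what it does on top of two nested cups, where
it can be replaced by the original crossing. -/
theorem rotate_rotate_sq
    (hP : (ρ_ P).inv ≫ (P ◁ η) ≫ (α_ P Q P).inv ≫ (ε ▷ P) ≫ (λ_ P).hom = 𝟙 P)
    (hQ : (λ_ Q).inv ≫ (η ▷ Q) ≫ (α_ Q P Q).hom ≫ (Q ◁ ε) ≫ (ρ_ Q).hom = 𝟙 Q)
    {c : P ⊗ P ⟶ P ⊗ P} (hc : c ≫ c = 𝟙 _) :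
    rotate η ε (rotate η ε c) ≫ rotate η ε (rotate η ε c) = 𝟙 _ := by
  have h := nestedCup_rotate_rotate hP c
  set N : 𝟙_ C ⟶ (Q ⊗ Q) ⊗ (P ⊗ P) := η ⊗≫ Q ◁ η ▷ P ⊗≫ 𝟙 ((Q ⊗ Q) ⊗ (P ⊗ P)) with hN
  set d := rotate η ε (rotate η ε c)
  have hd : N ≫ ((d ≫ d) ▷ (P ⊗ P)) = N := by
    rw [comp_whiskerRight, reassoc_of% h, whisker_exchange, reassoc_of% h,
      ← MonoidalCategory.whiskerLeft_comp, hc, MonoidalCategory.whiskerLeft_id, Category.comp_id]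
  -- the nested cups are straightened by nested caps
  have hbend : 𝟙 (Q ⊗ Q) ⊗≫ N ▷ (Q ⊗ Q) ⊗≫ (Q ⊗ Q) ◁ (P ◁ ε ▷ Q) ⊗≫ (Q ⊗ Q) ◁ ε ⊗≫ 𝟙 (Q ⊗ Q) =
      𝟙 (Q ⊗ Q) := by
    calc _ = 𝟙 (Q ⊗ Q) ⊗≫ η ▷ (Q ⊗ Q) ⊗≫ Q ◁ η ▷ P ▷ Q ▷ Q ⊗≫
          Q ◁ ((Q ⊗ P) ◁ ε ) ▷ Q ⊗≫ (Q ⊗ Q) ◁ ε ⊗≫ 𝟙 (Q ⊗ Q) := by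
          rw [hN]
          monoidal
      _ = 𝟙 (Q ⊗ Q) ⊗≫ η ▷ (Q ⊗ Q) ⊗≫ Q ◁ (η ▷ (P ⊗ Q) ≫
          ((Q ⊗ P) ◁ ε )) ▷ Q ⊗≫ (Q ⊗ Q) ◁ ε ⊗≫ 𝟙 (Q ⊗ Q) := by
          monoidal
      _ = 𝟙 (Q ⊗ Q) ⊗≫ ((λ_ Q).inv ≫ (η ▷ Q) ≫ (α_ Q P Q).hom ≫ (Q ◁ ε) ≫ (ρ_ Q).hom) ▷ Q ⊗≫
          Q ◁ ((λ_ Q).inv ≫ (η ▷ Q) ≫ (α_ Q P Q).hom ≫ (Q ◁ ε) ≫ (ρ_ Q).hom) ⊗≫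
            𝟙 (Q ⊗ Q) := by
          rw [← whisker_exchange]
          monoidal
      _ = _ := by
          rw [hQ]
          monoidal
  calc d ≫ d = (𝟙 (Q ⊗ Q) ⊗≫ N ▷ (Q ⊗ Q) ⊗≫ (Q ⊗ Q) ◁ (P ◁ ε ▷ Q) ⊗≫ (Q ⊗ Q) ◁ ε ⊗≫
          𝟙 (Q ⊗ Q)) ≫ d ≫ d := by
        rw [hbend, Category.id_comp]
    _ = 𝟙 (Q ⊗ Q) ⊗≫ N ▷ (Q ⊗ Q) ⊗≫ ((Q ⊗ Q) ◁ (P ◁ ε ▷ Q ⊗≫ ε) ≫ (d ≫ d) ▷ 𝟙_ C) ⊗≫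
          𝟙 (Q ⊗ Q) := by
        monoidal
    _ = 𝟙 (Q ⊗ Q) ⊗≫ (N ≫ ((d ≫ d) ▷ (P ⊗ P))) ▷ (Q ⊗ Q) ⊗≫ (Q ⊗ Q) ◁ (P ◁ ε ▷ Q ⊗≫ ε) ⊗≫
          𝟙 (Q ⊗ Q) := by
        rw [whisker_exchange]
        monoidal
    _ = 𝟙 (Q ⊗ Q) ⊗≫ N ▷ (Q ⊗ Q) ⊗≫ (Q ⊗ Q) ◁ (P ◁ ε ▷ Q) ⊗≫ (Q ⊗ Q) ◁ ε ⊗≫ 𝟙 (Q ⊗ Q) := by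
        rw [hd]
        monoidal
    _ = _ := hbend

end Rotation

/-! ### The symmetrizer -/

section Symmetrizer

variable {C : Type*} [Category C] [MonoidalCategory C]

/-- The tensor power `Xⁿ`, bracketed to the right and ending in the unit object. -/
@[reducible] def tensorPow (X : C) : ℕ → C
  | 0 => 𝟙_ C
  | n + 1 => X ⊗ tensorPow X n

variable {X : C}

/-- The crossing `z` of the first two strands, to the left of `Z`. -/
def crossHead {X Y : C} (z : X ⊗ Y ⟶ Y ⊗ X) (Z : C) : X ⊗ (Y ⊗ Z) ⟶ Y ⊗ (X ⊗ Z) :=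
  (α_ X Y Z).inv ≫ (z ▷ Z) ≫ (α_ Y X Z).hom

variable {c : X ⊗ X ⟶ X ⊗ X}

theorem crossHead_comp_whiskerLeft {X Y : C} (z : X ⊗ Y ⟶ Y ⊗ X) {Z W : C} (f : Z ⟶ W) :
    crossHead z Z ≫ (Y ◁ X ◁ f) = (X ◁ Y ◁ f) ≫ crossHead z W := by
  calc _ = 𝟙 _ ⊗≫ (z ▷ Z ≫ (Y ⊗ X) ◁ f) ⊗≫ 𝟙 _ := by
        unfold crossHead
        monoidal
    _ = _ := by
        rw [← whisker_exchange]
        unfold crossHead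
        monoidal

/-- The crossing `c` satisfies the relations of the symmetric groups. -/
structure IsSymmetric (c : X ⊗ X ⟶ X ⊗ X) : Prop where
  sq : c ≫ c = 𝟙 _
  braid : YangBaxter c c c

theorem IsSymmetric.crossHead_sq (hc : IsSymmetric c) (Z : C) :
    crossHead c Z ≫ crossHead c Z = 𝟙 _ := by
  calc _ = 𝟙 _ ⊗≫ (c ≫ c) ▷ Z ⊗≫ 𝟙 _ := by
        unfold crossHead
        monoidal
    _ = _ := by
        rw [hc.sq]
        monoidal

theorem IsSymmetric.crossHead_braid (hc : IsSymmetric c) (Z : C) :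
    crossHead c (X ⊗ Z) ≫ (X ◁ crossHead c Z) ≫ crossHead c (X ⊗ Z) =
      (X ◁ crossHead c Z) ≫ crossHead c (X ⊗ Z) ≫ (X ◁ crossHead c Z) := by
  have h := hc.braid
  unfold YangBaxter at h
  calc _ = 𝟙 _ ⊗≫ ((α_ X X X).inv ≫ (c ▷ X) ≫ (α_ X X X).hom ≫ (X ◁ c) ≫ (α_ X X X).inv ≫
        (c ▷ X)) ▷ Z ⊗≫ 𝟙 _ := by
        unfold crossHead
        monoidal
    _ = _ := by
        rw [h]
        unfold crossHead
        monoidal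

section Sum

variable [Preadditive C]

/-- The sum over all positions of the diagrams on `n + 1` strands in which the first strand at the
bottom crosses over to that position and the others keep their order. -/
def insertSum (c : X ⊗ X ⟶ X ⊗ X) : ∀ n : ℕ, (X ⊗ tensorPow X n ⟶ X ⊗ tensorPow X n)
  | 0 => 𝟙 _
  | n + 1 => 𝟙 _ + crossHead c (tensorPow X n) ≫ (X ◁ insertSum c n)

/-- The sum of the diagrams of all permutations of `n` strands, a permutation being split into one
of the last `n - 1` strands followed by the insertion of the first. -/
def symSum (c : X ⊗ X ⟶ X ⊗ X) : ∀ n : ℕ, (tensorPow X n ⟶ tensorPow X n)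
  | 0 => 𝟙 _
  | n + 1 => (X ◁ symSum c n) ≫ insertSum c n

theorem symSum_succ (c : X ⊗ X ⟶ X ⊗ X) (n : ℕ) :
    symSum c (n + 1) = (X ◁ symSum c n) ≫ insertSum c n := rfl

theorem insertSum_succ (c : X ⊗ X ⟶ X ⊗ X) (n : ℕ) :
    insertSum c (n + 1) = 𝟙 _ + crossHead c (tensorPow X n) ≫ (X ◁ insertSum c n) := rfl

end Sum

variable [Preadditive C] [Linear ℂ C]

/-- `SwapGen c n f r` says that `f` is the action on `Xⁿ` of an element of the group algebra of the
symmetric group, and `r` the sum of the coefficients of that element. -/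
inductive SwapGen (c : X ⊗ X ⟶ X ⊗ X) : ∀ n : ℕ, (tensorPow X n ⟶ tensorPow X n) → ℂ → Prop
  | id (n : ℕ) : SwapGen c n (𝟙 _) 1
  | head (n : ℕ) : SwapGen c (n + 2) (crossHead c (tensorPow X n)) 1
  | whisker {n : ℕ} {f : tensorPow X n ⟶ tensorPow X n} {r : ℂ} :
      SwapGen c n f r → SwapGen c (n + 1) (X ◁ f) r
  | comp {n : ℕ} {f g : tensorPow X n ⟶ tensorPow X n} {r s : ℂ} :
      SwapGen c n f r → SwapGen c n g s → SwapGen c n (f ≫ g) (r * s)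
  | add {n : ℕ} {f g : tensorPow X n ⟶ tensorPow X n} {r s : ℂ} :
      SwapGen c n f r → SwapGen c n g s → SwapGen c n (f + g) (r + s)
  | smul {n : ℕ} {f : tensorPow X n ⟶ tensorPow X n} {r : ℂ} (a : ℂ) :
      SwapGen c n f r → SwapGen c n (a • f) (a * r)

variable [MonoidalPreadditive C] [MonoidalLinear ℂ C]

theorem swapGen_insertSum : ∀ n : ℕ, SwapGen c (n + 1) (insertSum c n) (n + 1)
  | 0 => by
    have h := SwapGen.id (c := c) 1
    rwa [← zero_add (1 : ℂ), ← Nat.cast_zero] at h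
  | n + 1 => by
    have h := (SwapGen.id (c := c) (n + 2)).add
      ((SwapGen.head n).comp (swapGen_insertSum n).whisker)
    rw [one_mul, add_comm (1 : ℂ)] at h
    exact_mod_cast h

theorem swapGen_symSum : ∀ n : ℕ, SwapGen c n (symSum c n) n.factorial
  | 0 => by
    rw [Nat.factorial_zero, Nat.cast_one]
    exact SwapGen.id 0
  | n + 1 => by
    have h := (swapGen_symSum n).whisker.comp (swapGen_insertSum (c := c) n)
    rw [Nat.factorial_succ, mul_comm]
    exact_mod_cast h

/-- The ring identity behind `IsSymmetric.crossHead_insertSum`.  There `h` and `a` are crossings of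
neighbouring strands, `b` is an insertion sum, and `1 + b * h` is the next one (products of
endomorphisms are in the reverse order of `≫`). -/
theorem braid_absorb {R : Type*} [Ring R] {h a b d : R} (hh : h * h = 1)
    (hah : h * a * h = a * h * a) (hd : h * d = d * h) (hb : b = 1 + d * a)
    (had : b * d * a = b * d) : (1 + b * h) * b * h = (1 + b * h) * b := by
  have e₁ : b * h * b * h = b + b * d * h * a := by
    calc _ = b * (h * h) + b * (h * d) * a * h := by
          conv_lhs => rw [mul_assoc, mul_assoc, hb]
          conv_rhs => rw [hb]
          noncomm_ring
      _ = b * 1 + b * d * (h * a * h) := by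
          rw [hh, hd]
          noncomm_ring
      _ = b + (b * d * a) * h * a := by
          rw [hah]
          noncomm_ring
      _ = _ := by rw [had]
  have e₂ : b * h * b = b * h + b * d * h * a := by
    calc _ = b * h + b * (h * d) * a := by
          conv_lhs => rw [mul_assoc, hb]
          conv_rhs => rw [hb]
          noncomm_ring
      _ = _ := by
          rw [hd]
          noncomm_ring
  calc _ = b * h + b * h * b * h := by noncomm_ring
    _ = b + b * h * b := by
      rw [e₁, e₂]
      noncomm_ring
    _ = _ := by noncomm_ring

/-- Inserting the second and then the first strand at all positions produces all relative orders of
the two, so that a crossing of the two strands before has no effect. -/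
theorem IsSymmetric.crossHead_insertSum (hc : IsSymmetric c) : ∀ n : ℕ,
    crossHead c (tensorPow X n) ≫ (X ◁ insertSum c n) ≫ insertSum c (n + 1) =
      (X ◁ insertSum c n) ≫ insertSum c (n + 1)
  | 0 => by
    simp only [insertSum, MonoidalCategory.whiskerLeft_id, Category.id_comp, Category.comp_id,
      Preadditive.comp_add, hc.crossHead_sq, add_comm]
  | n + 1 => by
    have ih := congrArg (X ◁ ·) (hc.crossHead_insertSum n)
    simp only [MonoidalCategory.whiskerLeft_comp] at ih
    refine braid_absorb (R := End (X ⊗ (X ⊗ tensorPow X (n + 1))))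
      (h := crossHead c (tensorPow X (n + 1))) (a := X ◁ crossHead c (tensorPow X n))
      (b := X ◁ insertSum c (n + 1))
      (d := X ◁ X ◁ insertSum c n) (hc.crossHead_sq _) ?_ ?_ ?_ ?_
    · exact hc.crossHead_braid (tensorPow X n)
    · exact (crossHead_comp_whiskerLeft c (insertSum c n)).symm
    · exact (congrArg (X ◁ ·) (insertSum_succ c n)).trans (by
        simp only [MonoidalPreadditive.whiskerLeft_add, MonoidalCategory.whiskerLeft_id,
          MonoidalCategory.whiskerLeft_comp]
        rfl)
    · exact ih

/-- The sum over the symmetric group absorbs crossings from below. -/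
theorem SwapGen.comp_symSum (hc : IsSymmetric c) {n : ℕ} {f : tensorPow X n ⟶ tensorPow X n} {r : ℂ}
    (hf : SwapGen c n f r) : f ≫ symSum c n = r • symSum c n := by
  induction hf with
  | id n => rw [Category.id_comp, one_smul]
  | head n =>
    have h : symSum c (n + 2) = (X ◁ X ◁ symSum c n) ≫ (X ◁ insertSum c n) ≫
        insertSum c (n + 1) := by
      rw [symSum_succ, symSum_succ, MonoidalCategory.whiskerLeft_comp, Category.assoc]
    rw [h, one_smul]
    exact (Category.assoc _ _ _).symm.trans <| (congrArg (· ≫ _)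
      (crossHead_comp_whiskerLeft c (symSum c n))).trans <| (Category.assoc _ _ _).trans <|
        congrArg (_ ≫ ·) (hc.crossHead_insertSum n)
  | whisker hf ih =>
    rw [symSum_succ]
    refine (Category.assoc _ _ _).symm.trans ?_
    rw [← MonoidalCategory.whiskerLeft_comp, ih, MonoidalLinear.whiskerLeft_smul,
      Linear.smul_comp]
  | comp hf hg ihf ihg => rw [Category.assoc, ihg, Linear.comp_smul, ihf, smul_smul, mul_comm]
  | add hf hg ihf ihg => rw [Preadditive.add_comp, ihf, ihg, add_smul]
  | smul a hf ih => rw [Linear.smul_comp, ih, smul_smul]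

/-- `E_{n+2} = 1 ⊗ E_{n+1} + (1 / n!) (1 ⊗ E_{n+1}) c (1 ⊗ E_{n+1})`, the decomposition of the
symmetric group into double cosets of the stabilizer of the first strand.  The hypothesis is a case
of absorption from above, which is only available later, the present formula being used in its
proof. -/
theorem symSum_add_two_of_absorb (n : ℕ)
    (h : symSum c (n + 1) ≫ (X ◁ symSum c n) = (n.factorial : ℂ) • symSum c (n + 1)) :
    symSum c (n + 2) = X ◁ symSum c (n + 1) + (1 / (n.factorial : ℂ)) •
      ((X ◁ symSum c (n + 1)) ≫ crossHead c (tensorPow X n) ≫ (X ◁ symSum c (n + 1))) := by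
  have hn : (n.factorial : ℂ) ≠ 0 := Nat.cast_ne_zero.2 n.factorial_ne_zero
  have h' : (X ◁ symSum c (n + 1)) ≫ (X ◁ X ◁ symSum c n) =
      (n.factorial : ℂ) • (X ◁ symSum c (n + 1)) := by
    rw [← MonoidalCategory.whiskerLeft_comp, h, MonoidalLinear.whiskerLeft_smul]
  have e : (X ◁ symSum c (n + 1)) ≫ crossHead c (tensorPow X n) ≫ (X ◁ symSum c (n + 1)) =
      (n.factorial : ℂ) • ((X ◁ symSum c (n + 1)) ≫ crossHead c (tensorPow X n) ≫
        (X ◁ insertSum c n)) := by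
    have e' : crossHead c (tensorPow X n) ≫ (X ◁ symSum c (n + 1)) =
        (X ◁ X ◁ symSum c n) ≫ crossHead c (tensorPow X n) ≫ (X ◁ insertSum c n) := by
      rw [symSum_succ c n, MonoidalCategory.whiskerLeft_comp, ← Category.assoc,
        crossHead_comp_whiskerLeft, Category.assoc]
    rw [e', reassoc_of% h', Linear.smul_comp]
  rw [e, smul_smul, one_div, inv_mul_cancel₀ hn, one_smul, symSum_succ c (n + 1), insertSum_succ,
    Preadditive.comp_add, Category.comp_id]

/-- The induction step for absorption from above, on the number of strands. -/
theorem SwapGen.symSum_comp_aux (hc : IsSymmetric c) {k : ℕ} {f : tensorPow X k ⟶ tensorPow X k}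
    {r : ℂ} (hf : SwapGen c k f r)
    (ih : ∀ j < k, ∀ (g : tensorPow X j ⟶ tensorPow X j) (s : ℂ), SwapGen c j g s →
      symSum c j ≫ g = s • symSum c j) : symSum c k ≫ f = r • symSum c k := by
  induction hf with
  | id n => rw [Category.comp_id, one_smul]
  | head n =>
    rw [one_smul, symSum_succ c (n + 1), Category.assoc]
    cases n with
    | zero =>
      refine congrArg (_ ≫ ·) ?_
      simp only [insertSum, MonoidalCategory.whiskerLeft_id, Category.comp_id,
        Preadditive.add_comp, Category.id_comp, hc.crossHead_sq]
      exact add_comm _ _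
    | succ m =>
      -- the crossing exchanges the first two terms of the insertion sum and fixes the rest up to a
      -- crossing of the other strands, which is absorbed
      have h := ih (m + 2) (Nat.lt_succ_self _) _ _ (SwapGen.head m)
      rw [one_smul] at h
      have ha : (X ◁ symSum c (m + 2)) ≫ (X ◁ crossHead c (tensorPow X m)) =
          X ◁ symSum c (m + 2) := by
        rw [← MonoidalCategory.whiskerLeft_comp, h]
      have e : insertSum c (m + 2) ≫ crossHead c (tensorPow X (m + 1)) =
          crossHead c (tensorPow X (m + 1)) + 𝟙 _ + (X ◁ crossHead c (tensorPow X m)) ≫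
            crossHead c (tensorPow X (m + 1)) ≫ (X ◁ crossHead c (tensorPow X m)) ≫
              (X ◁ X ◁ insertSum c m) := by
        rw [insertSum_succ, insertSum_succ, MonoidalPreadditive.whiskerLeft_add,
          MonoidalCategory.whiskerLeft_id, MonoidalCategory.whiskerLeft_comp]
        simp only [Preadditive.add_comp, Preadditive.comp_add, Category.id_comp, Category.comp_id,
          Category.assoc, hc.crossHead_sq, add_assoc]
        rw [← crossHead_comp_whiskerLeft, ← reassoc_of% hc.crossHead_braid]
      rw [e, Preadditive.comp_add, reassoc_of% ha, insertSum_succ, insertSum_succ]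
      simp only [MonoidalPreadditive.whiskerLeft_add, Preadditive.comp_add,
        MonoidalCategory.whiskerLeft_id, Category.comp_id, MonoidalCategory.whiskerLeft_comp]
      abel
  | @whisker n f r hf _ =>
    cases n with
    | zero =>
      have h := ih 0 (Nat.lt_succ_self _) _ _ hf
      rw [symSum_succ, Category.assoc]
      change _ ≫ 𝟙 _ ≫ _ = r • (_ ≫ 𝟙 _)
      rw [Category.id_comp, Category.comp_id, ← MonoidalCategory.whiskerLeft_comp, h,
        MonoidalLinear.whiskerLeft_smul]
    | succ m =>
      have h : (X ◁ symSum c (m + 1)) ≫ (X ◁ f) = r • (X ◁ symSum c (m + 1)) := by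
        rw [← MonoidalCategory.whiskerLeft_comp, ih _ (Nat.lt_succ_self _) _ _ hf,
          MonoidalLinear.whiskerLeft_smul]
      rw [symSum_add_two_of_absorb m
        (ih _ (Nat.lt_succ_self _) _ _ (swapGen_symSum m).whisker)]
      simp only [Preadditive.add_comp, Linear.smul_comp, Category.assoc, h, Linear.comp_smul,
        smul_add]
      rw [smul_comm]
  | comp hf hg ihf ihg =>
    rw [← Category.assoc, ihf ih, Linear.smul_comp, ihg ih, smul_smul]
  | add hf hg ihf ihg => rw [Preadditive.comp_add, ihf ih, ihg ih, add_smul]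
  | smul a hf ihf => rw [Linear.comp_smul, ihf ih, smul_smul]

/-- The sum over the symmetric group absorbs crossings from above. -/
theorem SwapGen.symSum_comp (hc : IsSymmetric c) {n : ℕ} {f : tensorPow X n ⟶ tensorPow X n}
    {r : ℂ} (hf : SwapGen c n f r) : symSum c n ≫ f = r • symSum c n := by
  induction n using Nat.strong_induction_on generalizing r with
  | _ n ih => exact hf.symSum_comp_aux hc fun j hj g s hg => ih j hj hg

variable (c) in
/-- The symmetrizer of `n` strands, an idempotent if `c` satisfies the relations of the symmetric
group. -/
def symmetrizer (n : ℕ) : tensorPow X n ⟶ tensorPow X n := (1 / (n.factorial : ℂ)) • symSum c n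

theorem factorial_smul_symmetrizer (n : ℕ) :
    (n.factorial : ℂ) • symmetrizer c n = symSum c n := by
  rw [symmetrizer, smul_smul, mul_one_div_cancel (Nat.cast_ne_zero.2 n.factorial_ne_zero),
    one_smul]

theorem symmetrizer_zero : symmetrizer c 0 = 𝟙 _ := by
  rw [symmetrizer, Nat.factorial_zero, Nat.cast_one, one_div_one, one_smul]
  rfl

theorem swapGen_symmetrizer (n : ℕ) : SwapGen c n (symmetrizer c n) 1 := by
  have h := (swapGen_symSum (c := c) n).smul (1 / (n.factorial : ℂ))
  rwa [one_div_mul_cancel (Nat.cast_ne_zero.2 n.factorial_ne_zero)] at h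

theorem SwapGen.comp_symmetrizer (hc : IsSymmetric c) {n : ℕ}
    {f : tensorPow X n ⟶ tensorPow X n} {r : ℂ} (hf : SwapGen c n f r) :
    f ≫ symmetrizer c n = r • symmetrizer c n := by
  rw [symmetrizer, Linear.comp_smul, hf.comp_symSum hc, smul_comm]

theorem SwapGen.symmetrizer_comp (hc : IsSymmetric c) {n : ℕ}
    {f : tensorPow X n ⟶ tensorPow X n} {r : ℂ} (hf : SwapGen c n f r) :
    symmetrizer c n ≫ f = r • symmetrizer c n := by
  rw [symmetrizer, Linear.smul_comp, hf.symSum_comp hc, smul_comm]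

theorem symmetrizer_idem (hc : IsSymmetric c) (n : ℕ) :
    symmetrizer c n ≫ symmetrizer c n = symmetrizer c n := by
  rw [(swapGen_symmetrizer n).comp_symmetrizer hc, one_smul]

theorem whiskerLeft_symmetrizer_comp (hc : IsSymmetric c) (n : ℕ) :
    (X ◁ symmetrizer c n) ≫ symmetrizer c (n + 1) = symmetrizer c (n + 1) := by
  rw [(swapGen_symmetrizer n).whisker.comp_symmetrizer hc, one_smul]

theorem symmetrizer_comp_whiskerLeft (hc : IsSymmetric c) (n : ℕ) :
    symmetrizer c (n + 1) ≫ (X ◁ symmetrizer c n) = symmetrizer c (n + 1) := by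
  rw [(swapGen_symmetrizer n).whisker.symmetrizer_comp hc, one_smul]

theorem crossHead_comp_symmetrizer (hc : IsSymmetric c) (n : ℕ) :
    crossHead c (tensorPow X n) ≫ symmetrizer c (n + 2) = symmetrizer c (n + 2) := by
  rw [(SwapGen.head n).comp_symmetrizer hc, one_smul]

theorem symmetrizer_comp_crossHead (hc : IsSymmetric c) (n : ℕ) :
    symmetrizer c (n + 2) ≫ crossHead c (tensorPow X n) = symmetrizer c (n + 2) := by
  rw [(SwapGen.head n).symmetrizer_comp hc, one_smul]

theorem symmetrizer_one : symmetrizer c 1 = 𝟙 _ := by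
  rw [symmetrizer, symSum_succ]
  simp [symSum, insertSum]

theorem symmetrizer_add_two (hc : IsSymmetric c) (n : ℕ) :
    ((n : ℂ) + 2) • symmetrizer c (n + 2) = X ◁ symmetrizer c (n + 1) + ((n : ℂ) + 1) •
      ((X ◁ symmetrizer c (n + 1)) ≫ crossHead c (tensorPow X n) ≫
        (X ◁ symmetrizer c (n + 1))) := by
  have hn : ((n + 1).factorial : ℂ) ≠ 0 := Nat.cast_ne_zero.2 (n + 1).factorial_ne_zero
  have hn' : (n.factorial : ℂ) ≠ 0 := Nat.cast_ne_zero.2 n.factorial_ne_zero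
  have h := symSum_add_two_of_absorb n ((swapGen_symSum (c := c) n).whisker.symSum_comp hc)
  rw [← factorial_smul_symmetrizer, ← factorial_smul_symmetrizer,
    MonoidalLinear.whiskerLeft_smul] at h
  simp only [Linear.smul_comp, Linear.comp_smul, smul_smul] at h
  have h2 := congrArg ((1 / ((n + 1).factorial : ℂ)) • ·) h
  simp only [smul_add, smul_smul] at h2
  rw [one_div_mul_cancel hn, one_smul] at h2
  convert h2 using 2
  · rw [Nat.factorial_succ (n + 1)]
    push_cast
    field_simp
    ring
  · congr 1
    rw [Nat.factorial_succ n]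
    push_cast
    field_simp

end Symmetrizer

/-! ### Sliding a strand across a tensor power -/

section Slide

variable {C : Type*} [Category C] [MonoidalCategory C] {X Y : C}

/-- The strand `Y` passes to the left across `n` strands `X`. -/
def slideLeft (z : X ⊗ Y ⟶ Y ⊗ X) : ∀ n : ℕ, (tensorPow X n ⊗ Y ⟶ Y ⊗ tensorPow X n)
  | 0 => (λ_ Y).hom ≫ (ρ_ Y).inv
  | n + 1 => (α_ X (tensorPow X n) Y).hom ≫ (X ◁ slideLeft z n) ≫ (α_ X Y (tensorPow X n)).inv ≫
      (z ▷ tensorPow X n) ≫ (α_ Y X (tensorPow X n)).hom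

/-- The strand `Y` passes to the right across `n` strands `X`. -/
def slideRight (t : Y ⊗ X ⟶ X ⊗ Y) : ∀ n : ℕ, (Y ⊗ tensorPow X n ⟶ tensorPow X n ⊗ Y)
  | 0 => (ρ_ Y).hom ≫ (λ_ Y).inv
  | n + 1 => (α_ Y X (tensorPow X n)).inv ≫ (t ▷ tensorPow X n) ≫ (α_ X Y (tensorPow X n)).hom ≫
      (X ◁ slideRight t n) ≫ (α_ X (tensorPow X n) Y).inv

variable (z : X ⊗ Y ⟶ Y ⊗ X) (t : Y ⊗ X ⟶ X ⊗ Y)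

theorem slideLeft_succ (n : ℕ) : slideLeft z (n + 1) =
    (α_ X (tensorPow X n) Y).hom ≫ (X ◁ slideLeft z n) ≫ (α_ X Y (tensorPow X n)).inv ≫
      (z ▷ tensorPow X n) ≫ (α_ Y X (tensorPow X n)).hom := rfl

theorem slideRight_succ (n : ℕ) : slideRight t (n + 1) =
    (α_ Y X (tensorPow X n)).inv ≫ (t ▷ tensorPow X n) ≫ (α_ X Y (tensorPow X n)).hom ≫
      (X ◁ slideRight t n) ≫ (α_ X (tensorPow X n) Y).inv := rfl

variable {z t}

theorem slideLeft_comp_slideRight (h : z ≫ t = 𝟙 _) :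
    ∀ n : ℕ, slideLeft z n ≫ slideRight t n = 𝟙 _
  | 0 => by simp [slideLeft, slideRight]
  | n + 1 => by
    calc _ = 𝟙 _ ⊗≫ (X ◁ slideLeft z n) ⊗≫ ((z ≫ t) ▷ tensorPow X n) ⊗≫
          (X ◁ slideRight t n) ⊗≫ 𝟙 _ := by
          rw [slideLeft_succ, slideRight_succ]
          monoidal
      _ = 𝟙 _ ⊗≫ (X ◁ (slideLeft z n ≫ slideRight t n)) ⊗≫ 𝟙 _ := by
          rw [h]
          monoidal
      _ = _ := by
          rw [slideLeft_comp_slideRight h n]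
          monoidal

theorem slideRight_comp_slideLeft (h : t ≫ z = 𝟙 _) :
    ∀ n : ℕ, slideRight t n ≫ slideLeft z n = 𝟙 _
  | 0 => by simp [slideLeft, slideRight]
  | n + 1 => by
    calc _ = 𝟙 _ ⊗≫ (t ▷ tensorPow X n) ⊗≫ (X ◁ (slideRight t n ≫ slideLeft z n)) ⊗≫
          (z ▷ tensorPow X n) ⊗≫ 𝟙 _ := by
          rw [slideLeft_succ, slideRight_succ]
          monoidal
      _ = 𝟙 _ ⊗≫ ((t ≫ z) ▷ tensorPow X n) ⊗≫ 𝟙 _ := by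
          rw [slideRight_comp_slideLeft h n]
          monoidal
      _ = _ := by
          rw [h]
          monoidal

theorem whiskerLeft_comp_slideLeft {g : Y ⟶ Y} (h : (X ◁ g) ≫ z = z ≫ (g ▷ X)) :
    ∀ n : ℕ, (tensorPow X n ◁ g) ≫ slideLeft z n = slideLeft z n ≫ (g ▷ tensorPow X n)
  | 0 => by
    simp only [slideLeft]
    monoidal
  | n + 1 => by
    calc _ = 𝟙 _ ⊗≫ (X ◁ (tensorPow X n ◁ g ≫ slideLeft z n)) ⊗≫ (z ▷ tensorPow X n) ⊗≫ 𝟙 _ := by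
          rw [slideLeft_succ]
          monoidal
      _ = 𝟙 _ ⊗≫ (X ◁ slideLeft z n) ⊗≫ (((X ◁ g) ≫ z) ▷ tensorPow X n) ⊗≫ 𝟙 _ := by
          rw [whiskerLeft_comp_slideLeft h n]
          monoidal
      _ = _ := by
          rw [h, slideLeft_succ]
          monoidal

/-- A crossing of two strands `Y` can be moved past `n` strands `X`. -/
theorem YangBaxter.slideLeft {d : Y ⊗ Y ⟶ Y ⊗ Y} (h : YangBaxter z z d) :
    ∀ n : ℕ, YangBaxter (slideLeft z n) (slideLeft z n) d
  | 0 => by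
    unfold YangBaxter
    simp only [Heisenberg.slideLeft]
    calc _ = 𝟙 _ ⊗≫ d ⊗≫ 𝟙 _ := by monoidal
      _ = _ := by monoidal
  | n + 1 => by
    have ih := h.slideLeft n
    unfold YangBaxter at h ih ⊢
    calc _ = 𝟙 _ ⊗≫ X ◁ Heisenberg.slideLeft z n ▷ Y ⊗≫ (z ▷ (tensorPow X n ⊗ Y) ≫
          (Y ⊗ X) ◁ Heisenberg.slideLeft z n) ⊗≫
          Y ◁ z ▷ tensorPow X n ⊗≫ d ▷ (X ⊗ tensorPow X n) ⊗≫ 𝟙 _ := by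
          rw [slideLeft_succ]
          monoidal
      _ = 𝟙 _ ⊗≫ X ◁ Heisenberg.slideLeft z n ▷ Y ⊗≫ X ◁ Y ◁ Heisenberg.slideLeft z n ⊗≫
          ((α_ X Y Y).inv ≫ (z ▷ Y) ≫ (α_ Y X Y).hom ≫ (Y ◁ z) ≫ (α_ Y Y X).inv ≫ (d ▷ X)) ▷
            tensorPow X n ⊗≫ 𝟙 _ := by
          rw [← whisker_exchange]
          monoidal
      _ = 𝟙 _ ⊗≫ X ◁ ((α_ (tensorPow X n) Y Y).inv ≫ (Heisenberg.slideLeft z n ▷ Y) ≫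
          (α_ Y (tensorPow X n) Y).hom ≫ (Y ◁ Heisenberg.slideLeft z n) ≫
          (α_ Y Y (tensorPow X n)).inv ≫ (d ▷ tensorPow X n)) ⊗≫
          z ▷ (Y ⊗ tensorPow X n) ⊗≫ Y ◁ z ▷ tensorPow X n ⊗≫ 𝟙 _ := by
          rw [h]
          monoidal
      _ = 𝟙 _ ⊗≫ X ◁ tensorPow X n ◁ d ⊗≫ X ◁ Heisenberg.slideLeft z n ▷ Y ⊗≫
          ((X ⊗ Y) ◁ Heisenberg.slideLeft z n ≫
          z ▷ (Y ⊗ tensorPow X n)) ⊗≫ Y ◁ z ▷ tensorPow X n ⊗≫ 𝟙 _ := by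
          rw [ih]
          monoidal
      _ = _ := by
          rw [whisker_exchange, slideLeft_succ]
          monoidal

variable [Preadditive C] [Linear ℂ C] [MonoidalPreadditive C] [MonoidalLinear ℂ C]

/-- A strand `Y` can be moved past any combination of permutation diagrams on the strands `X`. -/
theorem SwapGen.whiskerRight_comp_slideLeft {c : X ⊗ X ⟶ X ⊗ X} (h : YangBaxter c z z) {n : ℕ}
    {f : tensorPow X n ⟶ tensorPow X n} {r : ℂ} (hf : SwapGen c n f r) :
    (f ▷ Y) ≫ slideLeft z n = slideLeft z n ≫ (Y ◁ f) := by
  induction hf with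
  | id n => simp
  | head n =>
    unfold YangBaxter at h
    calc _ = 𝟙 _ ⊗≫ (c ▷ (tensorPow X n ⊗ Y) ≫ (X ⊗ X) ◁ slideLeft z n) ⊗≫
          X ◁ z ▷ tensorPow X n ⊗≫ z ▷ (X ⊗ tensorPow X n) ⊗≫ 𝟙 _ := by
          rw [slideLeft_succ, slideLeft_succ]
          unfold crossHead
          monoidal
      _ = 𝟙 _ ⊗≫ X ◁ X ◁ slideLeft z n ⊗≫ ((α_ X X Y).inv ≫ (c ▷ Y) ≫ (α_ X X Y).hom ≫ (X ◁ z) ≫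
          (α_ X Y X).inv ≫ (z ▷ X)) ▷ tensorPow X n ⊗≫ 𝟙 _ := by
          rw [← whisker_exchange]
          monoidal
      _ = _ := by
          rw [h, slideLeft_succ, slideLeft_succ]
          unfold crossHead
          monoidal
  | @whisker n f r hf ih =>
    calc _ = 𝟙 _ ⊗≫ X ◁ ((f ▷ Y) ≫ slideLeft z n) ⊗≫ z ▷ tensorPow X n ⊗≫ 𝟙 _ := by
          rw [slideLeft_succ]
          monoidal
      _ = 𝟙 _ ⊗≫ X ◁ slideLeft z n ⊗≫ ((X ⊗ Y) ◁ f ≫ z ▷ tensorPow X n) ⊗≫ 𝟙 _ := by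
          rw [ih]
          monoidal
      _ = _ := by
          rw [whisker_exchange, slideLeft_succ]
          monoidal
  | comp hf hg ihf ihg =>
    rw [comp_whiskerRight, Category.assoc, ihg, reassoc_of% ihf, MonoidalCategory.whiskerLeft_comp]
  | add hf hg ihf ihg =>
    rw [MonoidalPreadditive.add_whiskerRight, Preadditive.add_comp, ihf, ihg,
      MonoidalPreadditive.whiskerLeft_add, Preadditive.comp_add]
  | smul a hf ih =>
    rw [MonoidalLinear.smul_whiskerRight, Linear.smul_comp, ih, MonoidalLinear.whiskerLeft_smul,
      Linear.comp_smul]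

/-- The isomorphism crosses the `m` strands one after the other past the `n` strands. -/
theorem exists_braiding {c : X ⊗ X ⟶ X ⊗ X} (hc : IsSymmetric c) (m n : ℕ) :
    ∃ σ : tensorPow X m ⊗ tensorPow X n ≅ tensorPow X n ⊗ tensorPow X m,
      (symSum c m ⊗ₘ symSum c n) ≫ σ.hom = σ.hom ≫ (symSum c n ⊗ₘ symSum c m) := by
  have hy := hc.braid.slideLeft n
  have yz := slideLeft_comp_slideRight hc.sq n
  have zy := slideRight_comp_slideLeft hc.sq n
  have hnat := (swapGen_symSum (c := c) n).whiskerRight_comp_slideLeft hc.braid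
  set y := slideLeft c n
  set z := slideRight c n
  have hz : YangBaxter c z z := by
    unfold YangBaxter at hy ⊢
    let Y₂ : tensorPow X n ⊗ (X ⊗ X) ≅ (X ⊗ X) ⊗ tensorPow X n :=
      { hom := (α_ _ _ _).inv ≫ (y ▷ X) ≫ (α_ _ _ _).hom ≫ (X ◁ y) ≫ (α_ _ _ _).inv
        inv := (α_ _ _ _).hom ≫ (X ◁ z) ≫ (α_ _ _ _).inv ≫ (z ▷ X) ≫ (α_ _ _ _).hom
        hom_inv_id := by
          simp only [Category.assoc, Iso.inv_hom_id_assoc]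
          rw [← MonoidalCategory.whiskerLeft_comp_assoc, yz]
          simp only [MonoidalCategory.whiskerLeft_id, Category.id_comp, Iso.hom_inv_id_assoc]
          rw [← comp_whiskerRight_assoc, yz]
          simp
        inv_hom_id := by
          simp only [Category.assoc, Iso.hom_inv_id_assoc]
          rw [← comp_whiskerRight_assoc, zy]
          simp only [id_whiskerRight, Category.id_comp, Iso.inv_hom_id_assoc]
          rw [← MonoidalCategory.whiskerLeft_comp_assoc, zy]
          simp }
    have e : Y₂.hom ≫ (c ▷ tensorPow X n) = (tensorPow X n ◁ c) ≫ Y₂.hom := by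
      simpa only [Y₂, Category.assoc] using hy
    have e' : (c ▷ tensorPow X n) ≫ Y₂.inv = Y₂.inv ≫ (tensorPow X n ◁ c) := by
      rw [Iso.comp_inv_eq, Category.assoc, ← e, Iso.inv_hom_id_assoc]
    simp only [Y₂, Category.assoc] at e'
    rw [← cancel_mono (α_ _ _ _).hom, ← cancel_epi (α_ _ _ _).hom]
    simp only [Category.assoc, Iso.inv_hom_id, Iso.hom_inv_id_assoc, Category.comp_id]
    exact e'
  have hznat : (X ◁ symSum c n) ≫ z = z ≫ (symSum c n ▷ X) := by
    calc _ = (z ≫ y) ≫ (X ◁ symSum c n) ≫ z := by rw [zy, Category.id_comp]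
      _ = z ≫ (y ≫ (X ◁ symSum c n)) ≫ z := by simp only [Category.assoc]
      _ = z ≫ (symSum c n ▷ X) ≫ (y ≫ z) := by rw [← hnat, Category.assoc]
      _ = _ := by rw [yz, Category.comp_id]
  refine ⟨⟨slideLeft z m, slideRight y m, slideLeft_comp_slideRight zy m,
    slideRight_comp_slideLeft yz m⟩, ?_⟩
  change _ ≫ slideLeft z m = slideLeft z m ≫ _
  rw [MonoidalCategory.tensorHom_def', Category.assoc,
    (swapGen_symSum m).whiskerRight_comp_slideLeft hz,
    reassoc_of% (whiskerLeft_comp_slideLeft hznat m), MonoidalCategory.tensorHom_def]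

end Slide

/-! ### One downward strand and many upward strands -/

section Commutation

variable {C : Type*} [Category C] [MonoidalCategory C]
  [Preadditive C] [Linear ℂ C] [MonoidalPreadditive C] [MonoidalLinear ℂ C] {P Q : C}

/-- The relations between an upward strand `P` and a downward strand `Q` on which the argument
rests, for the upward crossing `c`, the downward crossing `d`, the sideways crossings `s`
(rightward) and `t` (leftward), and the counterclockwise cup and cap.  Clockwise cups and caps do
not occur: they serve only to define `d`, `s` and `t`, and what is left of planar isotopy is that a
strand may be pulled across a cup or cap (`cup_P`, `cup_Q`, `cap_P`). -/
structure HeisenbergRelations (c : P ⊗ P ⟶ P ⊗ P) (d : Q ⊗ Q ⟶ Q ⊗ Q) (s : P ⊗ Q ⟶ Q ⊗ P)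
    (t : Q ⊗ P ⟶ P ⊗ Q) (cup : 𝟙_ C ⟶ Q ⊗ P) (cap : Q ⊗ P ⟶ 𝟙_ C) : Prop where
  symmP : IsSymmetric c
  sq : d ≫ d = 𝟙 _
  braid_PPQ : YangBaxter c s s
  braid_PQQ : YangBaxter s s d
  cup_P : (ρ_ P).inv ≫ (P ◁ cup) ≫ (α_ P Q P).inv ≫ (s ▷ P) ≫ (α_ Q P P).hom =
    (λ_ P).inv ≫ (cup ▷ P) ≫ (α_ Q P P).hom ≫ (Q ◁ c)
  cup_Q : (ρ_ Q).inv ≫ (Q ◁ cup) ≫ (α_ Q Q P).inv ≫ (d ▷ P) ≫ (α_ Q Q P).hom =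
    (λ_ Q).inv ≫ (cup ▷ Q) ≫ (α_ Q P Q).hom ≫ (Q ◁ s)
  cap_P : (α_ Q P P).inv ≫ (t ▷ P) ≫ (α_ P Q P).hom ≫ (P ◁ cap) ≫ (ρ_ P).hom =
    (Q ◁ c) ≫ (α_ Q P P).inv ≫ (cap ▷ P) ≫ (λ_ P).hom
  st : s ≫ t = 𝟙 _
  ts : t ≫ s = 𝟙 _ - cap ≫ cup
  circle : cup ≫ cap = 𝟙 _
  curl : (λ_ P).inv ≫ (cup ▷ P) ≫ (α_ Q P P).hom ≫ (Q ◁ c) ≫ (α_ Q P P).inv ≫ (cap ▷ P) ≫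
    (λ_ P).hom = 0

/-- The creation of a pair of strands `Q`, `P` to the left of `Z`. -/
def cupLeft (cup : 𝟙_ C ⟶ Q ⊗ P) (Z : C) : Z ⟶ Q ⊗ (P ⊗ Z) :=
  (λ_ Z).inv ≫ (cup ▷ Z) ≫ (α_ Q P Z).hom

/-- The annihilation of a pair of strands `Q`, `P` to the left of `Z`. -/
def capLeft (cap : Q ⊗ P ⟶ 𝟙_ C) (Z : C) : Q ⊗ (P ⊗ Z) ⟶ Z :=
  (α_ Q P Z).inv ≫ (cap ▷ Z) ≫ (λ_ Z).hom

theorem cupLeft_naturality (cup : 𝟙_ C ⟶ Q ⊗ P) {Y Z : C} (f : Y ⟶ Z) :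
    f ≫ cupLeft cup Z = cupLeft cup Y ≫ (Q ◁ P ◁ f) := by
  calc _ = 𝟙 _ ⊗≫ (𝟙_ C ◁ f ≫ cup ▷ Z) ⊗≫ 𝟙 _ := by
        unfold cupLeft
        monoidal
    _ = _ := by
        rw [whisker_exchange]
        unfold cupLeft
        monoidal

theorem capLeft_naturality (cap : Q ⊗ P ⟶ 𝟙_ C) {Y Z : C} (f : Y ⟶ Z) :
    (Q ◁ P ◁ f) ≫ capLeft cap Z = capLeft cap Y ≫ f := by
  calc _ = 𝟙 _ ⊗≫ ((Q ⊗ P) ◁ f ≫ cap ▷ Z) ⊗≫ 𝟙 _ := by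
        unfold capLeft
        monoidal
    _ = _ := by
        rw [whisker_exchange]
        unfold capLeft
        monoidal

namespace HeisenbergRelations

variable {c : P ⊗ P ⟶ P ⊗ P} {d : Q ⊗ Q ⟶ Q ⊗ Q} {s : P ⊗ Q ⟶ Q ⊗ P} {t : Q ⊗ P ⟶ P ⊗ Q}
  {cup : 𝟙_ C ⟶ Q ⊗ P} {cap : Q ⊗ P ⟶ 𝟙_ C}

/-- The circle having the value `1`, the composite `ts = 1 - cap cup` kills the cup. -/
theorem cup_comp_t (H : HeisenbergRelations c d s t cup cap) : cup ≫ t = 0 := by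
  have h : cup ≫ t ≫ s = 0 := by
    rw [H.ts, Preadditive.comp_sub, Category.comp_id, ← Category.assoc, H.circle, Category.id_comp,
      sub_self]
  calc _ = (cup ≫ t ≫ s) ≫ t := by rw [Category.assoc, Category.assoc, H.st, Category.comp_id]
    _ = 0 := by rw [h, Limits.zero_comp]

theorem s_comp_cap (H : HeisenbergRelations c d s t cup cap) : s ≫ cap = 0 := by
  have h : (t ≫ s) ≫ cap = 0 := by
    rw [H.ts, Preadditive.sub_comp, Category.id_comp, Category.assoc, H.circle, Category.comp_id,
      sub_self]
  calc _ = s ≫ (t ≫ s) ≫ cap := by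
        rw [Category.assoc, ← Category.assoc s t, H.st, Category.id_comp]
    _ = 0 := by rw [h, Limits.comp_zero]

theorem cupLeft_comp_capLeft (H : HeisenbergRelations c d s t cup cap) (Z : C) :
    cupLeft cup Z ≫ capLeft cap Z = 𝟙 _ := by
  calc _ = 𝟙 _ ⊗≫ (cup ≫ cap) ▷ Z ⊗≫ 𝟙 _ := by
        unfold cupLeft capLeft
        monoidal
    _ = _ := by
        rw [H.circle]
        monoidal

theorem cupLeft_crossHead_capLeft (H : HeisenbergRelations c d s t cup cap) (Z : C) :
    cupLeft cup (P ⊗ Z) ≫ (Q ◁ crossHead c Z) ≫ capLeft cap (P ⊗ Z) = 0 := by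
  calc _ = 𝟙 _ ⊗≫ ((λ_ P).inv ≫ (cup ▷ P) ≫ (α_ Q P P).hom ≫ (Q ◁ c) ≫ (α_ Q P P).inv ≫
        (cap ▷ P) ≫ (λ_ P).hom) ▷ Z ⊗≫ 𝟙 _ := by
        unfold cupLeft capLeft crossHead
        monoidal
    _ = _ := by
        rw [H.curl]
        simp [monoidalComp]

/-- Closing the first of `n + 1` symmetrized upward strands on the left gives `e_n / (n + 1)`: in
the recursion for `e_{n+1}`, the part without a crossing yields a circle and the other a left
curl. -/
theorem partialTrace_symmetrizer (H : HeisenbergRelations c d s t cup cap) : ∀ n : ℕ,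
    ((n : ℂ) + 1) • (cupLeft cup (tensorPow P n) ≫ (Q ◁ symmetrizer c (n + 1)) ≫
      capLeft cap (tensorPow P n)) = symmetrizer c n
  | 0 => by
    rw [symmetrizer_one, symmetrizer_zero, MonoidalCategory.whiskerLeft_id]
    erw [Category.id_comp]
    rw [H.cupLeft_comp_capLeft]
    simp
  | n + 1 => by
    have h : ((n : ℂ) + 2) • (cupLeft cup (tensorPow P (n + 1)) ≫ (Q ◁ symmetrizer c (n + 2)) ≫
        capLeft cap (tensorPow P (n + 1))) = cupLeft cup (tensorPow P (n + 1)) ≫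
          (Q ◁ (((n : ℂ) + 2) • symmetrizer c (n + 2))) ≫ capLeft cap (tensorPow P (n + 1)) := by
      rw [MonoidalLinear.whiskerLeft_smul, Linear.smul_comp, Linear.comp_smul]
    have e : (((n + 1 : ℕ) : ℂ) + 1) = (n : ℂ) + 2 := by
      push_cast
      ring
    rw [e, h, symmetrizer_add_two H.symmP]
    simp only [MonoidalPreadditive.whiskerLeft_add, MonoidalLinear.whiskerLeft_smul,
      Preadditive.add_comp, Preadditive.comp_add, Linear.smul_comp, Linear.comp_smul,
      MonoidalCategory.whiskerLeft_comp, Category.assoc, capLeft_naturality]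
    rw [← reassoc_of% (cupLeft_naturality cup (symmetrizer c (n + 1))),
      reassoc_of% (H.cupLeft_crossHead_capLeft (tensorPow P n)),
      reassoc_of% (H.cupLeft_comp_capLeft)]
    simp

theorem cupLeft_comp_slideRight (H : HeisenbergRelations c d s t cup cap) (n : ℕ) :
    cupLeft cup (tensorPow P n) ≫ slideRight t (n + 1) = 0 := by
  calc _ = 𝟙 _ ⊗≫ (cup ≫ t) ▷ tensorPow P n ⊗≫ P ◁ slideRight t n ⊗≫ 𝟙 _ := by
        rw [slideRight_succ]
        unfold cupLeft
        monoidal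
    _ = _ := by
        rw [H.cup_comp_t]
        simp [monoidalComp]

theorem slideLeft_comp_capLeft (H : HeisenbergRelations c d s t cup cap) (n : ℕ) :
    slideLeft s (n + 1) ≫ capLeft cap (tensorPow P n) = 0 := by
  calc _ = 𝟙 _ ⊗≫ P ◁ slideLeft s n ⊗≫ (s ≫ cap) ▷ tensorPow P n ⊗≫ 𝟙 _ := by
        rw [slideLeft_succ]
        unfold capLeft
        monoidal
    _ = _ := by
        rw [H.s_comp_cap]
        simp [monoidalComp]

theorem whiskerLeft_cupLeft (H : HeisenbergRelations c d s t cup cap) (Z : C) :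
    (P ◁ cupLeft cup Z) ≫ crossHead s (P ⊗ Z) =
      cupLeft cup (P ⊗ Z) ≫ (Q ◁ crossHead c Z) := by
  have h := H.cup_P
  calc _ = 𝟙 _ ⊗≫ ((ρ_ P).inv ≫ (P ◁ cup) ≫ (α_ P Q P).inv ≫ (s ▷ P) ≫ (α_ Q P P).hom) ▷ Z ⊗≫
        𝟙 _ := by
        unfold cupLeft crossHead
        monoidal
    _ = _ := by
        rw [h]
        unfold cupLeft crossHead
        monoidal

theorem whiskerLeft_capLeft (H : HeisenbergRelations c d s t cup cap) (Z : C) :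
    crossHead t (P ⊗ Z) ≫ (P ◁ capLeft cap Z) =
      (Q ◁ crossHead c Z) ≫ capLeft cap (P ⊗ Z) := by
  have h := H.cap_P
  calc _ = 𝟙 _ ⊗≫ ((α_ Q P P).inv ≫ (t ▷ P) ≫ (α_ P Q P).hom ≫ (P ◁ cap) ≫ (ρ_ P).hom) ▷ Z ⊗≫
        𝟙 _ := by
        unfold capLeft crossHead
        monoidal
    _ = _ := by
        rw [h]
        unfold capLeft crossHead
        monoidal

/-- A strand `Q` created next to symmetrized upward strands cannot leave through all of them to the
right: by the recursion for the symmetrizer it either crosses its partner first, where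
`cup ≫ t = 0`, or crosses another strand twice, which reduces the number of strands. -/
theorem cupLeft_symmetrizer_slideRight (H : HeisenbergRelations c d s t cup cap) : ∀ n : ℕ,
    cupLeft cup (tensorPow P n) ≫ (Q ◁ symmetrizer c (n + 1)) ≫ slideRight t (n + 1) = 0
  | 0 => by
    rw [symmetrizer_one, MonoidalCategory.whiskerLeft_id]
    erw [Category.id_comp]
    exact H.cupLeft_comp_slideRight 0
  | n + 1 => by
    have hn : (n : ℂ) + 2 ≠ 0 := by exact_mod_cast (Nat.succ_ne_zero (n + 1))
    have key : cupLeft cup (tensorPow P (n + 1)) ≫ (Q ◁ crossHead c (tensorPow P n)) ≫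
        (Q ◁ P ◁ symmetrizer c (n + 1)) ≫ slideRight t (n + 2) = 0 := by
      rw [← reassoc_of% (H.whiskerLeft_cupLeft (tensorPow P n))]
      calc _ = 𝟙 _ ⊗≫ P ◁ cupLeft cup (tensorPow P n) ⊗≫ (s ▷ tensorPow P (n + 1) ≫
              (Q ⊗ P) ◁ symmetrizer c (n + 1)) ⊗≫ t ▷ tensorPow P (n + 1) ⊗≫
              P ◁ slideRight t (n + 1) ⊗≫ 𝟙 _ := by
            rw [slideRight_succ t (n + 1)]
            unfold crossHead
            monoidal
        _ = 𝟙 _ ⊗≫ P ◁ cupLeft cup (tensorPow P n) ⊗≫ (P ⊗ Q) ◁ symmetrizer c (n + 1) ⊗≫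
              (s ≫ t) ▷ tensorPow P (n + 1) ⊗≫ P ◁ slideRight t (n + 1) ⊗≫ 𝟙 _ := by
            rw [← whisker_exchange]
            monoidal
        _ = 𝟙 _ ⊗≫ P ◁ (cupLeft cup (tensorPow P n) ≫ (Q ◁ symmetrizer c (n + 1)) ≫
              slideRight t (n + 1)) ⊗≫ 𝟙 _ := by
            rw [H.st]
            monoidal
        _ = 0 := by
            rw [cupLeft_symmetrizer_slideRight H n]
            simp [monoidalComp]
    have e : ((n : ℂ) + 2) • (cupLeft cup (tensorPow P (n + 1)) ≫ (Q ◁ symmetrizer c (n + 2)) ≫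
        slideRight t (n + 2)) = cupLeft cup (tensorPow P (n + 1)) ≫
          (Q ◁ (((n : ℂ) + 2) • symmetrizer c (n + 2))) ≫ slideRight t (n + 2) := by
      rw [MonoidalLinear.whiskerLeft_smul, Linear.smul_comp, Linear.comp_smul]
    refine (smul_eq_zero_iff_right hn).1 ?_
    rw [e, symmetrizer_add_two H.symmP]
    simp only [MonoidalPreadditive.whiskerLeft_add, MonoidalLinear.whiskerLeft_smul,
      Preadditive.add_comp, Preadditive.comp_add, Linear.smul_comp, Linear.comp_smul,
      MonoidalCategory.whiskerLeft_comp, Category.assoc]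
    rw [← reassoc_of% (cupLeft_naturality cup (symmetrizer c (n + 1))),
      ← reassoc_of% (cupLeft_naturality cup (symmetrizer c (n + 1))), key,
      H.cupLeft_comp_slideRight]
    simp

theorem crossHead_t_comp_s (H : HeisenbergRelations c d s t cup cap) (Z : C) :
    crossHead t Z ≫ crossHead s Z = 𝟙 _ - capLeft cap Z ≫ cupLeft cup Z := by
  calc _ = 𝟙 _ ⊗≫ (t ≫ s) ▷ Z ⊗≫ 𝟙 _ := by
        unfold crossHead
        monoidal
    _ = 𝟙 _ ⊗≫ 𝟙 (Q ⊗ P) ▷ Z ⊗≫ 𝟙 _ - 𝟙 _ ⊗≫ (cap ≫ cup) ▷ Z ⊗≫ 𝟙 _ := by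
        have e : (𝟙 (Q ⊗ P) - cap ≫ cup) ▷ Z = 𝟙 (Q ⊗ P) ▷ Z - (cap ≫ cup) ▷ Z := by
          rw [eq_sub_iff_add_eq, ← MonoidalPreadditive.add_whiskerRight, sub_add_cancel]
        rw [H.ts, e]
        simp only [monoidalComp, Preadditive.sub_comp, Preadditive.comp_sub]
    _ = _ := by
        congr 1
        · monoidal
        · unfold capLeft cupLeft
          monoidal

/-- Sliding through `n + 1` symmetrized strands and back, with the inner `n` strands symmetrized. -/
theorem sandwich_slide_succ (H : HeisenbergRelations c d s t cup cap) (n : ℕ) :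
    (Q ◁ symmetrizer c (n + 1)) ≫ slideRight t (n + 1) ≫ slideLeft s (n + 1) ≫
        (Q ◁ symmetrizer c (n + 1)) =
      (Q ◁ symmetrizer c (n + 1)) ≫ crossHead t (tensorPow P n) ≫
        (P ◁ ((Q ◁ symmetrizer c n) ≫ slideRight t n ≫ slideLeft s n ≫ (Q ◁ symmetrizer c n))) ≫
          crossHead s (tensorPow P n) ≫ (Q ◁ symmetrizer c (n + 1)) := by
  have e₁ : (Q ◁ symmetrizer c (n + 1)) ≫ crossHead t (tensorPow P n) =
      (Q ◁ symmetrizer c (n + 1)) ≫ crossHead t (tensorPow P n) ≫ (P ◁ Q ◁ symmetrizer c n) := by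
    rw [crossHead_comp_whiskerLeft, ← MonoidalCategory.whiskerLeft_comp_assoc,
      symmetrizer_comp_whiskerLeft H.symmP]
  have e₂ : crossHead s (tensorPow P n) ≫ (Q ◁ symmetrizer c (n + 1)) =
      (P ◁ Q ◁ symmetrizer c n) ≫ crossHead s (tensorPow P n) ≫ (Q ◁ symmetrizer c (n + 1)) := by
    rw [← reassoc_of% (crossHead_comp_whiskerLeft s (symmetrizer c n)),
      ← MonoidalCategory.whiskerLeft_comp, whiskerLeft_symmetrizer_comp H.symmP]
  have e₃ : slideRight t (n + 1) ≫ slideLeft s (n + 1) = crossHead t (tensorPow P n) ≫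
      (P ◁ (slideRight t n ≫ slideLeft s n)) ≫ crossHead s (tensorPow P n) := by
    rw [slideRight_succ, slideLeft_succ]
    unfold crossHead
    monoidal
  rw [reassoc_of% e₃]
  simp only [MonoidalCategory.whiskerLeft_comp, Category.assoc]
  rw [← e₂, ← reassoc_of% e₁]

theorem whiskerLeft_symmetrizer_zero :
    (Q ◁ symmetrizer c 0) ≫ slideRight t 0 ≫ slideLeft s 0 ≫ (Q ◁ symmetrizer c 0) =
      Q ◁ symmetrizer c 0 := by
  rw [symmetrizer_zero]
  simp [slideRight, slideLeft]

/-- The decomposition of `Q ⊗ e_{n+1}` into the part in which `Q` slides through all upward strands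
and back and the part in which it is capped off and created again. -/
theorem whiskerLeft_symmetrizer_succ (H : HeisenbergRelations c d s t cup cap) (n : ℕ) :
    (Q ◁ symmetrizer c (n + 1)) ≫ slideRight t (n + 1) ≫ slideLeft s (n + 1) ≫
        (Q ◁ symmetrizer c (n + 1)) + ((n : ℂ) + 1) • ((Q ◁ symmetrizer c (n + 1)) ≫
          capLeft cap (tensorPow P n) ≫ cupLeft cup (tensorPow P n) ≫
            (Q ◁ symmetrizer c (n + 1))) = Q ◁ symmetrizer c (n + 1) := by
  have idem : ∀ n : ℕ, (Q ◁ symmetrizer c n) ≫ (Q ◁ symmetrizer c n) = Q ◁ symmetrizer c n := by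
    intro n
    rw [← MonoidalCategory.whiskerLeft_comp, symmetrizer_idem H.symmP]
  have e₁ : ∀ n : ℕ, (Q ◁ symmetrizer c (n + 1)) ≫ crossHead t (tensorPow P n) ≫
      (P ◁ Q ◁ symmetrizer c n) ≫ crossHead s (tensorPow P n) ≫ (Q ◁ symmetrizer c (n + 1)) =
      Q ◁ symmetrizer c (n + 1) - (Q ◁ symmetrizer c (n + 1)) ≫ capLeft cap (tensorPow P n) ≫
        cupLeft cup (tensorPow P n) ≫ (Q ◁ symmetrizer c (n + 1)) := by
    intro n
    rw [reassoc_of% (crossHead_comp_whiskerLeft t (symmetrizer c n)),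
      ← MonoidalCategory.whiskerLeft_comp_assoc, symmetrizer_comp_whiskerLeft H.symmP,
      reassoc_of% (H.crossHead_t_comp_s (tensorPow P n)), Preadditive.sub_comp, Category.id_comp,
      Preadditive.comp_sub, idem, Category.assoc]
  induction n with
  | zero =>
    rw [H.sandwich_slide_succ, whiskerLeft_symmetrizer_zero, e₁]
    simp
  | succ n ih =>
    have e₂ : (Q ◁ symmetrizer c (n + 2)) ≫ crossHead t (tensorPow P (n + 1)) ≫
        (P ◁ Q ◁ symmetrizer c (n + 1)) ≫ (P ◁ capLeft cap (tensorPow P n)) =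
        (Q ◁ symmetrizer c (n + 2)) ≫ capLeft cap (tensorPow P (n + 1)) := by
      rw [reassoc_of% (crossHead_comp_whiskerLeft t (symmetrizer c (n + 1))),
        ← MonoidalCategory.whiskerLeft_comp_assoc, symmetrizer_comp_whiskerLeft H.symmP,
        H.whiskerLeft_capLeft, ← MonoidalCategory.whiskerLeft_comp_assoc,
        symmetrizer_comp_crossHead H.symmP]
    have e₃ : (P ◁ cupLeft cup (tensorPow P n)) ≫ (P ◁ Q ◁ symmetrizer c (n + 1)) ≫
        crossHead s (tensorPow P (n + 1)) ≫ (Q ◁ symmetrizer c (n + 2)) =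
        cupLeft cup (tensorPow P (n + 1)) ≫ (Q ◁ symmetrizer c (n + 2)) := by
      rw [← reassoc_of% (crossHead_comp_whiskerLeft s (symmetrizer c (n + 1))),
        ← MonoidalCategory.whiskerLeft_comp, whiskerLeft_symmetrizer_comp H.symmP,
        reassoc_of% (H.whiskerLeft_cupLeft (tensorPow P n)), ← MonoidalCategory.whiskerLeft_comp,
        crossHead_comp_symmetrizer H.symmP]
    have e₄ := eq_sub_of_add_eq ih
    have e₅ : P ◁ (Q ◁ symmetrizer c (n + 1) - ((n : ℂ) + 1) • ((Q ◁ symmetrizer c (n + 1)) ≫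
        capLeft cap (tensorPow P n) ≫ cupLeft cup (tensorPow P n) ≫
          (Q ◁ symmetrizer c (n + 1)))) = P ◁ Q ◁ symmetrizer c (n + 1) -
        ((n : ℂ) + 1) • ((P ◁ Q ◁ symmetrizer c (n + 1)) ≫ (P ◁ capLeft cap (tensorPow P n)) ≫
          (P ◁ cupLeft cup (tensorPow P n)) ≫ (P ◁ Q ◁ symmetrizer c (n + 1))) := by
      rw [eq_sub_iff_add_eq]
      simp only [← MonoidalCategory.whiskerLeft_comp, ← MonoidalLinear.whiskerLeft_smul,
        ← MonoidalPreadditive.whiskerLeft_add, sub_add_cancel]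
    rw [H.sandwich_slide_succ, e₄, e₅, Preadditive.sub_comp, Preadditive.comp_sub,
      Preadditive.comp_sub, e₁]
    simp only [Linear.smul_comp, Linear.comp_smul, Category.assoc]
    rw [e₃, reassoc_of% e₂]
    push_cast
    module

end HeisenbergRelations

end Commutation

/-! ### Adding a downward strand to a diagram -/

section AddStrand

variable {C : Type*} [Category C] [MonoidalCategory C] {P Q : C}

/-- A new strand `Q` at the upper left of `W`, joined by a cup to the first strand at the bottom
of `W`. -/
def cupPart (cup : 𝟙_ C ⟶ Q ⊗ P) {A R N S : C} (W : (P ⊗ A) ⊗ R ⟶ N ⊗ S) :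
    A ⊗ R ⟶ (Q ⊗ N) ⊗ S :=
  (cupLeft cup A ▷ R) ≫ (α_ Q (P ⊗ A) R).hom ≫ (Q ◁ W) ≫ (α_ Q N S).inv

/-- A new strand `Q` at the upper left of `W`, coming up through the `a` upward strands below `W`
from their right. -/
def slidePart (s : P ⊗ Q ⟶ Q ⊗ P) {a : ℕ} {R N S : C} (W : tensorPow P a ⊗ R ⟶ N ⊗ S) :
    tensorPow P a ⊗ (Q ⊗ R) ⟶ (Q ⊗ N) ⊗ S :=
  (α_ (tensorPow P a) Q R).inv ≫ (slideLeft s a ▷ R) ≫ (α_ Q (tensorPow P a) R).hom ≫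
    (Q ◁ W) ≫ (α_ Q N S).inv

/-- A new strand `Q` at the lower left of `W`, joined by a cap to the first strand at the top
of `W`. -/
def capPart (cap : Q ⊗ P ⟶ 𝟙_ C) {A R N S : C} (W : N ⊗ S ⟶ (P ⊗ A) ⊗ R) :
    (Q ⊗ N) ⊗ S ⟶ A ⊗ R :=
  (α_ Q N S).hom ≫ (Q ◁ W) ≫ (α_ Q (P ⊗ A) R).inv ≫ (capLeft cap A ▷ R)

/-- A new strand `Q` at the lower left of `W`, continuing upwards through the `a` upward strands
above `W` to their right. -/
def slideBackPart (t : Q ⊗ P ⟶ P ⊗ Q) {a : ℕ} {R N S : C} (W : N ⊗ S ⟶ tensorPow P a ⊗ R) :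
    (Q ⊗ N) ⊗ S ⟶ tensorPow P a ⊗ (Q ⊗ R) :=
  (α_ Q N S).hom ≫ (Q ◁ W) ≫ (α_ Q (tensorPow P a) R).inv ≫ (slideRight t a ▷ R) ≫
    (α_ (tensorPow P a) Q R).hom

section Naturality

variable (cup : 𝟙_ C ⟶ Q ⊗ P) (s : P ⊗ Q ⟶ Q ⊗ P) {a : ℕ} {A R R' N N' S : C}

theorem cupPart_comp (W : (P ⊗ A) ⊗ R ⟶ N ⊗ S) (k : N ⟶ N') :
    cupPart cup W ≫ ((Q ◁ k) ▷ S) = cupPart cup (W ≫ (k ▷ S)) := by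
  unfold cupPart
  monoidal

theorem slidePart_comp (W : tensorPow P a ⊗ R ⟶ N ⊗ S) (k : N ⟶ N') :
    slidePart s W ≫ ((Q ◁ k) ▷ S) = slidePart s (W ≫ (k ▷ S)) := by
  unfold slidePart
  monoidal

theorem comp_cupPart (W : (P ⊗ A) ⊗ R' ⟶ N ⊗ S) (k : R ⟶ R') :
    cupPart cup (((P ⊗ A) ◁ k) ≫ W) = (A ◁ k) ≫ cupPart cup W := by
  calc _ = 𝟙 _ ⊗≫ (cupLeft cup A ▷ R ≫ (Q ⊗ (P ⊗ A)) ◁ k) ⊗≫ Q ◁ W ⊗≫ 𝟙 _ := by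
        unfold cupPart
        monoidal
    _ = _ := by
        rw [← whisker_exchange]
        unfold cupPart
        monoidal

theorem comp_slidePart (W : tensorPow P a ⊗ R' ⟶ N ⊗ S) (k : R ⟶ R') :
    slidePart s ((tensorPow P a ◁ k) ≫ W) = (tensorPow P a ◁ (Q ◁ k)) ≫ slidePart s W := by
  calc _ = 𝟙 _ ⊗≫ (slideLeft s a ▷ R ≫ (Q ⊗ tensorPow P a) ◁ k) ⊗≫ Q ◁ W ⊗≫ 𝟙 _ := by
        unfold slidePart
        monoidal
    _ = _ := by
        rw [← whisker_exchange]
        unfold slidePart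
        monoidal

end Naturality

variable [Preadditive C] [Linear ℂ C] [MonoidalPreadditive C] [MonoidalLinear ℂ C]

section Linearity

variable (cup : 𝟙_ C ⟶ Q ⊗ P) (s : P ⊗ Q ⟶ Q ⊗ P) (cap : Q ⊗ P ⟶ 𝟙_ C) (t : Q ⊗ P ⟶ P ⊗ Q)
  {a : ℕ} {A R N S : C}

theorem cupPart_add (W W' : (P ⊗ A) ⊗ R ⟶ N ⊗ S) :
    cupPart cup (W + W') = cupPart cup W + cupPart cup W' := by
  simp only [cupPart, MonoidalPreadditive.whiskerLeft_add, Preadditive.add_comp,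
    Preadditive.comp_add]

theorem slidePart_add (W W' : tensorPow P a ⊗ R ⟶ N ⊗ S) :
    slidePart s (W + W') = slidePart s W + slidePart s W' := by
  simp only [slidePart, MonoidalPreadditive.whiskerLeft_add, Preadditive.add_comp,
    Preadditive.comp_add]

theorem cupPart_smul (r : ℂ) (W : (P ⊗ A) ⊗ R ⟶ N ⊗ S) :
    cupPart cup (r • W) = r • cupPart cup W := by
  simp only [cupPart, MonoidalLinear.whiskerLeft_smul, Linear.smul_comp, Linear.comp_smul]

theorem slidePart_smul (r : ℂ) (W : tensorPow P a ⊗ R ⟶ N ⊗ S) :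
    slidePart s (r • W) = r • slidePart s W := by
  simp only [slidePart, MonoidalLinear.whiskerLeft_smul, Linear.smul_comp, Linear.comp_smul]

theorem cupPart_zero : cupPart cup (0 : (P ⊗ A) ⊗ R ⟶ N ⊗ S) = 0 := by
  simp [cupPart]

theorem slidePart_zero : slidePart s (0 : tensorPow P a ⊗ R ⟶ N ⊗ S) = 0 := by
  simp [slidePart]

theorem capPart_zero : capPart cap (0 : N ⊗ S ⟶ (P ⊗ A) ⊗ R) = 0 := by
  simp [capPart]

theorem slideBackPart_zero : slideBackPart t (0 : N ⊗ S ⟶ tensorPow P a ⊗ R) = 0 := by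
  simp [slideBackPart]

end Linearity

namespace HeisenbergRelations

variable {c : P ⊗ P ⟶ P ⊗ P} {d : Q ⊗ Q ⟶ Q ⊗ Q} {s : P ⊗ Q ⟶ Q ⊗ P} {t : Q ⊗ P ⟶ P ⊗ Q}
  {cup : 𝟙_ C ⟶ Q ⊗ P} {cap : Q ⊗ P ⟶ 𝟙_ C}

theorem whiskerLeft_cupLeft_Q (H : HeisenbergRelations c d s t cup cap) (Z : C) :
    (Q ◁ cupLeft cup Z) ≫ crossHead d (P ⊗ Z) = cupLeft cup (Q ⊗ Z) ≫ (Q ◁ crossHead s Z) := by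
  have h := H.cup_Q
  calc _ = 𝟙 _ ⊗≫ ((ρ_ Q).inv ≫ (Q ◁ cup) ≫ (α_ Q Q P).inv ≫ (d ▷ P) ≫ (α_ Q Q P).hom) ▷ Z ⊗≫
        𝟙 _ := by
        unfold cupLeft crossHead
        monoidal
    _ = _ := by
        rw [h]
        unfold cupLeft crossHead
        monoidal

theorem cupLeft_cupLeft_crossHead (H : HeisenbergRelations c d s t cup cap) (Z : C) :
    cupLeft cup Z ≫ (Q ◁ cupLeft cup (P ⊗ Z)) ≫ crossHead d (P ⊗ (P ⊗ Z)) =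
      cupLeft cup Z ≫ (Q ◁ cupLeft cup (P ⊗ Z)) ≫ (Q ◁ Q ◁ crossHead c Z) := by
  rw [H.whiskerLeft_cupLeft_Q, reassoc_of% (cupLeft_naturality cup (cupLeft cup Z)),
    ← MonoidalCategory.whiskerLeft_comp, H.whiskerLeft_cupLeft,
    MonoidalCategory.whiskerLeft_comp]

theorem slideLeft_cupLeft_crossHead (H : HeisenbergRelations c d s t cup cap) (a : ℕ) :
    slideLeft s a ≫ (Q ◁ cupLeft cup (tensorPow P a)) ≫ crossHead d (P ⊗ tensorPow P a) =
      (cupLeft cup (tensorPow P a) ▷ Q) ≫ (α_ Q (P ⊗ tensorPow P a) Q).hom ≫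
        (Q ◁ slideLeft s (a + 1)) := by
  rw [H.whiskerLeft_cupLeft_Q, reassoc_of% (cupLeft_naturality cup (slideLeft s a)),
    slideLeft_succ]
  unfold cupLeft crossHead
  monoidal

theorem cupPart_cupPart (H : HeisenbergRelations c d s t cup cap) {A R N S : C}
    (W : (P ⊗ (P ⊗ A)) ⊗ R ⟶ N ⊗ S) :
    cupPart cup (cupPart cup W) ≫ (crossHead d N ▷ S) =
      cupPart cup (cupPart cup ((crossHead c A ▷ R) ≫ W)) := by
  calc _ = 𝟙 _ ⊗≫ (cupLeft cup A ≫ (Q ◁ cupLeft cup (P ⊗ A))) ▷ R ⊗≫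
        ((Q ⊗ Q) ◁ W ≫ d ▷ (N ⊗ S)) ⊗≫ 𝟙 _ := by
        unfold cupPart crossHead
        monoidal
    _ = 𝟙 _ ⊗≫ (cupLeft cup A ≫ (Q ◁ cupLeft cup (P ⊗ A)) ≫
        crossHead d (P ⊗ (P ⊗ A))) ▷ R ⊗≫ (Q ⊗ Q) ◁ W ⊗≫ 𝟙 _ := by
        rw [whisker_exchange]
        unfold crossHead
        monoidal
    _ = _ := by
        rw [H.cupLeft_cupLeft_crossHead]
        unfold cupPart
        monoidal

theorem slidePart_cupPart (H : HeisenbergRelations c d s t cup cap) {a : ℕ} {R N S : C}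
    (W : tensorPow P (a + 1) ⊗ R ⟶ N ⊗ S) :
    slidePart s (cupPart cup W) ≫ (crossHead d N ▷ S) = cupPart cup (slidePart s W) := by
  calc _ = 𝟙 _ ⊗≫ (slideLeft s a ≫ (Q ◁ cupLeft cup (tensorPow P a))) ▷ R ⊗≫
        ((Q ⊗ Q) ◁ W ≫ d ▷ (N ⊗ S)) ⊗≫ 𝟙 _ := by
        unfold cupPart slidePart crossHead
        monoidal
    _ = 𝟙 _ ⊗≫ (slideLeft s a ≫ (Q ◁ cupLeft cup (tensorPow P a)) ≫
        crossHead d (P ⊗ tensorPow P a)) ▷ R ⊗≫ (Q ⊗ Q) ◁ W ⊗≫ 𝟙 _ := by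
        rw [whisker_exchange]
        unfold crossHead
        monoidal
    _ = _ := by
        rw [H.slideLeft_cupLeft_crossHead]
        unfold cupPart slidePart
        monoidal

theorem crossHead_Q_sq (H : HeisenbergRelations c d s t cup cap) (Z : C) :
    crossHead d Z ≫ crossHead d Z = 𝟙 _ := by
  calc _ = 𝟙 _ ⊗≫ (d ≫ d) ▷ Z ⊗≫ 𝟙 _ := by
        unfold crossHead
        monoidal
    _ = _ := by
        rw [H.sq]
        monoidal

theorem cupPart_slidePart (H : HeisenbergRelations c d s t cup cap) {a : ℕ} {R N S : C}
    (W : tensorPow P (a + 1) ⊗ R ⟶ N ⊗ S) :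
    cupPart cup (slidePart s W) ≫ (crossHead d N ▷ S) = slidePart s (cupPart cup W) := by
  rw [← H.slidePart_cupPart, Category.assoc, ← comp_whiskerRight, H.crossHead_Q_sq,
    id_whiskerRight, Category.comp_id]

theorem slidePart_slidePart (H : HeisenbergRelations c d s t cup cap) {a : ℕ} {R N S : C}
    (W : tensorPow P a ⊗ R ⟶ N ⊗ S) :
    slidePart s (slidePart s W) ≫ (crossHead d N ▷ S) =
      (tensorPow P a ◁ crossHead d R) ≫ slidePart s (slidePart s W) := by
  have h := H.braid_PQQ.slideLeft a
  unfold YangBaxter at h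
  calc _ = 𝟙 _ ⊗≫ (slideLeft s a ▷ Q) ▷ R ⊗≫ (Q ◁ slideLeft s a) ▷ R ⊗≫
        ((Q ⊗ Q) ◁ W ≫ d ▷ (N ⊗ S)) ⊗≫ 𝟙 _ := by
        unfold slidePart crossHead
        monoidal
    _ = 𝟙 _ ⊗≫ ((α_ (tensorPow P a) Q Q).inv ≫ (slideLeft s a ▷ Q) ≫ (α_ Q (tensorPow P a) Q).hom ≫
        (Q ◁ slideLeft s a) ≫ (α_ Q Q (tensorPow P a)).inv ≫ (d ▷ tensorPow P a)) ▷ R ⊗≫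
          (Q ⊗ Q) ◁ W ⊗≫ 𝟙 _ := by
        rw [whisker_exchange]
        monoidal
    _ = _ := by
        rw [h]
        unfold slidePart crossHead
        monoidal

end HeisenbergRelations

end AddStrand

/-! ### Normally ordered diagrams -/

section NormalOrdering

variable {C : Type*} [Category C] [MonoidalCategory C]
  [Preadditive C] [Linear ℂ C] [MonoidalPreadditive C] [MonoidalLinear ℂ C] {P Q : C}

/-- The sum, over the choices of `r` of the `n` downward strands at the top, of the diagrams in
which these `r` strands come from the bottom, to the right of the upward strands, and the other
`n - r` are joined by cups to upward strands; the `b` upward strands are symmetrized.  The recursion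
peels off the leftmost downward strand.  It is zero unless `n + a = r + b`. -/
def normalOut (c : P ⊗ P ⟶ P ⊗ P) (s : P ⊗ Q ⟶ Q ⊗ P) (cup : 𝟙_ C ⟶ Q ⊗ P) :
    ∀ n r a b : ℕ, (tensorPow P a ⊗ tensorPow Q r ⟶ tensorPow Q n ⊗ tensorPow P b)
  | 0, 0, a, b => if h : a = b then
      (ρ_ (tensorPow P a)).hom ≫ symmetrizer c a ≫ eqToHom (congrArg (tensorPow P) h) ≫
        (λ_ (tensorPow P b)).inv else 0
  | 0, _ + 1, _, _ => 0
  | n + 1, 0, a, b => cupPart cup (normalOut c s cup n 0 (a + 1) b)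
  | n + 1, r + 1, a, b => cupPart cup (normalOut c s cup n (r + 1) (a + 1) b) +
      slidePart s (normalOut c s cup n r a b)

/-- The counterpart of `normalOut` in the opposite direction, with caps in place of cups and with
the remaining upward strands symmetrized at every step.  The coefficient `a + 1` of a cap is the
number of upward strands that it may be attached to. -/
def normalIn (c : P ⊗ P ⟶ P ⊗ P) (t : Q ⊗ P ⟶ P ⊗ Q) (cap : Q ⊗ P ⟶ 𝟙_ C) :
    ∀ n r a b : ℕ, (tensorPow Q n ⊗ tensorPow P b ⟶ tensorPow P a ⊗ tensorPow Q r)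
  | 0, 0, a, b => if h : a = b then
      (λ_ (tensorPow P b)).hom ≫ eqToHom (congrArg (tensorPow P) h.symm) ≫ symmetrizer c a ≫
        (ρ_ (tensorPow P a)).inv else 0
  | 0, _ + 1, _, _ => 0
  | n + 1, 0, a, b => ((a : ℂ) + 1) • (capPart cap (normalIn c t cap n 0 (a + 1) b) ≫
      (symmetrizer c a ▷ tensorPow Q 0))
  | n + 1, r + 1, a, b => ((a : ℂ) + 1) • (capPart cap (normalIn c t cap n (r + 1) (a + 1) b) ≫
      (symmetrizer c a ▷ tensorPow Q (r + 1))) +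
        slideBackPart t (normalIn c t cap n r a b) ≫ (symmetrizer c a ▷ tensorPow Q (r + 1))

section Parts

variable {cup : 𝟙_ C ⟶ Q ⊗ P} {s : P ⊗ Q ⟶ Q ⊗ P} {cap : Q ⊗ P ⟶ 𝟙_ C} {t : Q ⊗ P ⟶ P ⊗ Q}
  {c : P ⊗ P ⟶ P ⊗ P}

theorem whiskerRight_comp_cupPart {A R N S : C} (W : (P ⊗ A) ⊗ R ⟶ N ⊗ S) (f : A ⟶ A) :
    (f ▷ R) ≫ cupPart cup W = cupPart cup (((P ◁ f) ▷ R) ≫ W) := by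
  calc _ = 𝟙 _ ⊗≫ (f ≫ cupLeft cup A) ▷ R ⊗≫ Q ◁ W ⊗≫ 𝟙 _ := by
        unfold cupPart
        monoidal
    _ = _ := by
        rw [cupLeft_naturality]
        unfold cupPart
        monoidal

theorem whiskerRight_comp_slidePart (h : YangBaxter c s s) {a : ℕ} {R N S : C}
    (W : tensorPow P a ⊗ R ⟶ N ⊗ S) {f : tensorPow P a ⟶ tensorPow P a} {r : ℂ}
    (hf : SwapGen c a f r) :
    (f ▷ (Q ⊗ R)) ≫ slidePart s W = slidePart s ((f ▷ R) ≫ W) := by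
  calc _ = 𝟙 _ ⊗≫ (f ▷ Q ≫ slideLeft s a) ▷ R ⊗≫ Q ◁ W ⊗≫ 𝟙 _ := by
        unfold slidePart
        monoidal
    _ = _ := by
        rw [hf.whiskerRight_comp_slideLeft h]
        unfold slidePart
        monoidal

theorem cupPart_comp_capPart {A A' R R' N S : C} (U : (P ⊗ A) ⊗ R ⟶ N ⊗ S)
    (V : N ⊗ S ⟶ (P ⊗ A') ⊗ R') : cupPart cup U ≫ capPart cap V =
      (cupLeft cup A ▷ R) ≫ (α_ Q (P ⊗ A) R).hom ≫ (Q ◁ (U ≫ V)) ≫ (α_ Q (P ⊗ A') R').inv ≫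
        (capLeft cap A' ▷ R') := by
  unfold cupPart capPart
  monoidal

theorem cupPart_comp_slideBackPart {A R R' N S : C} {a' : ℕ} (U : (P ⊗ A) ⊗ R ⟶ N ⊗ S)
    (V : N ⊗ S ⟶ tensorPow P a' ⊗ R') : cupPart cup U ≫ slideBackPart t V =
      (cupLeft cup A ▷ R) ≫ (α_ Q (P ⊗ A) R).hom ≫ (Q ◁ (U ≫ V)) ≫
        (α_ Q (tensorPow P a') R').inv ≫ (slideRight t a' ▷ R') ≫
          (α_ (tensorPow P a') Q R').hom := by
  unfold cupPart slideBackPart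
  monoidal

theorem slidePart_comp_capPart {A' R R' N S : C} {a : ℕ} (U : tensorPow P a ⊗ R ⟶ N ⊗ S)
    (V : N ⊗ S ⟶ (P ⊗ A') ⊗ R') : slidePart s U ≫ capPart cap V =
      (α_ (tensorPow P a) Q R).inv ≫ (slideLeft s a ▷ R) ≫ (α_ Q (tensorPow P a) R).hom ≫
        (Q ◁ (U ≫ V)) ≫ (α_ Q (P ⊗ A') R').inv ≫ (capLeft cap A' ▷ R') := by
  unfold slidePart capPart
  monoidal

theorem slidePart_comp_slideBackPart {R R' N S : C} {a a' : ℕ} (U : tensorPow P a ⊗ R ⟶ N ⊗ S)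
    (V : N ⊗ S ⟶ tensorPow P a' ⊗ R') : slidePart s U ≫ slideBackPart t V =
      (α_ (tensorPow P a) Q R).inv ≫ (slideLeft s a ▷ R) ≫ (α_ Q (tensorPow P a) R).hom ≫
        (Q ◁ (U ≫ V)) ≫ (α_ Q (tensorPow P a') R').inv ≫ (slideRight t a' ▷ R') ≫
          (α_ (tensorPow P a') Q R').hom := by
  unfold slidePart slideBackPart
  monoidal

end Parts

namespace HeisenbergRelations

variable {c : P ⊗ P ⟶ P ⊗ P} {d : Q ⊗ Q ⟶ Q ⊗ Q} {s : P ⊗ Q ⟶ Q ⊗ P} {t : Q ⊗ P ⟶ P ⊗ Q}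
  {cup : 𝟙_ C ⟶ Q ⊗ P} {cap : Q ⊗ P ⟶ 𝟙_ C}

theorem comp_normalOut (H : HeisenbergRelations c d s t cup cap) : ∀ (n r a b : ℕ)
    {f : tensorPow P a ⟶ tensorPow P a} {x : ℂ}, SwapGen c a f x →
    (f ▷ tensorPow Q r) ≫ normalOut c s cup n r a b = x • normalOut c s cup n r a b
  | 0, 0, a, b, f, x, hf => by
    unfold normalOut
    split_ifs with h
    · calc _ = (ρ_ _).hom ≫ (f ≫ symmetrizer c a) ≫ eqToHom (congrArg (tensorPow P) h) ≫
            (λ_ (tensorPow P b)).inv := by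
            simp
        _ = _ := by
            rw [hf.comp_symmetrizer H.symmP]
            simp only [Linear.smul_comp, Linear.comp_smul]
    · simp
  | 0, r + 1, a, b, f, x, hf => by simp [normalOut]
  | n + 1, 0, a, b, f, x, hf => by
    unfold normalOut
    rw [whiskerRight_comp_cupPart, comp_normalOut H n 0 (a + 1) b hf.whisker, cupPart_smul]
  | n + 1, r + 1, a, b, f, x, hf => by
    unfold normalOut
    rw [Preadditive.comp_add, whiskerRight_comp_cupPart,
      comp_normalOut H n (r + 1) (a + 1) b hf.whisker, cupPart_smul]
    erw [whiskerRight_comp_slidePart H.braid_PPQ _ hf]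
    rw [comp_normalOut H n r a b hf, slidePart_smul, smul_add]

theorem symmetrizer_comp_normalOut (H : HeisenbergRelations c d s t cup cap) (n r a b : ℕ) :
    (symmetrizer c a ▷ tensorPow Q r) ≫ normalOut c s cup n r a b = normalOut c s cup n r a b := by
  rw [H.comp_normalOut n r a b (swapGen_symmetrizer a), one_smul]

theorem normalIn_comp_symmetrizer (H : HeisenbergRelations c d s t cup cap) : ∀ n r a b : ℕ,
    normalIn c t cap n r a b ≫ (symmetrizer c a ▷ tensorPow Q r) = normalIn c t cap n r a b
  | 0, 0, a, b => by
    unfold normalIn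
    split_ifs with h
    · calc _ = (λ_ (tensorPow P b)).hom ≫ eqToHom (congrArg (tensorPow P) h.symm) ≫
            (symmetrizer c a ≫ symmetrizer c a) ≫ (ρ_ (tensorPow P a)).inv := by
            simp
        _ = _ := by rw [symmetrizer_idem H.symmP]
    · simp
  | 0, r + 1, a, b => by simp [normalIn]
  | n + 1, 0, a, b => by
    unfold normalIn
    rw [Linear.smul_comp, Category.assoc, ← comp_whiskerRight, symmetrizer_idem H.symmP]
  | n + 1, r + 1, a, b => by
    unfold normalIn
    rw [Preadditive.add_comp, Linear.smul_comp, Category.assoc, Category.assoc,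
      ← comp_whiskerRight, symmetrizer_idem H.symmP]

theorem normalIn_eq_zero (c : P ⊗ P ⟶ P ⊗ P) (t : Q ⊗ P ⟶ P ⊗ Q) (cap : Q ⊗ P ⟶ 𝟙_ C) :
    ∀ n r a b : ℕ, n < r ∨ b < a → normalIn c t cap n r a b = 0
  | 0, 0, a, b, h => by
    unfold normalIn
    rw [dif_neg (by omega)]
  | 0, r + 1, a, b, h => rfl
  | n + 1, 0, a, b, h => by
    unfold normalIn
    rw [normalIn_eq_zero c t cap n 0 (a + 1) b (by omega), capPart_zero, Limits.zero_comp,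
      smul_zero]
  | n + 1, r + 1, a, b, h => by
    unfold normalIn
    rw [normalIn_eq_zero c t cap n (r + 1) (a + 1) b (by omega),
      normalIn_eq_zero c t cap n r a b (by omega), capPart_zero, slideBackPart_zero,
      Limits.zero_comp, smul_zero, add_zero]

theorem normalOut_zero_of_ne (c : P ⊗ P ⟶ P ⊗ P) (s : P ⊗ Q ⟶ Q ⊗ P) (cup : 𝟙_ C ⟶ Q ⊗ P)
    {a b : ℕ} (r : ℕ) (h : a ≠ b) : normalOut c s cup 0 r a b = 0 := by
  cases r with
  | zero =>
    unfold normalOut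
    rw [dif_neg h]
  | succ r => rfl

/-- Inserting a strand `Q` that starts with a cup at all positions produces every diagram of
`normalOut c s cup (n + 1) r a b` once for each of its cups, whose number is `b - a`. -/
theorem cupPart_comp_insertSum (H : HeisenbergRelations c d s t cup cap) : ∀ n r a b : ℕ,
    cupPart cup (normalOut c s cup n r (a + 1) b) ≫ (insertSum d n ▷ tensorPow P b) =
      ((b : ℂ) - a) • normalOut c s cup (n + 1) r a b
  | 0, r, a, b => by
    have h₁ : ((b : ℂ) - a) • cupPart cup (normalOut c s cup 0 r (a + 1) b) =
        cupPart cup (normalOut c s cup 0 r (a + 1) b) := by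
      by_cases h : a + 1 = b
      · subst h
        push_cast
        rw [add_sub_cancel_left, one_smul]
      · rw [normalOut_zero_of_ne _ _ _ _ h, cupPart_zero, smul_zero]
    have h₂ : ∀ r, ((b : ℂ) - a) • slidePart s (normalOut c s cup 0 r a b) = 0 := by
      intro r
      by_cases h : a = b
      · rw [h, sub_self, zero_smul]
      · rw [normalOut_zero_of_ne _ _ _ _ h, slidePart_zero, smul_zero]
    change _ ≫ (𝟙 _ ▷ _) = _
    rw [id_whiskerRight, Category.comp_id]
    cases r with
    | zero => exact h₁.symm
    | succ r =>
      conv_rhs => unfold normalOut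
      rw [smul_add, h₁, h₂, add_zero]
  | n + 1, r, a, b => by
    have e₁ : cupPart cup (cupPart cup (normalOut c s cup n r (a + 2) b)) ≫
        (crossHead d (tensorPow Q n) ▷ tensorPow P b) ≫ ((Q ◁ insertSum d n) ▷ tensorPow P b) =
        ((b : ℂ) - (a + 1)) • cupPart cup (normalOut c s cup (n + 1) r (a + 1) b) := by
      rw [← Category.assoc, H.cupPart_cupPart, H.comp_normalOut n r (a + 2) b (SwapGen.head a),
        one_smul, cupPart_comp, cupPart_comp_insertSum H n r (a + 1) b, cupPart_smul]
      push_cast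
      rfl
    rw [insertSum_succ, MonoidalPreadditive.add_whiskerRight, comp_whiskerRight, id_whiskerRight,
      Preadditive.comp_add, Category.comp_id]
    cases r with
    | zero =>
      have e : normalOut c s cup (n + 2) 0 a b =
        cupPart cup (normalOut c s cup (n + 1) 0 (a + 1) b) := rfl
      have e' : normalOut c s cup (n + 1) 0 (a + 1) b =
        cupPart cup (normalOut c s cup n 0 (a + 2) b) := rfl
      rw [e]
      conv_lhs => rw [e']
      rw [e₁, ← e']
      module
    | succ r =>
      have e : normalOut c s cup (n + 2) (r + 1) a b =
        cupPart cup (normalOut c s cup (n + 1) (r + 1) (a + 1) b) +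
          slidePart s (normalOut c s cup (n + 1) r a b) := rfl
      have e' : normalOut c s cup (n + 1) (r + 1) (a + 1) b =
        cupPart cup (normalOut c s cup n (r + 1) (a + 2) b) +
          slidePart s (normalOut c s cup n r (a + 1) b) := rfl
      have e₂ : cupPart cup (slidePart s (normalOut c s cup n r (a + 1) b)) ≫
          (crossHead d (tensorPow Q n) ▷ tensorPow P b) ≫ ((Q ◁ insertSum d n) ▷ tensorPow P b) =
          ((b : ℂ) - a) • slidePart s (normalOut c s cup (n + 1) r a b) := by
        rw [← Category.assoc, H.cupPart_slidePart, slidePart_comp,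
          cupPart_comp_insertSum H n r a b, slidePart_smul]
      have e₃ : cupPart cup (normalOut c s cup (n + 1) (r + 1) (a + 1) b) =
          cupPart cup (cupPart cup (normalOut c s cup n (r + 1) (a + 2) b)) +
            cupPart cup (slidePart s (normalOut c s cup n r (a + 1) b)) := by
        rw [e', cupPart_add]
      have e₄ : cupPart cup (normalOut c s cup (n + 1) (r + 1) (a + 1) b) ≫
          (crossHead d (tensorPow Q n) ▷ tensorPow P b) ≫ ((Q ◁ insertSum d n) ▷ tensorPow P b) =
          ((b : ℂ) - (a + 1)) • cupPart cup (normalOut c s cup (n + 1) (r + 1) (a + 1) b) +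
            ((b : ℂ) - a) • slidePart s (normalOut c s cup (n + 1) r a b) := by
        rw [← e₁, ← e₂, ← Preadditive.add_comp, ← e₃]
      rw [e, e₄]
      module

/-- Inserting a strand `Q` that comes from the bottom at all positions amounts to inserting it at
all positions at the bottom, among the strands that come from there, and then choosing which
strands these are. -/
theorem slidePart_comp_insertSum (H : HeisenbergRelations c d s t cup cap) : ∀ n r a b : ℕ,
    slidePart s (normalOut c s cup n r a b) ≫ (insertSum d n ▷ tensorPow P b) =
      (tensorPow P a ◁ insertSum d r) ≫ normalOut c s cup (n + 1) (r + 1) a b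
  | 0, r, a, b => by
    have e : normalOut c s cup 1 (r + 1) a b = slidePart s (normalOut c s cup 0 r a b) :=
      (congrArg (· + slidePart s (normalOut c s cup 0 r a b)) (cupPart_zero cup)).trans
        (zero_add _)
    change _ ≫ (𝟙 _ ▷ _) = _
    rw [id_whiskerRight, Category.comp_id, e]
    cases r with
    | zero =>
      change _ = (_ ◁ 𝟙 _) ≫ _
      rw [MonoidalCategory.whiskerLeft_id, Category.id_comp]
    | succ r =>
      have e' : normalOut c s cup 0 (r + 1) a b = 0 := rfl
      rw [e', slidePart_zero, Limits.comp_zero]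
  | n + 1, r, a, b => by
    rw [insertSum_succ d n, MonoidalPreadditive.add_whiskerRight, comp_whiskerRight,
      id_whiskerRight, Preadditive.comp_add, Category.comp_id]
    have e : normalOut c s cup (n + 2) (r + 1) a b =
        cupPart cup (normalOut c s cup (n + 1) (r + 1) (a + 1) b) +
          slidePart s (normalOut c s cup (n + 1) r a b) := rfl
    have e₁ : slidePart s (cupPart cup (normalOut c s cup n r (a + 1) b)) ≫
        (crossHead d (tensorPow Q n) ▷ tensorPow P b) ≫ ((Q ◁ insertSum d n) ▷ tensorPow P b) =
        (tensorPow P a ◁ insertSum d r) ≫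
          cupPart cup (normalOut c s cup (n + 1) (r + 1) (a + 1) b) := by
      rw [← Category.assoc, H.slidePart_cupPart, cupPart_comp,
        slidePart_comp_insertSum H n r (a + 1) b, comp_cupPart]
    cases r with
    | zero =>
      have e' : normalOut c s cup (n + 1) 0 a b =
        cupPart cup (normalOut c s cup n 0 (a + 1) b) := rfl
      have e₂ : insertSum d 0 = 𝟙 _ := rfl
      rw [← e', e₂, MonoidalCategory.whiskerLeft_id, Category.id_comp] at e₁
      rw [e, e₂, MonoidalCategory.whiskerLeft_id, Category.id_comp, e₁]
      exact add_comm _ _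
    | succ r =>
      have e' : normalOut c s cup (n + 1) (r + 1) a b =
        cupPart cup (normalOut c s cup n (r + 1) (a + 1) b) +
          slidePart s (normalOut c s cup n r a b) := rfl
      have e₂ : slidePart s (slidePart s (normalOut c s cup n r a b)) ≫
          (crossHead d (tensorPow Q n) ▷ tensorPow P b) ≫ ((Q ◁ insertSum d n) ▷ tensorPow P b) =
          (tensorPow P a ◁ (crossHead d (tensorPow Q r) ≫ (Q ◁ insertSum d r))) ≫
            slidePart s (normalOut c s cup (n + 1) (r + 1) a b) := by
        rw [← Category.assoc, H.slidePart_slidePart, Category.assoc, slidePart_comp,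
          slidePart_comp_insertSum H n r a b, comp_slidePart,
          MonoidalCategory.whiskerLeft_comp, Category.assoc]
      have e₃ : slidePart s (normalOut c s cup (n + 1) (r + 1) a b) =
          slidePart s (cupPart cup (normalOut c s cup n (r + 1) (a + 1) b)) +
            slidePart s (slidePart s (normalOut c s cup n r a b)) := by
        rw [e', slidePart_add]
      have e₄ : slidePart s (normalOut c s cup (n + 1) (r + 1) a b) ≫
          (crossHead d (tensorPow Q n) ▷ tensorPow P b) ≫ ((Q ◁ insertSum d n) ▷ tensorPow P b) =
          (tensorPow P a ◁ insertSum d (r + 1)) ≫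
            cupPart cup (normalOut c s cup (n + 1) (r + 2) (a + 1) b) +
          (tensorPow P a ◁ (crossHead d (tensorPow Q r) ≫ (Q ◁ insertSum d r))) ≫
            slidePart s (normalOut c s cup (n + 1) (r + 1) a b) := by
        rw [← e₁, ← e₂, ← Preadditive.add_comp, ← e₃]
      have e₅ : slidePart s (normalOut c s cup (n + 1) (r + 1) a b) +
          (tensorPow P a ◁ (crossHead d (tensorPow Q r) ≫ (Q ◁ insertSum d r))) ≫
            slidePart s (normalOut c s cup (n + 1) (r + 1) a b) =
          (tensorPow P a ◁ insertSum d (r + 1)) ≫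
            slidePart s (normalOut c s cup (n + 1) (r + 1) a b) := by
        rw [insertSum_succ d r, MonoidalPreadditive.whiskerLeft_add, Preadditive.add_comp,
          MonoidalCategory.whiskerLeft_id, Category.id_comp]
      rw [e, e₄, Preadditive.comp_add, ← e₅]
      abel

end HeisenbergRelations

end NormalOrdering

/-! ### The decomposition of `Qⁿ ⊗ Pᵇ` -/

section Decomposition

variable {C : Type*} [Category C] [MonoidalCategory C]
  [Preadditive C] [Linear ℂ C] [MonoidalPreadditive C] [MonoidalLinear ℂ C] {P Q : C}

namespace HeisenbergRelations

variable {c : P ⊗ P ⟶ P ⊗ P} {d : Q ⊗ Q ⟶ Q ⊗ Q} {s : P ⊗ Q ⟶ Q ⊗ P} {t : Q ⊗ P ⟶ P ⊗ Q}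
  {cup : 𝟙_ C ⟶ Q ⊗ P} {cap : Q ⊗ P ⟶ 𝟙_ C}

theorem whiskerLeft_comp_comp_zero {N S R : C}
    (W : N ⊗ S ⟶ tensorPow P 0 ⊗ R) {N' S' : C} (U : tensorPow P 0 ⊗ R ⟶ N' ⊗ S') :
    (α_ Q N S).hom ≫ (Q ◁ (W ≫ U)) ≫ (α_ Q N' S').inv = slideBackPart t W ≫ slidePart s U := by
  have h : slideRight t 0 ≫ slideLeft s 0 = 𝟙 _ := by simp [slideRight, slideLeft]
  calc _ = (α_ Q N S).hom ≫ Q ◁ W ⊗≫ (slideRight t 0 ≫ slideLeft s 0) ▷ R ⊗≫ Q ◁ U ⊗≫ 𝟙 _ := by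
        rw [h]
        monoidal
    _ = _ := by
        unfold slideBackPart slidePart
        monoidal

/-- The decomposition of `Q ⊗ e_{a+1}` inserted in the middle of a composite that is symmetrized
there. -/
theorem whiskerLeft_comp_comp_succ (H : HeisenbergRelations c d s t cup cap) {a : ℕ} {N S R : C}
    {W : N ⊗ S ⟶ tensorPow P (a + 1) ⊗ R} (hW : W ≫ (symmetrizer c (a + 1) ▷ R) = W) {N' S' : C}
    {U : tensorPow P (a + 1) ⊗ R ⟶ N' ⊗ S'} (hU : (symmetrizer c (a + 1) ▷ R) ≫ U = U) :
    (α_ Q N S).hom ≫ (Q ◁ (W ≫ U)) ≫ (α_ Q N' S').inv =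
      slideBackPart t W ≫ slidePart s U + ((a : ℂ) + 1) • (capPart cap W ≫ cupPart cup U) := by
  let F : (Q ⊗ tensorPow P (a + 1) ⟶ Q ⊗ tensorPow P (a + 1)) → ((Q ⊗ N) ⊗ S ⟶ (Q ⊗ N') ⊗ S') :=
    fun k => (α_ Q N S).hom ≫ (Q ◁ W) ≫ (α_ Q (tensorPow P (a + 1)) R).inv ≫ (k ▷ R) ≫
      (α_ Q (tensorPow P (a + 1)) R).hom ≫ (Q ◁ U) ≫ (α_ Q N' S').inv
  have hF : ∀ k, F ((Q ◁ symmetrizer c (a + 1)) ≫ k ≫ (Q ◁ symmetrizer c (a + 1))) = F k := by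
    intro k
    calc _ = (α_ Q N S).hom ≫ (Q ◁ (W ≫ (symmetrizer c (a + 1) ▷ R))) ≫
          (α_ Q (tensorPow P (a + 1)) R).inv ≫ (k ▷ R) ≫ (α_ Q (tensorPow P (a + 1)) R).hom ≫
            (Q ◁ ((symmetrizer c (a + 1) ▷ R) ≫ U)) ≫ (α_ Q N' S').inv := by
          simp only [F]
          monoidal
      _ = _ := by rw [hW, hU]
  have h := H.whiskerLeft_symmetrizer_succ a
  have e₁ : F (Q ◁ symmetrizer c (a + 1)) = (α_ Q N S).hom ≫ (Q ◁ (W ≫ U)) ≫ (α_ Q N' S').inv := by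
    calc _ = (α_ Q N S).hom ≫ (Q ◁ (W ≫ ((symmetrizer c (a + 1) ▷ R) ≫ U))) ≫ (α_ Q N' S').inv := by
          simp only [F]
          monoidal
      _ = _ := by rw [hU]
  have e₂ : F (slideRight t (a + 1) ≫ slideLeft s (a + 1)) =
      slideBackPart t W ≫ slidePart s U := by
    simp only [F]
    unfold slideBackPart slidePart
    monoidal
  have e₃ : F (capLeft cap (tensorPow P a) ≫ cupLeft cup (tensorPow P a)) =
      capPart cap W ≫ cupPart cup U := by
    simp only [F]
    unfold capPart cupPart
    monoidal
  have hadd : ∀ (k k' : Q ⊗ tensorPow P (a + 1) ⟶ Q ⊗ tensorPow P (a + 1)) (x : ℂ),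
      F (k + x • k') = F k + x • F k' := by
    intro k k' x
    simp only [F, MonoidalPreadditive.add_whiskerRight, Preadditive.add_comp, Preadditive.comp_add,
      MonoidalLinear.smul_whiskerRight, Linear.smul_comp, Linear.comp_smul]
  rw [← e₁, ← h, hadd, ← e₂, ← e₃, ← hF (slideRight t (a + 1) ≫ slideLeft s (a + 1)),
    ← hF (capLeft cap (tensorPow P a) ≫ cupLeft cup (tensorPow P a))]
  simp only [Category.assoc]

/-- The decomposition of the identity of `Qⁿ ⊗ Pᵇ`, after symmetrization.  In the induction step the
new strand `Q` is moved past `Pᵃ` in each term; the coefficient `(b - a)!` arises since the new cup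
is one of `b - a` cups. -/
theorem symSum_tensor_symmetrizer (H : HeisenbergRelations c d s t cup cap) : ∀ n b : ℕ,
    (symSum d n ▷ tensorPow P b) ≫ (tensorPow Q n ◁ symmetrizer c b) =
      ∑ r ∈ Finset.range (n + 1), ∑ a ∈ Finset.range (b + 1), ((b - a).factorial : ℂ) •
        (normalIn c t cap n r a b ≫ (tensorPow P a ◁ symSum d r) ≫ normalOut c s cup n r a b)
  | 0, b => by
    rw [Finset.sum_range_one, Finset.sum_eq_single b]
    · have e₁ : normalIn c t cap 0 0 b b = (λ_ (tensorPow P b)).hom ≫ symmetrizer c b ≫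
          (ρ_ (tensorPow P b)).inv := by
        unfold normalIn
        simp
      have e₂ : normalOut c s cup 0 0 b b = (ρ_ (tensorPow P b)).hom ≫ symmetrizer c b ≫
          (λ_ (tensorPow P b)).inv := by
        unfold normalOut
        simp
      rw [e₁, e₂, Nat.sub_self, Nat.factorial_zero, Nat.cast_one, one_smul]
      change (𝟙 _ ▷ _) ≫ _ = _ ≫ (_ ◁ 𝟙 _) ≫ _
      simp only [id_whiskerRight, MonoidalCategory.whiskerLeft_id, Category.id_comp,
        Category.assoc, Iso.inv_hom_id_assoc]
      rw [← Category.assoc (symmetrizer c b), symmetrizer_idem H.symmP]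
      simp
    · intro a _ ha
      rw [normalOut_zero_of_ne _ _ _ _ ha, Limits.comp_zero, Limits.comp_zero, smul_zero]
    · intro h
      exact absurd (Finset.mem_range.2 (Nat.lt_succ_self b)) h
  | n + 1, b => by
    have ih := symSum_tensor_symmetrizer H n b
    -- `X` are the terms in which the new strand slides through, `Y` those in which it is capped
    -- off; `G` adds the new strand on the left and inserts it at all positions
    let X : ℕ → ℕ → ((Q ⊗ tensorPow Q n) ⊗ tensorPow P b ⟶ (Q ⊗ tensorPow Q n) ⊗ tensorPow P b) :=
      fun r a => slideBackPart t (normalIn c t cap n r a b) ≫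
        (tensorPow P a ◁ symSum d (r + 1)) ≫ normalOut c s cup (n + 1) (r + 1) a b
    let Y : ℕ → ℕ → ((Q ⊗ tensorPow Q n) ⊗ tensorPow P b ⟶ (Q ⊗ tensorPow Q n) ⊗ tensorPow P b) :=
      fun r a => ((a : ℂ) + 1) • (capPart cap (normalIn c t cap n r (a + 1) b) ≫
        (tensorPow P a ◁ symSum d r) ≫ normalOut c s cup (n + 1) r a b)
    let Z : ℕ → ℕ → (tensorPow Q n ⊗ tensorPow P b ⟶ tensorPow Q n ⊗ tensorPow P b) :=
      fun r a => normalIn c t cap n r a b ≫ (tensorPow P a ◁ symSum d r) ≫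
        normalOut c s cup n r a b
    let G : (tensorPow Q n ⊗ tensorPow P b ⟶ tensorPow Q n ⊗ tensorPow P b) →ₗ[ℂ]
        ((Q ⊗ tensorPow Q n) ⊗ tensorPow P b ⟶ (Q ⊗ tensorPow Q n) ⊗ tensorPow P b) :=
      { toFun := fun k => ((α_ _ _ _).hom ≫ (Q ◁ k) ≫ (α_ _ _ _).inv) ≫
          (insertSum d n ▷ tensorPow P b)
        map_add' := fun k k' => by
          simp only [MonoidalPreadditive.whiskerLeft_add, Preadditive.add_comp,
            Preadditive.comp_add]
        map_smul' := fun x k => by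
          simp only [MonoidalLinear.whiskerLeft_smul, Linear.smul_comp, Linear.comp_smul,
            RingHom.id_apply] }
    have hU : ∀ r a, (symmetrizer c a ▷ tensorPow Q r) ≫ (tensorPow P a ◁ symSum d r) ≫
        normalOut c s cup n r a b = (tensorPow P a ◁ symSum d r) ≫ normalOut c s cup n r a b := by
      intro r a
      rw [← Category.assoc, ← whisker_exchange, Category.assoc, H.symmetrizer_comp_normalOut]
    have hslide : ∀ r a, slidePart s ((tensorPow P a ◁ symSum d r) ≫ normalOut c s cup n r a b) ≫
        (insertSum d n ▷ tensorPow P b) =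
          (tensorPow P a ◁ symSum d (r + 1)) ≫ normalOut c s cup (n + 1) (r + 1) a b := by
      intro r a
      rw [comp_slidePart, Category.assoc, H.slidePart_comp_insertSum, symSum_succ,
        MonoidalCategory.whiskerLeft_comp, Category.assoc]
    have hcup : ∀ r a, cupPart cup ((tensorPow P (a + 1) ◁ symSum d r) ≫
        normalOut c s cup n r (a + 1) b) ≫ (insertSum d n ▷ tensorPow P b) =
          ((b : ℂ) - a) • ((tensorPow P a ◁ symSum d r) ≫ normalOut c s cup (n + 1) r a b) := by
      intro r a
      rw [comp_cupPart, Category.assoc, H.cupPart_comp_insertSum, Linear.comp_smul]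
    have hG₀ : ∀ r, G (Z r 0) = X r 0 := by
      intro r
      change ((α_ _ _ _).hom ≫ (Q ◁ (_ ≫ _)) ≫ (α_ _ _ _).inv) ≫ _ = _
      rw [whiskerLeft_comp_comp_zero (s := s) (t := t), Category.assoc, hslide]
    have hG : ∀ r a, G (Z r (a + 1)) = X r (a + 1) + ((b : ℂ) - a) • Y r a := by
      intro r a
      change ((α_ _ _ _).hom ≫ (Q ◁ (_ ≫ _)) ≫ (α_ _ _ _).inv) ≫ _ = _
      rw [H.whiskerLeft_comp_comp_succ (H.normalIn_comp_symmetrizer n r (a + 1) b) (hU r (a + 1)),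
        Preadditive.add_comp, Category.assoc, hslide, Linear.smul_comp, Category.assoc, hcup,
        Linear.comp_smul, smul_comm]
    have hYn : ∀ a, Y (n + 1) a = 0 := by
      intro a
      simp only [Y]
      rw [normalIn_eq_zero _ _ _ _ _ _ _ (Or.inl (Nat.lt_succ_self n)), capPart_zero,
        Limits.zero_comp, smul_zero]
    have hYb : ∀ r, Y r b = 0 := by
      intro r
      simp only [Y]
      rw [normalIn_eq_zero _ _ _ _ _ _ _ (Or.inr (Nat.lt_succ_self b)), capPart_zero,
        Limits.zero_comp, smul_zero]
    have hU' : ∀ r a, (symmetrizer c a ▷ tensorPow Q r) ≫ (tensorPow P a ◁ symSum d r) ≫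
        normalOut c s cup (n + 1) r a b =
          (tensorPow P a ◁ symSum d r) ≫ normalOut c s cup (n + 1) r a b := by
      intro r a
      rw [← Category.assoc, ← whisker_exchange, Category.assoc, H.symmetrizer_comp_normalOut]
    have hR₀ : ∀ a, normalIn c t cap (n + 1) 0 a b ≫ (tensorPow P a ◁ symSum d 0) ≫
        normalOut c s cup (n + 1) 0 a b = Y 0 a := by
      intro a
      have e : normalIn c t cap (n + 1) 0 a b = ((a : ℂ) + 1) •
        (capPart cap (normalIn c t cap n 0 (a + 1) b) ≫ (symmetrizer c a ▷ tensorPow Q 0)) := rfl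
      rw [e, Linear.smul_comp, Category.assoc, hU']
    have hR : ∀ r a, normalIn c t cap (n + 1) (r + 1) a b ≫ (tensorPow P a ◁ symSum d (r + 1)) ≫
        normalOut c s cup (n + 1) (r + 1) a b = Y (r + 1) a + X r a := by
      intro r a
      have e : normalIn c t cap (n + 1) (r + 1) a b = ((a : ℂ) + 1) •
        (capPart cap (normalIn c t cap n (r + 1) (a + 1) b) ≫
          (symmetrizer c a ▷ tensorPow Q (r + 1))) +
        slideBackPart t (normalIn c t cap n r a b) ≫
          (symmetrizer c a ▷ tensorPow Q (r + 1)) := rfl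
      rw [e, Preadditive.add_comp, Linear.smul_comp, Category.assoc, Category.assoc, hU']
    have hL : (symSum d (n + 1) ▷ tensorPow P b) ≫ (tensorPow Q (n + 1) ◁ symmetrizer c b) =
        G ((symSum d n ▷ tensorPow P b) ≫ (tensorPow Q n ◁ symmetrizer c b)) := by
      change _ = ((α_ _ _ _).hom ≫ (Q ◁ (_ ≫ _)) ≫ (α_ _ _ _).inv) ≫ _
      calc _ = 𝟙 _ ⊗≫ Q ◁ symSum d n ▷ tensorPow P b ⊗≫ (insertSum d n ▷ tensorPow P b ≫
            (Q ⊗ tensorPow Q n) ◁ symmetrizer c b) := by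
            rw [symSum_succ]
            monoidal
        _ = _ := by
            rw [← whisker_exchange]
            monoidal
    -- this absorbs the number `b - a` of cups into the factorial
    have hfac : ∀ a ∈ Finset.range b,
        ((b - (a + 1)).factorial : ℂ) * ((b : ℂ) - a) = ((b - a).factorial : ℂ) := by
      intro a ha
      obtain ⟨k, rfl⟩ := Nat.exists_eq_add_of_lt (Finset.mem_range.1 ha)
      have e₁ : a + k + 1 - (a + 1) = k := by omega
      have e₂ : a + k + 1 - a = k + 1 := by omega
      rw [e₁, e₂, Nat.factorial_succ]
      push_cast
      ring
    have hL' : ∀ r, ∑ a ∈ Finset.range (b + 1), ((b - a).factorial : ℂ) • G (Z r a) =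
        ∑ a ∈ Finset.range (b + 1), ((b - a).factorial : ℂ) • (X r a + Y r a) := by
      intro r
      simp only [smul_add, Finset.sum_add_distrib]
      rw [Finset.sum_range_succ', Finset.sum_range_succ' (fun a => _ • X r a),
        Finset.sum_range_succ (fun a => _ • Y r a), hYb, smul_zero, add_zero, hG₀, add_right_comm,
        ← Finset.sum_add_distrib]
      refine congrArg (· + _) (Finset.sum_congr rfl fun a ha => ?_)
      rw [hG, smul_add, smul_smul, hfac a ha]
    rw [hL, ih]
    simp only [map_sum, map_smul]
    rw [Finset.sum_range_succ' _ (n + 1)]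
    simp only [hR, hR₀]
    refine (Finset.sum_congr rfl fun r _ => hL' r).trans ?_
    rw [Finset.sum_comm, Finset.sum_comm (s := Finset.range (n + 1)), ← Finset.sum_add_distrib]
    refine Finset.sum_congr rfl fun a _ => ?_
    simp only [← Finset.smul_sum, ← smul_add, Finset.sum_add_distrib]
    congr 1
    rw [add_comm, add_right_comm, ← Finset.sum_range_succ' (fun r => Y r a),
      Finset.sum_range_succ _ (n + 1), hYn, add_zero]

/-- The morphisms `normalOut` for different `r`, `a` are orthogonal to each other with respect to
`normalIn`.  In the induction step the cup of one meets the cap or the sliding strand of the other: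
equal kinds reproduce the two summands of Pascal's rule, mixed kinds compose to zero. -/
theorem normalOut_comp_normalIn (H : HeisenbergRelations c d s t cup cap) (b : ℕ) : ∀ n : ℕ,
    (∀ r a, normalOut c s cup n r a b ≫ normalIn c t cap n r a b =
      (if n + a = r + b then (n.choose r : ℂ) else 0) • (symmetrizer c a ▷ tensorPow Q r)) ∧
    (∀ r a r' a', ¬(r = r' ∧ a = a') →
      normalOut c s cup n r a b ≫ normalIn c t cap n r' a' b = 0)
  | 0 => by
    constructor
    · intro r a
      cases r with
      | zero =>
        by_cases h : a = b
        · subst h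
          have e₁ : normalIn c t cap 0 0 a a = (λ_ (tensorPow P a)).hom ≫ symmetrizer c a ≫
              (ρ_ (tensorPow P a)).inv := by
            unfold normalIn
            simp
          have e₂ : normalOut c s cup 0 0 a a = (ρ_ (tensorPow P a)).hom ≫ symmetrizer c a ≫
              (λ_ (tensorPow P a)).inv := by
            unfold normalOut
            simp
          rw [e₁, e₂, if_pos rfl, Nat.choose_self, Nat.cast_one, one_smul]
          simp only [Category.assoc, Iso.inv_hom_id_assoc]
          rw [← Category.assoc (symmetrizer c a), symmetrizer_idem H.symmP]
          simp
        · rw [normalOut_zero_of_ne _ _ _ _ h, if_neg (by omega), Limits.zero_comp, zero_smul]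
      | succ r =>
        rw [Nat.choose_zero_succ, Nat.cast_zero, ite_self, zero_smul]
        exact Limits.zero_comp
    · intro r a r' a' h
      cases r with
      | succ r => exact Limits.zero_comp
      | zero =>
        cases r' with
        | succ r' => exact Limits.comp_zero
        | zero =>
          by_cases h₁ : a = b
          · have e : normalIn c t cap 0 0 a' b = 0 := by
              unfold normalIn
              rw [dif_neg (by omega)]
            rw [e, Limits.comp_zero]
          · rw [normalOut_zero_of_ne _ _ _ _ h₁, Limits.zero_comp]
  | n + 1 => by
    obtain ⟨ih, ih'⟩ := normalOut_comp_normalIn H b n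
    -- cup against cap: a partial trace of the symmetrizer
    have hBC : ∀ r a, cupPart cup (normalOut c s cup n r (a + 1) b) ≫
        (((a : ℂ) + 1) • (capPart cap (normalIn c t cap n r (a + 1) b) ≫
          (symmetrizer c a ▷ tensorPow Q r))) =
        (if n + (a + 1) = r + b then (n.choose r : ℂ) else 0) •
          (symmetrizer c a ▷ tensorPow Q r) := by
      intro r a
      have e : (cupLeft cup (tensorPow P a) ▷ tensorPow Q r) ≫ (α_ Q _ _).hom ≫
          (Q ◁ (symmetrizer c (a + 1) ▷ tensorPow Q r)) ≫ (α_ Q _ _).inv ≫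
            (capLeft cap (tensorPow P a) ▷ tensorPow Q r) =
          (cupLeft cup (tensorPow P a) ≫ (Q ◁ symmetrizer c (a + 1)) ≫
            capLeft cap (tensorPow P a)) ▷ tensorPow Q r := by
        monoidal
      rw [Linear.comp_smul, ← Category.assoc, cupPart_comp_capPart, ih]
      simp only [MonoidalLinear.whiskerLeft_smul, Linear.smul_comp, Linear.comp_smul]
      rw [e, smul_comm, ← Linear.smul_comp, ← MonoidalLinear.smul_whiskerRight,
        H.partialTrace_symmetrizer, ← comp_whiskerRight, symmetrizer_idem H.symmP]
    have hBC' : ∀ r a r' a', ¬(r = r' ∧ a = a') → cupPart cup (normalOut c s cup n r (a + 1) b) ≫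
        (((a' : ℂ) + 1) • (capPart cap (normalIn c t cap n r' (a' + 1) b) ≫
          (symmetrizer c a' ▷ tensorPow Q r'))) = 0 := by
      intro r a r' a' h
      rw [Linear.comp_smul, ← Category.assoc, cupPart_comp_capPart, ih' _ _ _ _ (by omega)]
      simp
    -- cup against sliding strand
    have hBS : ∀ r a r' a', cupPart cup (normalOut c s cup n r (a + 1) b) ≫
        slideBackPart t (normalIn c t cap n r' a' b) ≫
          (symmetrizer c a' ▷ tensorPow Q (r' + 1)) = 0 := by
      intro r a r' a'
      rw [← Category.assoc, cupPart_comp_slideBackPart]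
      by_cases h : r = r' ∧ a + 1 = a'
      · obtain ⟨rfl, rfl⟩ := h
        have e : (cupLeft cup (tensorPow P a) ▷ tensorPow Q r) ≫ (α_ Q _ _).hom ≫
            (Q ◁ (symmetrizer c (a + 1) ▷ tensorPow Q r)) ≫ (α_ Q _ _).inv ≫
              (slideRight t (a + 1) ▷ tensorPow Q r) ≫ (α_ _ Q _).hom =
            ((cupLeft cup (tensorPow P a) ≫ (Q ◁ symmetrizer c (a + 1)) ≫
              slideRight t (a + 1)) ▷ tensorPow Q r) ≫ (α_ _ Q _).hom := by
          monoidal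
        rw [ih]
        simp only [MonoidalLinear.whiskerLeft_smul, Linear.smul_comp, Linear.comp_smul]
        rw [e, H.cupLeft_symmetrizer_slideRight]
        simp
      · rw [ih' _ _ _ _ h]
        simp
    -- sliding strand against cap: the strand is moved past the symmetrizer and meets `s ≫ cap = 0`
    have hSC : ∀ r a r' a' : ℕ, slidePart s (normalOut c s cup n r a b) ≫
        (((a' : ℂ) + 1) • (capPart cap (normalIn c t cap n r' (a' + 1) b) ≫
          (symmetrizer c a' ▷ tensorPow Q r'))) = 0 := by
      intro r a r' a'
      rw [Linear.comp_smul, ← Category.assoc, slidePart_comp_capPart]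
      by_cases h : r = r' ∧ a = a' + 1
      · obtain ⟨rfl, rfl⟩ := h
        have e : (α_ _ Q _).inv ≫ (slideLeft s (a' + 1) ▷ tensorPow Q r) ≫ (α_ Q _ _).hom ≫
            (Q ◁ (symmetrizer c (a' + 1) ▷ tensorPow Q r)) ≫ (α_ Q _ _).inv ≫
              (capLeft cap (tensorPow P a') ▷ tensorPow Q r) =
            (α_ _ Q _).inv ≫ ((slideLeft s (a' + 1) ≫ (Q ◁ symmetrizer c (a' + 1))) ≫
              capLeft cap (tensorPow P a')) ▷ tensorPow Q r := by
          monoidal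
        rw [ih]
        simp only [MonoidalLinear.whiskerLeft_smul, Linear.smul_comp, Linear.comp_smul]
        rw [e, ← (swapGen_symmetrizer (a' + 1)).whiskerRight_comp_slideLeft H.braid_PPQ,
          Category.assoc (symmetrizer c (a' + 1) ▷ Q), H.slideLeft_comp_capLeft]
        simp
      · rw [ih' _ _ _ _ h]
        simp
    -- sliding strand against sliding strand: the two crossings cancel
    have hSS : ∀ r a, slidePart s (normalOut c s cup n r a b) ≫
        slideBackPart t (normalIn c t cap n r a b) ≫ (symmetrizer c a ▷ tensorPow Q (r + 1)) =
        (if n + a = r + b then (n.choose r : ℂ) else 0) •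
          (symmetrizer c a ▷ tensorPow Q (r + 1)) := by
      intro r a
      have e : (α_ _ Q _).inv ≫ (slideLeft s a ▷ tensorPow Q r) ≫ (α_ Q _ _).hom ≫
          (Q ◁ (symmetrizer c a ▷ tensorPow Q r)) ≫ (α_ Q _ _).inv ≫
            (slideRight t a ▷ tensorPow Q r) ≫ (α_ _ Q _).hom =
          (α_ _ Q _).inv ≫ ((slideLeft s a ≫ (Q ◁ symmetrizer c a)) ≫
            slideRight t a) ▷ tensorPow Q r ≫ (α_ _ Q _).hom := by
        monoidal
      have e' : (α_ (tensorPow P a) Q (tensorPow Q r)).inv ≫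
          (symmetrizer c a ▷ Q) ▷ tensorPow Q r ≫ (α_ _ Q _).hom =
            symmetrizer c a ▷ tensorPow Q (r + 1) := by
        monoidal
      rw [← Category.assoc, slidePart_comp_slideBackPart, ih]
      simp only [MonoidalLinear.whiskerLeft_smul, Linear.smul_comp, Linear.comp_smul]
      rw [e, ← (swapGen_symmetrizer a).whiskerRight_comp_slideLeft H.braid_PPQ,
        Category.assoc (symmetrizer c a ▷ Q), slideLeft_comp_slideRight H.st, Category.comp_id,
        Category.assoc, Category.assoc, reassoc_of% e', ← comp_whiskerRight,
        symmetrizer_idem H.symmP]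
    have hSS' : ∀ r a r' a', ¬(r = r' ∧ a = a') → slidePart s (normalOut c s cup n r a b) ≫
        slideBackPart t (normalIn c t cap n r' a' b) ≫
          (symmetrizer c a' ▷ tensorPow Q (r' + 1)) = 0 := by
      intro r a r' a' h
      rw [← Category.assoc, slidePart_comp_slideBackPart, ih' _ _ _ _ h]
      simp
    constructor
    · intro r a
      cases r with
      | zero =>
        refine (hBC 0 a).trans ?_
        rw [Nat.choose_zero_right, Nat.choose_zero_right, add_right_comm n 1 a, add_assoc n a 1]
      | succ r =>
        have e := congrArg₂ (· + ·) (hBC (r + 1) a) (hSS r a)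
        refine Eq.trans ?_ (e.trans ?_)
        · have h₁ := hBS (r + 1) a r a
          have h₂ := hSC r a (r + 1) a
          conv_lhs => unfold normalOut normalIn
          simp only [Preadditive.add_comp, Preadditive.comp_add]
          erw [h₁, h₂]
          rw [add_zero, zero_add]
        · rw [← add_smul]
          congr 1
          by_cases h : n + a = r + b
          · rw [if_pos h, if_pos (by omega), if_pos (by omega), Nat.choose_succ_succ]
            push_cast
            ring
          · rw [if_neg h, if_neg (by omega), if_neg (by omega), add_zero]
    · intro r a r' a' h
      cases r with
      | zero =>
        cases r' with
        | zero => exact hBC' 0 a 0 a' h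
        | succ r' =>
          refine (Preadditive.comp_add _ _ _ _ _ _).trans ?_
          erw [hBC' 0 a (r' + 1) a' h, hBS 0 a r' a']
          exact add_zero _
      | succ r =>
        cases r' with
        | zero =>
          refine (Preadditive.add_comp _ _ _ _ _ _).trans ?_
          erw [hBC' (r + 1) a 0 a' h, hSC r a 0 a']
          exact add_zero _
        | succ r' =>
          refine (Preadditive.add_comp _ _ _ _ _ _).trans ?_
          refine (congrArg₂ (· + ·) (Preadditive.comp_add _ _ _ _ _ _)
            (Preadditive.comp_add _ _ _ _ _ _)).trans ?_
          erw [hBC' (r + 1) a (r' + 1) a' h, hBS (r + 1) a r' a', hSC r a (r' + 1) a',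
            hSS' r a r' a' (by omega)]
          rw [add_zero, add_zero]

end HeisenbergRelations

end Decomposition

/-! ### The trace of the Heisenberg category -/

section Trace

open Idempotents

theorem incl_map_add {X Y : Obj} (f g : X ⟶ Y) :
    incl.map (f + g) = incl.map f + incl.map g := rfl

theorem incl_map_smul {X Y : Obj} (r : ℂ) (f : X ⟶ Y) :
    incl.map (r • f) = r • incl.map f := rfl

/-- The class in the trace, as a linear map on the endomorphisms of an object. -/
def clsLinear (X : Obj) : (X ⟶ X) →ₗ[ℂ] Tr ℂ H where
  toFun f := cls f
  map_add' f g := by rw [cls, incl_map_add, map_add, cls, cls]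
  map_smul' r f := by rw [cls, incl_map_smul, map_smul, cls, RingHom.id_apply]

theorem cls_comp_comm {X Y : Obj} (f : X ⟶ Y) (g : Y ⟶ X) : cls (f ≫ g) = cls (g ≫ f) := by
  rw [cls, cls, Functor.map_comp, Functor.map_comp, trClass_comp_comm]

theorem cls_conj {X Y : Obj} (a : X ≅ Y) (f : X ⟶ X) (g : Y ⟶ Y)
    (h : f ≫ a.hom = a.hom ≫ g) : cls f = cls g :=
  trClass_conj (incl.mapIso a) _ _ (by
    rw [Functor.mapIso_hom, ← Functor.map_comp, h, Functor.map_comp])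

/-- The embedding of `H'` in its additive closure is compatible with tensor products: the tensor
product of two one-term sequences is the one-term sequence of their tensor product, up to the
index set. -/
def embeddingTensorIso (X Y : Obj) :
    (Mat_.embedding Obj).obj X ⊗ (Mat_.embedding Obj).obj Y ≅ (Mat_.embedding Obj).obj (X ⊗ Y) where
  hom := reindex (M := (Mat_.embedding Obj).obj X ⊗ (Mat_.embedding Obj).obj Y)
    (N := (Mat_.embedding Obj).obj (X ⊗ Y)) (fun _ => PUnit.unit) (fun _ => 𝟙 (X ⊗ Y))
  inv := reindex (M := (Mat_.embedding Obj).obj (X ⊗ Y))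
    (N := (Mat_.embedding Obj).obj X ⊗ (Mat_.embedding Obj).obj Y)
    (fun _ => (PUnit.unit, PUnit.unit)) (fun _ => 𝟙 (X ⊗ Y))
  hom_inv_id := by
    refine (reindex_comp_reindex (M := (Mat_.embedding Obj).obj X ⊗ (Mat_.embedding Obj).obj Y)
      (N := (Mat_.embedding Obj).obj (X ⊗ Y))
      (K := (Mat_.embedding Obj).obj X ⊗ (Mat_.embedding Obj).obj Y) _ _ _ _).trans ?_
    refine Eq.trans ?_ (reindex_id ((Mat_.embedding Obj).obj X ⊗ (Mat_.embedding Obj).obj Y))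
    exact congrArg (reindex (M := (Mat_.embedding Obj).obj X ⊗ (Mat_.embedding Obj).obj Y)
      (N := (Mat_.embedding Obj).obj X ⊗ (Mat_.embedding Obj).obj Y) (fun i => i))
        (funext fun _ => Category.comp_id (𝟙 (X ⊗ Y)))
  inv_hom_id := by
    refine (reindex_comp_reindex (M := (Mat_.embedding Obj).obj (X ⊗ Y))
      (N := (Mat_.embedding Obj).obj X ⊗ (Mat_.embedding Obj).obj Y)
      (K := (Mat_.embedding Obj).obj (X ⊗ Y)) _ _ _ _).trans ?_
    refine Eq.trans ?_ (reindex_id ((Mat_.embedding Obj).obj (X ⊗ Y)))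
    exact congrArg (reindex (M := (Mat_.embedding Obj).obj (X ⊗ Y))
      (N := (Mat_.embedding Obj).obj (X ⊗ Y)) (fun i => i))
        (funext fun _ => Category.comp_id (𝟙 (X ⊗ Y)))

theorem embeddingTensorIso_naturality {X Y : Obj} (f : X ⟶ X) (g : Y ⟶ Y) :
    ((Mat_.embedding Obj).map f ⊗ₘ (Mat_.embedding Obj).map g) ≫ (embeddingTensorIso X Y).hom =
      (embeddingTensorIso X Y).hom ≫ (Mat_.embedding Obj).map (f ⊗ₘ g) := by
  ext i j
  refine (comp_reindex_apply (M := (Mat_.embedding Obj).obj X ⊗ (Mat_.embedding Obj).obj Y)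
    (N := (Mat_.embedding Obj).obj X ⊗ (Mat_.embedding Obj).obj Y)
    (K := (Mat_.embedding Obj).obj (X ⊗ Y)) (fun _ => PUnit.unit)
      (fun x y _ => Subsingleton.elim (α := PUnit × PUnit) x y) _ _ _
    (PUnit.unit, PUnit.unit)).trans ?_
  refine Eq.trans ?_ (reindex_comp_apply (M := (Mat_.embedding Obj).obj X ⊗
    (Mat_.embedding Obj).obj Y) (N := (Mat_.embedding Obj).obj (X ⊗ Y)) _ _ _ _ _).symm
  exact (Category.comp_id (f ⊗ₘ g)).trans (Category.id_comp (f ⊗ₘ g)).symm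

theorem cls_mul_cls {X Y : Obj} (f : X ⟶ X) (g : Y ⟶ Y) : cls f * cls g = cls (f ⊗ₘ g) := by
  rw [cls, cls, cls, trClass_mul_trClass]
  have h' : (incl.obj X ⊗ incl.obj Y).p ≫ (embeddingTensorIso X Y).hom =
      (embeddingTensorIso X Y).hom :=
    (congrArg (· ≫ (embeddingTensorIso X Y).hom) (id_tensorHom_id _ _)).trans
      (Category.id_comp (embeddingTensorIso X Y).hom)
  have h : (incl.obj X ⊗ incl.obj Y).p ≫ (embeddingTensorIso X Y).hom =
      (embeddingTensorIso X Y).hom ≫ (incl.obj (X ⊗ Y)).p :=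
    h'.trans (Category.comp_id (embeddingTensorIso X Y).hom).symm
  refine trClass_conj (karoubiIso (X := incl.obj X ⊗ incl.obj Y) (Y := incl.obj (X ⊗ Y))
    (embeddingTensorIso X Y) h) _ _ ?_
  ext1
  exact (congrArg (((Mat_.embedding Obj).map f ⊗ₘ (Mat_.embedding Obj).map g) ≫ ·) h').trans
    ((embeddingTensorIso_naturality f g).trans
      (congrArg (· ≫ (Mat_.embedding Obj).map (f ⊗ₘ g)) h').symm)

end Trace

/-! ### The relations of the diagrammatic category -/

section Presentation

/-- A strand can be pulled across the cap, for a crossing turned to the left. -/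
theorem rotateLeft_cap {C : Type*} [Category C] [MonoidalCategory C] {P Q : C}
    {η : 𝟙_ C ⟶ P ⊗ Q} {ε : Q ⊗ P ⟶ 𝟙_ C}
    (hP : (λ_ P).inv ≫ (η ▷ P) ≫ (α_ P Q P).hom ≫ (P ◁ ε) ≫ (ρ_ P).hom = 𝟙 P)
    (c : P ⊗ P ⟶ P ⊗ P) :
    (α_ Q P P).inv ≫ (((ρ_ (Q ⊗ P)).inv ≫ ((Q ⊗ P) ◁ η) ≫
      (α_ Q P (P ⊗ Q)).hom ≫ (Q ◁ ((α_ P P Q).inv ≫ (c ▷ Q) ≫ (α_ P P Q).hom)) ≫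
        (α_ Q P (P ⊗ Q)).inv ≫ (ε ▷ (P ⊗ Q)) ≫ (λ_ (P ⊗ Q)).hom) ▷ P) ≫ (α_ P Q P).hom ≫
          (P ◁ ε) ≫ (ρ_ P).hom =
      (Q ◁ c) ≫ (α_ Q P P).inv ≫ (ε ▷ P) ≫ (λ_ P).hom := by
  calc _ = 𝟙 _ ⊗≫ Q ◁ P ◁ η ▷ P ⊗≫ Q ◁ c ▷ Q ▷ P ⊗≫ (ε ▷ (P ⊗ Q ⊗ P) ≫ 𝟙_ _ ◁ (P ◁ ε)) ⊗≫
        𝟙 _ := by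
        monoidal
    _ = 𝟙 _ ⊗≫ Q ◁ P ◁ η ▷ P ⊗≫ Q ◁ (c ▷ (Q ⊗ P) ≫ (P ⊗ P) ◁ ε) ⊗≫ ε ▷ P ⊗≫ 𝟙 _ := by
        rw [← whisker_exchange]
        monoidal
    _ = 𝟙 _ ⊗≫ Q ◁ P ◁ ((λ_ P).inv ≫ (η ▷ P) ≫ (α_ P Q P).hom ≫ (P ◁ ε) ≫ (ρ_ P).hom) ⊗≫
        Q ◁ c ⊗≫ ε ▷ P ⊗≫ 𝟙 _ := by
        rw [← whisker_exchange]
        monoidal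
    _ = _ := by
        rw [hP]
        monoidal

theorem zigzag_P : (ρ_ Obj.P).inv ≫ (Obj.P ◁ mk Diag.cupQP) ≫ (α_ Obj.P Obj.Q Obj.P).inv ≫
    (mk Diag.capPQ ▷ Obj.P) ≫ (λ_ Obj.P).hom = 𝟙 Obj.P := Quotient.sound Rel.zigzag_P_left

theorem isSymmetric_crossP : IsSymmetric crossP := by
  refine ⟨Quotient.sound Rel.cross_cross, ?_⟩
  have h : ((α_ Obj.P Obj.P Obj.P).inv ≫ (crossP ▷ Obj.P) ≫ (α_ Obj.P Obj.P Obj.P).hom) ≫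
      (Obj.P ◁ crossP) ≫
        ((α_ Obj.P Obj.P Obj.P).inv ≫ (crossP ▷ Obj.P) ≫ (α_ Obj.P Obj.P Obj.P).hom) =
      (Obj.P ◁ crossP) ≫
        ((α_ Obj.P Obj.P Obj.P).inv ≫ (crossP ▷ Obj.P) ≫ (α_ Obj.P Obj.P Obj.P).hom) ≫
          (Obj.P ◁ crossP) := Quotient.sound Rel.braid
  unfold YangBaxter
  rw [← cancel_mono (α_ Obj.P Obj.P Obj.P).hom]
  simpa only [Category.assoc, Iso.inv_hom_id, Category.comp_id] using h

theorem crossR_eq_rotate :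
    mk Diag.crossR = rotate (mk Diag.cupQP) (mk Diag.capPQ) crossP := rfl

/-- This is where the invariance of the crossing under a full turn enters: the downward crossing,
defined by turning the upward crossing to the left, may also be obtained by turning it to the
right. -/
theorem crossQ_eq_rotate :
    crossQ = rotate (mk Diag.cupQP) (mk Diag.capPQ) (mk Diag.crossR) :=
  Quotient.sound Rel.cross_cyclic

theorem yangBaxter_crossP_crossR : YangBaxter crossP (mk Diag.crossR) (mk Diag.crossR) :=
  isSymmetric_crossP.braid.rotate zigzag_P

theorem yangBaxter_crossR_crossQ : YangBaxter (mk Diag.crossR) (mk Diag.crossR) crossQ := by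
  have h := yangBaxter_crossP_crossR.rotate zigzag_P
  rwa [← crossR_eq_rotate, ← crossQ_eq_rotate] at h

theorem isSymmetric_crossQ : IsSymmetric crossQ := by
  constructor
  · rw [crossQ_eq_rotate, crossR_eq_rotate]
    exact rotate_rotate_sq zigzag_P (Quotient.sound Rel.zigzag_Q_right) isSymmetric_crossP.sq
  · have h := yangBaxter_crossR_crossQ.rotate zigzag_P
    rwa [← crossQ_eq_rotate] at h

theorem heisenbergRelations : HeisenbergRelations crossP crossQ (mk Diag.crossR) (mk Diag.crossL)
    (mk Diag.cupQP) (mk Diag.capQP) := by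
  -- the definition of the leftward crossing, with whiskerings for tensor products with identities
  have hL : mk Diag.crossL = (ρ_ (Obj.Q ⊗ Obj.P)).inv ≫ ((Obj.Q ⊗ Obj.P) ◁ mk Diag.cupPQ) ≫
      (α_ Obj.Q Obj.P (Obj.P ⊗ Obj.Q)).hom ≫ (Obj.Q ◁ ((α_ Obj.P Obj.P Obj.Q).inv ≫
        (crossP ▷ Obj.Q) ≫ (α_ Obj.P Obj.P Obj.Q).hom)) ≫
          (α_ Obj.Q Obj.P (Obj.P ⊗ Obj.Q)).inv ≫ (mk Diag.capQP ▷ (Obj.P ⊗ Obj.Q)) ≫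
            (λ_ (Obj.P ⊗ Obj.Q)).hom := rfl
  refine ⟨isSymmetric_crossP, isSymmetric_crossQ.sq, yangBaxter_crossP_crossR,
    yangBaxter_crossR_crossQ, cup_rotate zigzag_P crossP, ?_, ?_, ?_, ?_, ?_, ?_⟩
  · rw [crossQ_eq_rotate]
    exact cup_rotate zigzag_P _
  · rw [hL]
    exact rotateLeft_cap (Quotient.sound Rel.zigzag_P_right) crossP
  · exact Quotient.sound Rel.crossR_crossL
  · rw [sub_eq_add_neg]
    exact Quotient.sound Rel.crossL_crossR
  · exact Quotient.sound Rel.circle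
  · exact Quotient.sound Rel.curl

end Presentation

/-! ### Sums of permutation diagrams -/

section PermutationSums

/-- The two recursively defined tensor powers agree in each degree, but not by definition for a
variable exponent. -/
def powIso (X : Obj) : ∀ n : ℕ, pow X n ≅ tensorPow X n
  | 0 => Iso.refl _
  | n + 1 => whiskerLeftIso X (powIso X n)

theorem sum_insertStrand {X : Obj} (c : X ⊗ X ⟶ X ⊗ X) :
    ∀ n : ℕ, (∑ j : Fin (n + 1), insertStrand c j) ≫ (powIso X (n + 1)).hom =
      (powIso X (n + 1)).hom ≫ insertSum c n
  | 0 => (congrArg (· ≫ (powIso X 1).hom) (Fin.sum_univ_one _)).trans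
      ((Category.id_comp (powIso X 1).hom).trans (Category.comp_id (powIso X 1).hom).symm)
  | n + 1 => by
    have ih := congrArg (X ◁ ·) (sum_insertStrand c n)
    have h₁ : ∑ j : Fin (n + 2), insertStrand c j =
        𝟙 _ + crossHead c (pow X n) ≫ (X ◁ ∑ j : Fin (n + 1), insertStrand c j) := by
      rw [Fin.sum_univ_succ]
      refine congrArg₂ (· + ·) rfl ?_
      refine Eq.trans ?_ (congrArg (crossHead c (pow X n) ≫ ·)
        (whiskerLeft_sum X Finset.univ fun j : Fin (n + 1) => insertStrand c j)).symm
      refine Eq.trans ?_ (Preadditive.comp_sum _ _ _).symm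
      refine Finset.sum_congr rfl fun i _ => ?_
      change (α_ X X (pow X n)).inv ≫ (c ▷ pow X n) ≫ (α_ X X (pow X n)).hom ≫
          (X ◁ insertStrand c i) = ((α_ X X (pow X n)).inv ≫ (c ▷ pow X n) ≫
            (α_ X X (pow X n)).hom) ≫ (X ◁ insertStrand c i)
      simp only [Category.assoc]
    have h₂ : crossHead c (pow X n) ≫ (X ◁ X ◁ (powIso X n).hom) =
        (X ◁ X ◁ (powIso X n).hom) ≫ crossHead c (tensorPow X n) :=
      crossHead_comp_whiskerLeft c (powIso X n).hom
    refine (congrArg (· ≫ (powIso X (n + 2)).hom) h₁).trans ?_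
    rw [insertSum_succ, Preadditive.comp_add]
    refine (Preadditive.add_comp _ _ _ _ _ _).trans (congrArg₂ (· + ·) ?_ ?_)
    · exact (Category.id_comp (powIso X (n + 2)).hom).trans
        (Category.comp_id (powIso X (n + 2)).hom).symm
    · refine (Category.assoc _ _ _).trans ?_
      refine (congrArg (crossHead c (pow X n) ≫ ·) (((whiskerLeft_comp X _ _).symm.trans ih).trans
        (whiskerLeft_comp X _ _))).trans ?_
      refine (Category.assoc _ _ _).symm.trans ?_
      exact (congrArg (· ≫ X ◁ insertSum c n) h₂).trans (Category.assoc _ _ _)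

/-- A permutation is determined by the image of the first point and the permutation of the
rest. -/
theorem bijective_removeFirst (n : ℕ) :
    Function.Bijective fun w : Equiv.Perm (Fin (n + 1)) => (w 0, removeFirst w) := by
  rw [Fintype.bijective_iff_injective_and_card]
  constructor
  · intro v w h
    obtain ⟨h₀, h₁⟩ := Prod.mk.inj h
    ext i
    refine congrArg Fin.val (Fin.cases h₀ (fun j => ?_) i)
    rw [← succAbove_removeFirst, ← succAbove_removeFirst, h₀, h₁]
  · simp only [Fintype.card_prod, Fintype.card_perm, Fintype.card_fin, Nat.factorial_succ]

theorem sum_permDiagram {X : Obj} (c : X ⊗ X ⟶ X ⊗ X) :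
    ∀ n : ℕ, (∑ w : Equiv.Perm (Fin n), permDiagram c w) ≫ (powIso X n).hom =
      (powIso X n).hom ≫ symSum c n
  | 0 => (congrArg (· ≫ (powIso X 0).hom) (Fintype.sum_unique _)).trans
      ((Category.id_comp (powIso X 0).hom).trans (Category.comp_id (powIso X 0).hom).symm)
  | n + 1 => by
    have ih := congrArg (X ◁ ·) (sum_permDiagram c n)
    have h : ∑ w : Equiv.Perm (Fin (n + 1)), permDiagram c w =
        ∑ x : Fin (n + 1) × Equiv.Perm (Fin n), (X ◁ permDiagram c x.2) ≫ insertStrand c x.1 :=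
      Fintype.sum_bijective _ (bijective_removeFirst n) _ _ fun w => rfl
    have h' : ∑ w : Equiv.Perm (Fin (n + 1)), permDiagram c w =
        (X ◁ ∑ w : Equiv.Perm (Fin n), permDiagram c w) ≫
          ∑ j : Fin (n + 1), insertStrand c j := by
      refine h.trans ((Fintype.sum_prod_type_right _).trans ?_)
      refine Eq.trans ?_ (congrArg (· ≫ _)
        (whiskerLeft_sum X Finset.univ fun w : Equiv.Perm (Fin n) => permDiagram c w)).symm
      refine Eq.trans ?_ (Preadditive.sum_comp _ _ _).symm
      exact Finset.sum_congr rfl fun w _ =>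
        (Preadditive.comp_sum Finset.univ (X ◁ permDiagram c w)
          fun j : Fin (n + 1) => insertStrand c j).symm
    refine (congrArg (· ≫ (powIso X (n + 1)).hom) h').trans ?_
    refine (Category.assoc _ _ _).trans ?_
    refine (congrArg ((X ◁ ∑ w : Equiv.Perm (Fin n), permDiagram c w) ≫ ·)
      (sum_insertStrand c n)).trans ?_
    refine (Category.assoc _ _ _).symm.trans ?_
    refine (congrArg (· ≫ insertSum c n) (((whiskerLeft_comp X _ _).symm.trans ih).trans
      (whiskerLeft_comp X _ _))).trans ?_
    exact Category.assoc _ _ _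

theorem cls_permDiagram {X : Obj} (c : X ⊗ X ⟶ X ⊗ X) (n : ℕ) :
    ∑ w : Equiv.Perm (Fin n), cls (permDiagram c w) = cls (symSum c n) :=
  (map_sum (clsLinear (pow X n)) (fun w : Equiv.Perm (Fin n) => permDiagram c w) _).symm.trans
    (cls_conj (powIso X n) _ _ (sum_permDiagram c n))

end PermutationSums

/-! ### The relations in the trace -/

section TraceRelations

theorem p_eq (n : ℕ) : p n = (1 / (n.factorial : ℂ)) • cls (symSum crossP n) :=
  congrArg ((1 / (n.factorial : ℂ)) • ·) (cls_permDiagram crossP n)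

theorem q_eq (n : ℕ) : q n = (1 / (n.factorial : ℂ)) • cls (symSum crossQ n) :=
  congrArg ((1 / (n.factorial : ℂ)) • ·) (cls_permDiagram crossQ n)

theorem p_eq_cls_symmetrizer (n : ℕ) : p n = cls (symmetrizer crossP n) :=
  (p_eq n).trans
    ((clsLinear (tensorPow Obj.P n)).map_smul (1 / (n.factorial : ℂ)) (symSum crossP n)).symm

theorem cls_symSum_mul_comm {X : Obj} {c : X ⊗ X ⟶ X ⊗ X} (hc : IsSymmetric c) (m n : ℕ) :
    cls (symSum c m) * cls (symSum c n) = cls (symSum c n) * cls (symSum c m) := by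
  obtain ⟨σ, hσ⟩ := exists_braiding hc m n
  rw [cls_mul_cls, cls_mul_cls, cls_conj σ _ _ hσ]

theorem p_mul_p (n m : ℕ) : p n * p m = p m * p n := by
  rw [p_eq, p_eq, smul_mul_smul_comm, smul_mul_smul_comm,
    cls_symSum_mul_comm isSymmetric_crossP n m, mul_comm (1 / (n.factorial : ℂ))]

theorem q_mul_q (n m : ℕ) : q n * q m = q m * q n := by
  rw [q_eq, q_eq, smul_mul_smul_comm, smul_mul_smul_comm,
    cls_symSum_mul_comm isSymmetric_crossQ n m, mul_comm (1 / (n.factorial : ℂ))]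

/-- By cyclicity of the trace, each term of the decomposition of `Qⁿ ⊗ Pᵇ` contributes a multiple
of a product in the opposite order. -/
theorem cls_normalIn_normalOut (n r a b : ℕ) :
    cls (normalIn crossP (mk Diag.crossL) (mk Diag.capQP) n r a b ≫
        (tensorPow Obj.P a ◁ symSum crossQ r) ≫
          normalOut crossP (mk Diag.crossR) (mk Diag.cupQP) n r a b) =
      if n + a = r + b then ((n.choose r * r.factorial : ℕ) : ℂ) • (p a * q r) else 0 := by
  rw [cls_comp_comm, Category.assoc, (heisenbergRelations.normalOut_comp_normalIn b n).1 r a,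
    Linear.comp_smul]
  refine ((clsLinear _).map_smul _ _).trans ?_
  change _ • cls ((tensorPow Obj.P a ◁ symSum crossQ r) ≫
    (symmetrizer crossP a ▷ tensorPow Obj.Q r)) = _
  rw [whisker_exchange, ← MonoidalCategory.tensorHom_def, ← cls_mul_cls, ← p_eq_cls_symmetrizer]
  have hr : (r.factorial : ℂ) ≠ 0 := Nat.cast_ne_zero.2 r.factorial_ne_zero
  have hq : cls (symSum crossQ r) = (r.factorial : ℂ) • q r := by
    rw [q_eq, smul_smul, mul_one_div_cancel hr, one_smul]
  rw [hq, mul_smul_comm, smul_smul]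
  split_ifs with h
  · rw [Nat.cast_mul]
  · rw [zero_mul, zero_smul]

theorem q_mul_p (n m : ℕ) :
    q n * p m = ∑ k ∈ Finset.range (min m n + 1), p (m - k) * q (n - k) := by
  have hn : (n.factorial : ℂ) ≠ 0 := Nat.cast_ne_zero.2 n.factorial_ne_zero
  have h₁ : q n * p m = (1 / (n.factorial : ℂ)) •
      ∑ r ∈ Finset.range (n + 1), ∑ a ∈ Finset.range (m + 1), ((m - a).factorial : ℂ) •
        (if n + a = r + m then ((n.choose r * r.factorial : ℕ) : ℂ) • (p a * q r) else 0) := by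
    rw [q_eq, p_eq_cls_symmetrizer, smul_mul_assoc, cls_mul_cls, MonoidalCategory.tensorHom_def,
      heisenbergRelations.symSum_tensor_symmetrizer n m]
    congr 1
    refine (map_sum (clsLinear _) _ _).trans (Finset.sum_congr rfl fun r _ => ?_)
    refine (map_sum (clsLinear _) _ _).trans (Finset.sum_congr rfl fun a _ => ?_)
    refine ((clsLinear _).map_smul _ _).trans (congrArg (((m - a).factorial : ℂ) • ·) ?_)
    exact cls_normalIn_normalOut n r a m
  rw [h₁, ← Finset.sum_product', Finset.smul_sum]
  simp only [smul_ite, smul_zero]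
  rw [← Finset.sum_filter]
  refine Finset.sum_nbij' (fun x => m - x.2) (fun k => (n - k, m - k)) ?_ ?_ ?_ ?_ ?_
  · rintro ⟨r, a⟩ h
    simp only [Finset.mem_filter, Finset.mem_product, Finset.mem_range] at h ⊢
    omega
  · intro k h
    simp only [Finset.mem_filter, Finset.mem_product, Finset.mem_range] at h ⊢
    omega
  · rintro ⟨r, a⟩ h
    simp only [Finset.mem_filter, Finset.mem_product, Finset.mem_range] at h
    exact Prod.ext (by dsimp only; omega) (by dsimp only; omega)
  · intro k h
    simp only [Finset.mem_range] at h
    dsimp only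
    omega
  · rintro ⟨r, a⟩ h
    simp only [Finset.mem_filter, Finset.mem_product, Finset.mem_range] at h
    obtain ⟨⟨hr, ha⟩, h⟩ := h
    dsimp only
    have e₁ : m - (m - a) = a := by omega
    have e₂ : n - (m - a) = r := by omega
    have e₃ : m - a = n - r := by omega
    rw [e₁, e₂, e₃, smul_smul, smul_smul]
    -- with `k` caps the coefficient is `(1 / n!) * k! * (n choose r) * r!`, where `k + r = n`
    have e₄ : (1 / (n.factorial : ℂ)) * ((n - r).factorial : ℂ) *
        ((n.choose r * r.factorial : ℕ) : ℂ) = 1 := by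
      rw [mul_assoc, ← Nat.cast_mul, mul_comm (n - r).factorial,
        Nat.choose_mul_factorial_mul_factorial (by omega : r ≤ n), one_div_mul_cancel hn]
    rw [e₄, one_smul]

end TraceRelations

end Heisenberg

end

theorem mainTheorem3 :
    (∀ n m : ℕ, Heisenberg.p n * Heisenberg.p m = Heisenberg.p m * Heisenberg.p n) ∧
    (∀ n m : ℕ, Heisenberg.q n * Heisenberg.q m = Heisenberg.q m * Heisenberg.q n) ∧
    (∀ n m : ℕ, Heisenberg.q n * Heisenberg.p m =
      ∑ k ∈ Finset.range (min m n + 1), Heisenberg.p (m - k) * Heisenberg.q (n - k)) :=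
  ⟨Heisenberg.p_mul_p, Heisenberg.q_mul_q, Heisenberg.q_mul_p⟩
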